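/- Orthologic is the following sequent calculus. Terms are built from variables $x_0,x_1,\dots$ and the constants $0,1$ with $\neg,\land,\lor$ (the children of $\land$ and $\lor$ are unordered). An annotated formula is $\varphi^L$ or $\varphi^R$ with $\varphi$ a term, and a sequent is a set of at most two annotated formulas. Let $\Gamma,\Delta$ stand for sets of at most one annotated formula. Given a set $A$ of sequents (axioms), the rules are: every axiom, $\varphi^L,\varphi^R$, $0^L$ and $1^R$ are derivable; Cut (from $\Gamma,\psi^R$ and $\psi^L,\Delta$ infer $\Gamma,\Delta$); Weaken (from $\Gamma$ infer $\Gamma,\Delta$); from $\Gamma,\varphi^L$ infer $\Gamma,(\varphi\land\psi)^L$; from $\Gamma,\varphi^R$ and $\Gamma,\psi^R$ infer $\Gamma,(\varphi\land\psi)^R$; from $\Gamma,\varphi^L$ and $\Gamma,\psi^L$ infer $\Gamma,(\varphi\lor\psi)^L$; from $\Gamma,\varphi^R$ infer $\Gamma,(\varphi\lor\psi)^R$; from $\Gamma,\varphi^R$ infer $\Gamma,(\neg\varphi)^L$; from $\Gamma,\varphi^L$ infer $\Gamma,(\neg\varphi)^R$. **Theorem.** There is a single algorithm on a word RAM (unit-cost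 instructions, words of $O(\log \ell)$ bits where $\ell$ is the length of the input string, each input symbol fitting in one word) with the following two properties. 1. Given a finite list $A$ of axiom sequents and a sequent $S$, it decides whether $S$ is provable in orthologic from $A$, in time $O\big((1+|A|)\,n^2\big)$. Here $|A|$ is the number of axioms and $n$ is the size of the problem, that is, the total number of occurrences of subformulas in $S$ and in the axioms (with $n$ replaced by $1$ if it is $0$). 2. It solves the uniform word problem for finitely presented ortholattices in cubic time: given a finite list of relations $\varphi_i\le\psi_i$ and terms $\varphi,\psi$, it decides in time $O(n^3)$ whether $\varphi\le\psi$ holds in every ortholattice under every assignment of the variables that satisfies all $\varphi_i\le\psi_i$. Here $n$ is the total number of occurrences of subformulas in the $\varphi_i,\psi_i,\varphi,\psi$. -/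

import Mathlib

namespace OL

/-! ### Terms, annotated formulas and sequents -/

/-- Terms over the signature of ortholattices, with variables `var 0, var 1, …`. -/
inductive Term : Type
  | var (i : ℕ) : Term
  | bot : Term
  | top : Term
  | neg (φ : Term) : Term
  | and (φ ψ : Term) : Term
  | or (φ ψ : Term) : Term

/-- The number of (occurrences of) subformulas of a term, that is, the number of its symbols. -/
def Term.size : Term → ℕ
  | .var _ => 1
  | .bot => 1
  | .top => 1
  | .neg φ => φ.size + 1
  | .and φ ψ => φ.size + ψ.size + 1
  | .or φ ψ => φ.size + ψ.size + 1

/-- Annotated formulas: `L φ` is `φ` on the left side of a sequent, `R φ` is `φ` on the right. -/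
inductive AFormula : Type
  | L (φ : Term) : AFormula
  | R (φ : Term) : AFormula

open AFormula

/-- The sequent `Γ, Δ`: a set of at most two annotated formulas. Each of `Γ`, `Δ` is empty
(`none`) or consists of one annotated formula. -/
def sequent (Γ Δ : Option AFormula) : Set AFormula := {x | Γ = some x ∨ Δ = some x}

/-- Derivability in orthologic from a set `A` of sequents (the axioms).

Children of a conjunction or disjunction are unordered, so `LeftAnd` and `RightOr` apply to either
child. The rules `leftBot` and `rightTop` are those of the constants `0` and `1`. -/
inductive Provable (A : Set (Set AFormula)) : Set AFormula → Prop
  | hyp (φ : Term) : Provable A (sequent (some (L φ)) (some (R φ)))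
  | ax (Γ Δ : Option AFormula) : sequent Γ Δ ∈ A → Provable A (sequent Γ Δ)
  | cut (Γ Δ : Option AFormula) (ψ : Term) :
      Provable A (sequent Γ (some (R ψ))) → Provable A (sequent (some (L ψ)) Δ) →
      Provable A (sequent Γ Δ)
  | weaken (Γ Δ : Option AFormula) : Provable A (sequent Γ none) → Provable A (sequent Γ Δ)
  | leftAnd₁ (Γ : Option AFormula) (φ ψ : Term) :
      Provable A (sequent Γ (some (L φ))) → Provable A (sequent Γ (some (L (.and φ ψ))))
  | leftAnd₂ (Γ : Option AFormula) (φ ψ : Term) :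
      Provable A (sequent Γ (some (L ψ))) → Provable A (sequent Γ (some (L (.and φ ψ))))
  | rightAnd (Γ : Option AFormula) (φ ψ : Term) :
      Provable A (sequent Γ (some (R φ))) → Provable A (sequent Γ (some (R ψ))) →
      Provable A (sequent Γ (some (R (.and φ ψ))))
  | leftOr (Γ : Option AFormula) (φ ψ : Term) :
      Provable A (sequent Γ (some (L φ))) → Provable A (sequent Γ (some (L ψ))) →
      Provable A (sequent Γ (some (L (.or φ ψ))))
  | rightOr₁ (Γ : Option AFormula) (φ ψ : Term) :
      Provable A (sequent Γ (some (R φ))) → Provable A (sequent Γ (some (R (.or φ ψ))))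
  | rightOr₂ (Γ : Option AFormula) (φ ψ : Term) :
      Provable A (sequent Γ (some (R ψ))) → Provable A (sequent Γ (some (R (.or φ ψ))))
  | leftNot (Γ : Option AFormula) (φ : Term) :
      Provable A (sequent Γ (some (R φ))) → Provable A (sequent Γ (some (L (.neg φ))))
  | rightNot (Γ : Option AFormula) (φ : Term) :
      Provable A (sequent Γ (some (L φ))) → Provable A (sequent Γ (some (R (.neg φ))))
  | leftBot : Provable A (sequent none (some (L .bot)))
  | rightTop : Provable A (sequent none (some (R .top)))

/-! ### Ortholattices -/

/-- Ortholattices: bounded lattices with an antitone involutive complementation. -/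
class Ortholattice (α : Type*) extends Lattice α, BoundedOrder α, Compl α where
  compl_compl : ∀ x : α, xᶜᶜ = x
  compl_le_compl : ∀ x y : α, x ≤ y → yᶜ ≤ xᶜ
  inf_compl_le_bot : ∀ x : α, x ⊓ xᶜ ≤ ⊥
  top_le_sup_compl : ∀ x : α, ⊤ ≤ x ⊔ xᶜ

/-- The value of a term in an ortholattice under an assignment of the variables. -/
def Term.eval {α : Type*} [Ortholattice α] (v : ℕ → α) : Term → α
  | .var i => v i
  | .bot => ⊥
  | .top => ⊤
  | .neg φ => (φ.eval v)ᶜ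
  | .and φ ψ => φ.eval v ⊓ ψ.eval v
  | .or φ ψ => φ.eval v ⊔ ψ.eval v

/-! ### Problem instances, their size, and their encoding as strings of symbols -/

/-- A symbolic presentation of a sequent. -/
abbrev Seq : Type := Option AFormula × Option AFormula

/-- The sequent (a set of annotated formulas) that is presented. -/
def Seq.toSet (S : Seq) : Set AFormula := sequent S.1 S.2

def AFormula.size : AFormula → ℕ
  | L φ => φ.size
  | R φ => φ.size

def slotSize : Option AFormula → ℕ
  | none => 0
  | some x => x.size

def Seq.size (S : Seq) : ℕ := slotSize S.1 + slotSize S.2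

/-- An instance of the provability problem: a finite list of axioms and a goal sequent. -/
structure Problem : Type where
  axs : List Seq
  goal : Seq

/-- The set of axioms of the instance. -/
def Problem.axiomSet (P : Problem) : Set (Set AFormula) := {S | ∃ a ∈ P.axs, S = a.toSet}

/-- The number of subformulas of the goal and of all axioms. -/
def Problem.size (P : Problem) : ℕ := P.goal.size + (P.axs.map Seq.size).sum

/-- A term in reverse Polish notation, one number for each symbol. The numbers `0`, `1`, `2` are
kept for the punctuation of sequents. -/
def Term.encode : Term → List ℕ
  | .bot => [3]
  | .top => [4]
  | .neg φ => φ.encode ++ [5]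
  | .and φ ψ => φ.encode ++ ψ.encode ++ [6]
  | .or φ ψ => φ.encode ++ ψ.encode ++ [7]
  | .var i => [i + 8]

/-- The side annotation follows the term: `1` for left, `2` for right. -/
def AFormula.encode : AFormula → List ℕ
  | L φ => φ.encode ++ [1]
  | R φ => φ.encode ++ [2]

def slotEncode : Option AFormula → List ℕ
  | none => []
  | some x => x.encode

/-- A sequent is written as its annotated formulas, followed by the end mark `0`. -/
def Seq.encode (S : Seq) : List ℕ := slotEncode S.1 ++ slotEncode S.2 ++ [0]

/-- The goal, followed by the axioms. -/
def Problem.encode (P : Problem) : List ℕ := P.goal.encode ++ P.axs.flatMap Seq.encode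

/-- An instance of the uniform word problem for finitely presented ortholattices: a finite list of
relations `φ ≤ ψ`, and an inequality `lhs ≤ rhs` between terms. -/
structure WordProblem : Type where
  rels : List (Term × Term)
  lhs : Term
  rhs : Term

/-- The number of subformulas of the relations and of the query. -/
def WordProblem.size (W : WordProblem) : ℕ :=
  W.lhs.size + W.rhs.size + (W.rels.map fun r => r.1.size + r.2.size).sum

/-- The query holds in every ortholattice, for every assignment that satisfies the relations. -/
def WordProblem.Holds (W : WordProblem) : Prop :=
  ∀ (α : Type*) [Ortholattice α] (v : ℕ → α),
    (∀ r ∈ W.rels, r.1.eval v ≤ r.2.eval v) → W.lhs.eval v ≤ W.rhs.eval v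

/-- Each inequality `φ ≤ ψ` is written as the sequent with `φ` on the left and `ψ` on the right. -/
def WordProblem.encode (W : WordProblem) : List ℕ :=
  (W.lhs.encode ++ [1] ++ W.rhs.encode ++ [2] ++ [0]) ++
    W.rels.flatMap fun r => r.1.encode ++ [1] ++ r.2.encode ++ [2] ++ [0]

/-! ### The word RAM

Registers and memory cells hold words of `w` bits, that is, natural numbers below `2 ^ w`; a word
addresses a memory cell. Programs are written with structured control flow. Every instruction and
every evaluation of a test takes one unit of time. -/

inductive Op : Type
  | add | sub | mul

/-- Arithmetic on `w`-bit words (modulo `2 ^ w`). -/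
def Op.apply (w : ℕ) : Op → ℕ → ℕ → ℕ
  | .add, x, y => (x + y) % 2 ^ w
  | .sub, x, y => (x + (2 ^ w - y)) % 2 ^ w
  | .mul, x, y => x * y % 2 ^ w

structure State : Type where
  reg : ℕ → ℕ
  mem : ℕ → ℕ

def State.setReg (s : State) (d x : ℕ) : State := { s with reg := Function.update s.reg d x }

def State.setMem (s : State) (a x : ℕ) : State := { s with mem := Function.update s.mem a x }

/-- Comparisons of two registers. -/
inductive Test : Type
  | lt (a b : ℕ) : Test
  | eq (a b : ℕ) : Test

def Test.Sat (s : State) : Test → Prop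
  | .lt a b => s.reg a < s.reg b
  | .eq a b => s.reg a = s.reg b

/-- Programs. Numbers `d`, `a`, `b` are names of registers. -/
inductive Prog : Type
  /-- `d := k` -/
  | const (d k : ℕ) : Prog
  /-- `d := a ∘ b` -/
  | op (o : Op) (d a b : ℕ) : Prog
  /-- `d := mem[a]` -/
  | load (d a : ℕ) : Prog
  /-- `mem[a] := b` -/
  | store (a b : ℕ) : Prog
  | seq (p q : Prog) : Prog
  | ite (c : Test) (p q : Prog) : Prog
  | while (c : Test) (p : Prog) : Prog

/-- `Exec w p s t s'`: on words of `w` bits, the program `p` started in the state `s` halts after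
exactly `t` steps in the state `s'`. -/
inductive Exec (w : ℕ) : Prog → State → ℕ → State → Prop
  | const (d k : ℕ) (s : State) : Exec w (.const d k) s 1 (s.setReg d (k % 2 ^ w))
  | op (o : Op) (d a b : ℕ) (s : State) :
      Exec w (.op o d a b) s 1 (s.setReg d (o.apply w (s.reg a) (s.reg b)))
  | load (d a : ℕ) (s : State) : Exec w (.load d a) s 1 (s.setReg d (s.mem (s.reg a)))
  | store (a b : ℕ) (s : State) : Exec w (.store a b) s 1 (s.setMem (s.reg a) (s.reg b))
  | seq {p q : Prog} {s s' s'' : State} {t t' : ℕ} :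
      Exec w p s t s' → Exec w q s' t' s'' → Exec w (.seq p q) s (t + t') s''
  | ite_true {c : Test} {p : Prog} (q : Prog) {s s' : State} {t : ℕ} :
      c.Sat s → Exec w p s t s' → Exec w (.ite c p q) s (t + 1) s'
  | ite_false {c : Test} (p : Prog) {q : Prog} {s s' : State} {t : ℕ} :
      ¬ c.Sat s → Exec w q s t s' → Exec w (.ite c p q) s (t + 1) s'
  | while_true {c : Test} {p : Prog} {s s' s'' : State} {t t' : ℕ} :
      c.Sat s → Exec w p s t s' → Exec w (.while c p) s' t' s'' →
      Exec w (.while c p) s (t + t' + 1) s''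
  | while_false {c : Test} (p : Prog) {s : State} :
      ¬ c.Sat s → Exec w (.while c p) s 1 s

/-- The input string is in the first memory cells and its length in register `0`; all other cells
and registers hold `0`. -/
def initState (input : List ℕ) : State where
  reg := fun r => if r = 0 then input.length else 0
  mem := fun i => input.getD i 0

/-- On words of `w` bits and the given input, the program halts within `T` steps, with `1` in
register `0` if `Q` is true and with `0` in register `0` if `Q` is false. -/
def DecidesWithin (w : ℕ) (p : Prog) (input : List ℕ) (T : ℕ) (Q : Prop) : Prop :=
  ∃ (t : ℕ) (s : State), Exec w p (initState input) t s ∧ t ≤ T ∧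
    (Q → s.reg 0 = 1) ∧ (¬ Q → s.reg 0 = 0)

/-- Words of `w` bits are admissible for the input with constant `K`: the word length is at least
`K` times one plus the binary logarithm of the input length, and every input symbol (in particular
every variable name) fits in one word. -/
def WordsFit (K w : ℕ) (input : List ℕ) : Prop :=
  K * (Nat.log 2 input.length + 1) ≤ w ∧ ∀ x ∈ input, x < 2 ^ w

end OL

/-! Call two annotated formulas orthogonal if the sequent formed by them is provable. Orthogonality
is symmetric, and by weakening a formula orthogonal to itself is orthogonal to everything. The
closed sets of any relation with these two properties form an ortholattice (`IsOrtho.ortholattice`).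
The theorem rests on the fact that a relation generated by few inferences is already complete. Its
points are the occurrences of subformulas in the problem, each with a left and a right annotation.
The inferences are symmetry, weakening, the logical rules read from children to parent in the syntax
trees, and cuts only on formulas that are themselves members of the goal or of an axiom.

In the lattice of closed sets, with variables evaluated by means of their occurrences, the left node
of `φ` lies in the extent of the value of `φ` and the right node in its intent
(`ClosedAt.mem_eval`). This is a semantic form of cut elimination, since no cut on `φ` is used.
Where cuts on `φ` are available, its node determines the value completely (`CutAt.mem_eval`). Hence
the axioms hold in this model, and if the goal holds there, its two nodes are related. Together with
soundness (`Provable.seqHolds`) a circle closes: related goal nodes yield a proof, a proof yields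
validity in every ortholattice that satisfies the axioms, and validity yields related goal nodes. So
both problems amount to computing the relation (`Decides.provable_iff`, `Decides.holds_iff`).

For the running time, there are O(n) nodes and O(n²) pairs once empty axioms are set aside. A queue
receives each pair at most once, and a matrix tests membership in unit time. An occurrence has only
one parent, so a node is a premise of at most one logical rule, and these rules cost O(1) per pair.
A pair `x, x` costs O(n) for weakening, and there are O(n) of them. A pair `x, y` costs O(n) for
cuts only if `y` is one of the at most 4(1+|A|) nodes on which cuts are made. The sum is
O((1+|A|)n²) (`sum_pairCost_le`). An empty axiom proves everything and is treated separately;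
without empty axioms |A| ≤ n, so the input has length O(n). For the word problem 1+|A| ≤ n, and the
bound becomes cubic.

The program is verified against abstract tables and a queue (`Rep`), with weakest preconditions for
code without loops and a potential for the loops. -/

namespace OL

open AFormula

/-! ### Soundness of orthologic -/

section Semantics

variable {α : Type*} [Ortholattice α]

theorem Ortholattice.compl_bot' : (⊥ : α)ᶜ = ⊤ := by
  apply top_unique
  have h := Ortholattice.compl_le_compl (⊥ : α) (⊤ : α)ᶜ bot_le
  rwa [Ortholattice.compl_compl] at h

theorem Ortholattice.compl_top' : (⊤ : α)ᶜ = ⊥ := by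
  rw [← Ortholattice.compl_bot', Ortholattice.compl_compl]

theorem Ortholattice.le_compl_comm {a b : α} (h : a ≤ bᶜ) : b ≤ aᶜ := by
  have := Ortholattice.compl_le_compl _ _ h
  rwa [Ortholattice.compl_compl] at this

theorem Ortholattice.le_bot_of_le_compl {a : α} (h : a ≤ aᶜ) : a ≤ ⊥ :=
  (le_inf le_rfl h).trans (Ortholattice.inf_compl_le_bot a)

theorem Ortholattice.le_compl_of_self {a : α} (h : a ≤ aᶜ) (b : α) : a ≤ b :=
  (Ortholattice.le_bot_of_le_compl h).trans bot_le

/-- The value of an annotated formula: right formulas are complemented. -/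
def AFormula.eval (v : ℕ → α) : AFormula → α
  | L φ => φ.eval v
  | R φ => (φ.eval v)ᶜ

/-- The value of a slot of a sequent: the empty slot has value `⊤`. -/
def slotEval (v : ℕ → α) : Option AFormula → α
  | none => ⊤
  | some x => x.eval v

/-- The sequent `Γ, Δ` holds if the values of `Γ` and `Δ` are orthogonal. -/
def SeqHolds (v : ℕ → α) (Γ Δ : Option AFormula) : Prop := slotEval v Γ ≤ (slotEval v Δ)ᶜ

/-- This covers weakening, exchange and the choice of `Γ`, `Δ` for a given set at once. The case
with content is a formula paired with itself: `a ≤ aᶜ` forces `a ≤ ⊥`, so `a` is orthogonal to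
everything. -/
theorem SeqHolds.of_subset {v : ℕ → α} {Γ Δ Γ' Δ' : Option AFormula}
    (hs : sequent Γ' Δ' ⊆ sequent Γ Δ) (h : SeqHolds v Γ' Δ') : SeqHolds v Γ Δ := by
  unfold SeqHolds at *
  have key : ∀ x, (Γ' = some x ∨ Δ' = some x) → (Γ = some x ∨ Δ = some x) := fun x hx => hs hx
  have h' := Ortholattice.le_compl_comm h
  have tb : ∀ {a b : α}, ⊤ ≤ aᶜ → a ≤ b := fun {a b} h =>
    ((Ortholattice.le_compl_comm h).trans (Ortholattice.compl_top'.le)).trans bot_le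
  have self : ∀ {a b : α}, a ≤ aᶜ → a ≤ b := fun {a b} h => Ortholattice.le_compl_of_self h b
  rcases Γ' with _ | x <;> rcases Δ' with _ | y
  · exact le_top.trans (tb h)
  · rcases key y (.inr rfl) with rfl | rfl
    · exact tb h
    · exact le_top.trans h
  · rcases key x (.inl rfl) with rfl | rfl
    · exact tb h'
    · exact le_top.trans h'
  · rcases key x (.inl rfl) with rfl | rfl <;> rcases key y (.inr rfl) with hy | hy
    · cases hy; exact self h
    · subst hy; exact h
    · subst hy; exact h'
    · cases hy; exact Ortholattice.le_compl_comm (self h)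

/-- Derivations are indexed by sets, so the induction only supplies some presentation of each
premise; `out` passes to the presentation that the rule displays. -/
theorem Provable.seqHolds {A : Set (Set AFormula)} {v : ℕ → α}
    (hA : ∀ Γ Δ, sequent Γ Δ ∈ A → SeqHolds v Γ Δ) {S : Set AFormula} (h : Provable A S) :
    ∃ Γ Δ, sequent Γ Δ = S ∧ SeqHolds v Γ Δ := by
  have out : ∀ {Γ Δ}, (∃ Γ' Δ', sequent Γ' Δ' = sequent Γ Δ ∧ SeqHolds v Γ' Δ') →
      SeqHolds v Γ Δ := fun ⟨_, _, e, h⟩ => h.of_subset e.subset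
  induction h with
  | hyp φ => exact ⟨_, _, rfl, (Ortholattice.compl_compl _).ge⟩
  | ax Γ Δ h => exact ⟨_, _, rfl, hA _ _ h⟩
  | cut Γ Δ ψ _ _ h₁ h₂ =>
    refine ⟨_, _, rfl, ?_⟩
    have h₁ := out h₁
    have h₂ := out h₂
    simp only [SeqHolds, slotEval, AFormula.eval, Ortholattice.compl_compl] at *
    exact h₁.trans h₂
  | weaken Γ Δ _ h =>
    exact ⟨_, _, rfl, SeqHolds.of_subset (by rintro x (hx | hx) <;> simp_all [sequent]) (out h)⟩
  | leftAnd₁ Γ φ ψ _ h =>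
    exact ⟨_, _, rfl, (out h).trans (Ortholattice.compl_le_compl _ _ inf_le_left)⟩
  | leftAnd₂ Γ φ ψ _ h =>
    exact ⟨_, _, rfl, (out h).trans (Ortholattice.compl_le_compl _ _ inf_le_right)⟩
  | rightAnd Γ φ ψ _ _ h₁ h₂ =>
    refine ⟨_, _, rfl, ?_⟩
    have h₁ := out h₁
    have h₂ := out h₂
    simp only [SeqHolds, slotEval, AFormula.eval, Ortholattice.compl_compl] at *
    exact le_inf h₁ h₂
  | leftOr Γ φ ψ _ _ h₁ h₂ =>
    refine ⟨_, _, rfl, ?_⟩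
    have h₁ := out h₁
    have h₂ := out h₂
    exact Ortholattice.le_compl_comm
      (sup_le (Ortholattice.le_compl_comm h₁) (Ortholattice.le_compl_comm h₂))
  | rightOr₁ Γ φ ψ _ h =>
    exact ⟨_, _, rfl, (out h).trans (Ortholattice.compl_le_compl _ _
      (Ortholattice.compl_le_compl _ _ le_sup_left))⟩
  | rightOr₂ Γ φ ψ _ h =>
    exact ⟨_, _, rfl, (out h).trans (Ortholattice.compl_le_compl _ _
      (Ortholattice.compl_le_compl _ _ le_sup_right))⟩
  | leftNot Γ φ _ h => exact ⟨_, _, rfl, (out h : SeqHolds v Γ (some (R φ)))⟩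
  | rightNot Γ φ _ h =>
    refine ⟨_, _, rfl, (out h).trans ?_⟩
    exact Ortholattice.compl_le_compl _ _ (Ortholattice.compl_compl _).le
  | leftBot =>
    refine ⟨_, _, rfl, ?_⟩
    exact Ortholattice.compl_bot'.ge
  | rightTop =>
    refine ⟨_, _, rfl, ?_⟩
    exact (Ortholattice.compl_compl _).ge

end Semantics

/-! ### Derived properties of provability -/

theorem sequent_comm (Γ Δ : Option AFormula) : sequent Γ Δ = sequent Δ Γ :=
  Set.ext fun _ => or_comm

theorem sequent_self (Γ : Option AFormula) : sequent Γ Γ = sequent Γ none :=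
  Set.ext fun x => by simp [sequent]

theorem Provable.symm {A : Set (Set AFormula)} {Γ Δ : Option AFormula}
    (h : Provable A (sequent Γ Δ)) : Provable A (sequent Δ Γ) := sequent_comm Γ Δ ▸ h

theorem Provable.of_self {A : Set (Set AFormula)} {Γ : Option AFormula}
    (h : Provable A (sequent Γ Γ)) (Δ : Option AFormula) : Provable A (sequent Γ Δ) :=
  .weaken _ _ (sequent_self Γ ▸ h)

/-- The annotated formula with the other annotation. -/
def AFormula.dual : AFormula → AFormula
  | L φ => R φ
  | R φ => L φ

theorem Provable.cut_dual {A : Set (Set AFormula)} {Γ Δ : Option AFormula} {x : AFormula}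
    (h₁ : Provable A (sequent Γ (some x))) (h₂ : Provable A (sequent (some x.dual) Δ)) :
    Provable A (sequent Γ Δ) := by
  cases x with
  | L φ => exact (Provable.cut _ _ φ h₂.symm h₁.symm).symm
  | R φ => exact .cut _ _ φ h₁ h₂

/-! ### The ortholattice of closed sets of an orthogonality relation -/

/-- A symmetric relation, such that self-related elements are related to everything. -/
structure IsOrtho {X : Type*} (r : X → X → Prop) : Prop where
  symm : ∀ x y, r x y → r y x
  all_of_self : ∀ x y, r x x → r x y

section Model

variable {X : Type*} {r : X → X → Prop}

open Order in
/-- The concepts of an orthogonality relation form an ortholattice. -/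
abbrev IsOrtho.ortholattice (hr : IsOrtho r) : Ortholattice (Concept X X r) where
  compl c := ⟨c.intent, c.extent,
    Set.ext fun x => by
      conv_rhs => rw [← c.lowerPolar_intent]
      exact forall₂_congr fun a _ => ⟨hr.symm _ _, hr.symm _ _⟩,
    Set.ext fun x => by
      conv_rhs => rw [← c.upperPolar_extent]
      exact forall₂_congr fun a _ => ⟨hr.symm _ _, hr.symm _ _⟩⟩
  compl_compl c := rfl
  compl_le_compl c d h := Concept.intent_subset_intent_iff.2 h
  inf_compl_le_bot c := by
    -- A point in both the extent and the intent is related to itself, hence to every point.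
    have h : ∀ x ∈ (c.extent ∩ c.intent), ∀ y, r x y := fun x hx y =>
      hr.all_of_self _ _ (c.rel_extent_intent hx.1 hx.2)
    intro x hx y _
    exact h x hx y
  top_le_sup_compl c := by
    have h : ∀ x ∈ (c.extent ∩ c.intent), ∀ y, r x y := fun x hx y =>
      hr.all_of_self _ _ (c.rel_extent_intent hx.1 hx.2)
    rw [← Concept.intent_subset_intent_iff]
    intro x hx
    change x ∈ upperPolar r Set.univ
    exact fun y _ => hr.symm _ _ (h x ⟨hx.2, hx.1⟩ y)

/-! ### Occurrences of terms in an orthogonality relation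

A node `n` and its successor `n + 1` stand for the left and the right annotation of an occurrence
of a term. -/

/-- The node `n` is the root of an occurrence of a term in a relation that is closed under the
rules for this occurrence. -/
def ClosedAt (r : ℕ → ℕ → Prop) (isVar : ℕ → ℕ → Prop) : Term → ℕ → Prop
  | .var k, n => isVar k n
  | .bot, n => r n n
  | .top, n => r (n + 1) (n + 1)
  | .neg φ, n => ∃ a, ClosedAt r isVar φ a ∧
      (∀ x, r x (a + 1) → r x n) ∧ (∀ x, r x a → r x (n + 1))
  | .and φ ψ, n => ∃ a b, ClosedAt r isVar φ a ∧ ClosedAt r isVar ψ b ∧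
      (∀ x, r x a → r x n) ∧ (∀ x, r x b → r x n) ∧
      (∀ x, r x (a + 1) → r x (b + 1) → r x (n + 1))
  | .or φ ψ, n => ∃ a b, ClosedAt r isVar φ a ∧ ClosedAt r isVar ψ b ∧
      (∀ x, r x (a + 1) → r x (n + 1)) ∧ (∀ x, r x (b + 1) → r x (n + 1)) ∧
      (∀ x, r x a → r x b → r x n)

/-- The node `k` is a closed occurrence of an annotated formula on which the relation admits
cuts. -/
def CutAt (r : ℕ → ℕ → Prop) (isVar : ℕ → ℕ → Prop) : AFormula → ℕ → Prop
  | L φ, k => ClosedAt r isVar φ k ∧ ∀ x z, r x (k + 1) → r k z → r x z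
  | R φ, k => ∃ n, k = n + 1 ∧ ClosedAt r isVar φ n ∧ ∀ x z, r x (n + 1) → r n z → r x z

/-- The nodes `k₁`, `k₂` represent a sequent: a single formula is represented twice, and the empty
sequent by any node. -/
def SeqAt (r : ℕ → ℕ → Prop) (isVar : ℕ → ℕ → Prop) : Seq → ℕ → ℕ → Prop
  | (some x, some y), k₁, k₂ => CutAt r isVar x k₁ ∧ CutAt r isVar y k₂
  | (some x, none), k₁, k₂ => CutAt r isVar x k₁ ∧ k₂ = k₁
  | (none, some x), k₁, k₂ => CutAt r isVar x k₁ ∧ k₂ = k₁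
  | (none, none), _, _ => True

/-! ### The canonical model and completeness of restricted inferences -/

section Completeness

universe u

variable {r : ℕ → ℕ → Prop} {isVar : ℕ → ℕ → Prop}

/-- A relation on the natural numbers, lifted to an arbitrary universe. -/
def liftRel (r : ℕ → ℕ → Prop) (x y : ULift.{u} ℕ) : Prop := r x.down y.down

theorem rel_of_mem {c : Concept (ULift.{u} ℕ) (ULift.{u} ℕ) (liftRel r)} {x y : ULift.{u} ℕ}
    (hx : x ∈ c.extent) (hy : y ∈ c.intent) : r x.down y.down := c.rel_extent_intent hx hy

theorem IsOrtho.lift (hr : IsOrtho r) : IsOrtho (liftRel.{u} r) :=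
  ⟨fun _ _ h => hr.symm _ _ h, fun _ _ h => hr.all_of_self _ _ h⟩

/-- The assignment that maps a variable to the elements related to all its right occurrences. -/
def nodeVal (r : ℕ → ℕ → Prop) (isVar : ℕ → ℕ → Prop) (k : ℕ) :
    Concept (ULift.{u} ℕ) (ULift.{u} ℕ) (liftRel r) :=
  Concept.ofAttributes (liftRel r) {x | ∃ m, isVar k m ∧ x.down = m + 1}

/-- The value of a compound term may be larger than the closed set generated by its node, so only
two memberships are claimed. Each case of the induction then needs just the rules that introduce the
connective, and for variables the initial pairs `hv`; cut is never used. -/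
theorem ClosedAt.mem_eval (hr : IsOrtho r)
    (hv : ∀ k m n, isVar k m → isVar k n → r m (n + 1)) (φ : Term) (n : ℕ)
    (h : ClosedAt r isVar φ n) :
    letI := (hr.lift.{u}).ortholattice
    ULift.up n ∈ (φ.eval (nodeVal.{u} r isVar)).extent ∧
      ULift.up (n + 1) ∈ (φ.eval (nodeVal.{u} r isVar)).intent := by
  let _ := (hr.lift.{u}).ortholattice
  -- A rule with one premise is an inclusion of polars, so it carries membership in closed sets from
  -- the child to the parent.
  have up : ∀ (c : Concept (ULift.{u} ℕ) (ULift.{u} ℕ) (liftRel r)) (a b : ℕ),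
      (∀ x, r x a → r x b) → ULift.up a ∈ c.extent → ULift.up b ∈ c.extent := by
    intro c a b hab ha
    rw [← c.lowerPolar_intent]
    exact fun y hy => hr.symm _ _ (hab _ (hr.symm _ _ (rel_of_mem ha hy)))
  have dn : ∀ (c : Concept (ULift.{u} ℕ) (ULift.{u} ℕ) (liftRel r)) (a b : ℕ),
      (∀ x, r x a → r x b) → ULift.up a ∈ c.intent → ULift.up b ∈ c.intent := by
    intro c a b hab ha
    rw [← c.upperPolar_extent]
    exact fun y hy => hab _ (rel_of_mem hy ha)
  show ULift.up n ∈ (φ.eval (nodeVal.{u} r isVar)).extent ∧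
      ULift.up (n + 1) ∈ (φ.eval (nodeVal.{u} r isVar)).intent
  induction φ generalizing n with
  | var k =>
    have h : isVar k n := h
    constructor
    · rintro ⟨_⟩ ⟨m, hm, rfl⟩
      exact hv _ _ _ h hm
    · exact subset_upperPolar_lowerPolar _ _ ⟨n, h, rfl⟩
  | bot =>
    have h : r n n := h
    refine ⟨?_, Set.mem_univ _⟩
    exact fun y _ => hr.all_of_self _ _ h
  | top =>
    have h : r (n + 1) (n + 1) := h
    refine ⟨Set.mem_univ _, ?_⟩
    exact fun y _ => hr.symm _ _ (hr.all_of_self _ _ h)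
  | neg φ ih =>
    obtain ⟨a, ha, h₁, h₂⟩ := h
    obtain ⟨i₁, i₂⟩ := ih a ha
    exact ⟨dn _ _ _ h₁ i₂, up _ _ _ h₂ i₁⟩
  | and φ ψ ihφ ihψ =>
    obtain ⟨a, b, ha, hb, h₁, h₂, h₃⟩ := h
    obtain ⟨i₁, i₂⟩ := ihφ a ha
    obtain ⟨j₁, j₂⟩ := ihψ b hb
    refine ⟨⟨up _ _ _ h₁ i₁, up _ _ _ h₂ j₁⟩, ?_⟩
    rw [← Concept.upperPolar_extent]
    exact fun y hy => h₃ _ (rel_of_mem hy.1 i₂) (rel_of_mem hy.2 j₂)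
  | or φ ψ ihφ ihψ =>
    obtain ⟨a, b, ha, hb, h₁, h₂, h₃⟩ := h
    obtain ⟨i₁, i₂⟩ := ihφ a ha
    obtain ⟨j₁, j₂⟩ := ihψ b hb
    refine ⟨?_, ⟨dn _ _ _ h₁ i₂, dn _ _ _ h₂ j₂⟩⟩
    rw [← Concept.lowerPolar_intent]
    exact fun y hy => hr.symm _ _ (h₃ _ (hr.symm _ _ (rel_of_mem i₁ hy.1))
      (hr.symm _ _ (rel_of_mem j₁ hy.2)))

/-- Every point of the extent is related to the node opposite to `k`. A cut with `r y k` then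
relates it to `y`, so the polar of the single point `k` is already the whole intent. -/
theorem CutAt.mem_eval (hr : IsOrtho r)
    (hv : ∀ k m n, isVar k m → isVar k n → r m (n + 1)) (x : AFormula) (k : ℕ)
    (h : CutAt r isVar x k) :
    letI := (hr.lift.{u}).ortholattice
    ULift.up k ∈ (x.eval (nodeVal.{u} r isVar)).extent ∧
      ∀ y, y ∈ (x.eval (nodeVal.{u} r isVar)).intent ↔ r y.down k := by
  let _ := (hr.lift.{u}).ortholattice
  show ULift.up k ∈ (x.eval (nodeVal.{u} r isVar)).extent ∧
      ∀ y, y ∈ (x.eval (nodeVal.{u} r isVar)).intent ↔ r y.down k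
  cases x with
  | L φ =>
    obtain ⟨i₁, i₂⟩ := ClosedAt.mem_eval hr hv φ k h.1
    refine ⟨i₁, fun y => ⟨fun hy => hr.symm _ _ (rel_of_mem i₁ hy), fun hy => ?_⟩⟩
    rw [← Concept.upperPolar_extent]
    exact fun z hz => h.2 _ _ (rel_of_mem hz i₂) (hr.symm _ _ hy)
  | R φ =>
    obtain ⟨n, rfl, h, hc⟩ := h
    obtain ⟨i₁, i₂⟩ := ClosedAt.mem_eval hr hv φ n h
    refine ⟨i₂, fun y => ⟨fun hy => (rel_of_mem hy i₂), fun hy => ?_⟩⟩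
    change y ∈ (φ.eval (nodeVal.{u} r isVar)).extent
    rw [← Concept.lowerPolar_intent]
    exact fun z hz => hc _ _ hy (rel_of_mem i₁ hz)

/-- The direction from nodes to truth makes the axioms hold in the model, the other one reads off
the goal. The empty sequent is excluded because arbitrary nodes may represent it. -/
theorem SeqAt.seqHolds_iff (hr : IsOrtho r)
    (hv : ∀ k m n, isVar k m → isVar k n → r m (n + 1)) (S : Seq) (k₁ k₂ : ℕ)
    (hS : S ≠ (none, none)) (h : SeqAt r isVar S k₁ k₂) :
    letI := (hr.lift.{u}).ortholattice
    SeqHolds (nodeVal.{u} r isVar) S.1 S.2 ↔ r k₁ k₂ := by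
  let _ := (hr.lift.{u}).ortholattice
  show SeqHolds (nodeVal.{u} r isVar) S.1 S.2 ↔ r k₁ k₂
  have single : ∀ {x k}, CutAt r isVar x k →
      (SeqHolds (nodeVal.{u} r isVar) (some x) none ↔ r k k) := by
    intro x k h
    obtain ⟨i₁, i₂⟩ := CutAt.mem_eval.{u} hr hv x k h
    constructor
    · intro hs
      exact rel_of_mem (hs i₁ : _ ∈ (⊤ᶜ : Concept _ _ (liftRel.{u} r)).extent)
        (Set.mem_univ (ULift.up.{u} k))
    · intro hk y hy z _
      exact hr.symm _ _ (rel_of_mem hy ((i₂ z).2 (hr.symm _ _ (hr.all_of_self _ _ hk))))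
  obtain ⟨_ | x, _ | y⟩ := S
  · exact absurd rfl hS
  · obtain ⟨h, rfl⟩ := h
    rw [← single h]
    exact ⟨fun h => Ortholattice.le_compl_comm h, fun h => Ortholattice.le_compl_comm h⟩
  · obtain ⟨h, rfl⟩ := h
    exact single h
  · obtain ⟨h₁, h₂⟩ := h
    obtain ⟨i₁, i₂⟩ := CutAt.mem_eval.{u} hr hv x k₁ h₁
    obtain ⟨j₁, j₂⟩ := CutAt.mem_eval.{u} hr hv y k₂ h₂
    constructor
    · intro hs
      exact (j₂ _).1 (hs i₁)
    · intro hk z hz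
      refine (j₂ _).2 ?_
      exact (rel_of_mem hz ((i₂ (ULift.up k₂)).2 (hr.symm _ _ hk)))

/-- Truth of the empty sequent means `⊤ ≤ ⊤ᶜ`, and then all points are related, whichever nodes
represent it. -/
theorem SeqAt.rel_of_seqHolds (hr : IsOrtho r)
    (hv : ∀ k m n, isVar k m → isVar k n → r m (n + 1)) (S : Seq) (k₁ k₂ : ℕ)
    (h : SeqAt r isVar S k₁ k₂)
    (hs : letI := (hr.lift.{u}).ortholattice; SeqHolds (nodeVal.{u} r isVar) S.1 S.2) :
    r k₁ k₂ := by
  let _ := (hr.lift.{u}).ortholattice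
  by_cases hS : S = (none, none)
  · subst hS
    exact rel_of_mem (c := ⊤ᶜ) (hs (Set.mem_univ (ULift.up.{u} k₁))) (Set.mem_univ (ULift.up.{u} k₂))
  · exact (SeqAt.seqHolds_iff.{u} hr hv S k₁ k₂ hS h).1 hs

/-- The relation `r` decides the goal of the instance `P` at the nodes `g₁`, `g₂`. -/
structure Decides (P : Problem) (r : ℕ → ℕ → Prop) (isVar : ℕ → ℕ → Prop) (g₁ g₂ : ℕ) :
    Prop where
  ortho : IsOrtho r
  var : ∀ k m n, isVar k m → isVar k n → r m (n + 1)
  goal : SeqAt r isVar P.goal g₁ g₂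
  axs : ∀ a ∈ P.axs, a ≠ (none, none) ∧ ∃ k₁ k₂, SeqAt r isVar a k₁ k₂ ∧ r k₁ k₂
  sound : r g₁ g₂ → Provable P.axiomSet P.goal.toSet

/-- The canonical model satisfies the axioms. -/
theorem Decides.seqHolds_axs {P : Problem} {g₁ g₂ : ℕ} (h : Decides P r isVar g₁ g₂)
    (a : Seq) (ha : a ∈ P.axs) :
    letI := (h.ortho.lift.{u}).ortholattice
    SeqHolds (nodeVal.{u} r isVar) a.1 a.2 := by
  obtain ⟨hne, k₁, k₂, hk, hr⟩ := h.axs a ha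
  exact (SeqAt.seqHolds_iff.{u} h.ortho h.var a k₁ k₂ hne hk).2 hr

theorem Provable.seqHolds_goal {P : Problem} {α : Type*} [Ortholattice α] {v : ℕ → α}
    (hP : Provable P.axiomSet P.goal.toSet) (hv : ∀ a ∈ P.axs, SeqHolds v a.1 a.2) :
    SeqHolds v P.goal.1 P.goal.2 := by
  obtain ⟨Γ, Δ, e, hs⟩ := hP.seqHolds (v := v) (by
    rintro Γ Δ ⟨a, ha, e⟩
    exact (hv a ha).of_subset e.superset)
  exact hs.of_subset e.subset

theorem Decides.provable_iff {P : Problem} {g₁ g₂ : ℕ} (h : Decides P r isVar g₁ g₂) :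
    Provable P.axiomSet P.goal.toSet ↔ r g₁ g₂ := by
  refine ⟨fun hP => ?_, h.sound⟩
  let _ := (h.ortho.lift.{0}).ortholattice
  exact SeqAt.rel_of_seqHolds.{0} h.ortho h.var _ _ _ h.goal (hP.seqHolds_goal h.seqHolds_axs)

/-- The instance of the provability problem for an instance of the word problem. -/
def WordProblem.toProblem (W : WordProblem) : Problem where
  axs := W.rels.map fun r => (some (L r.1), some (R r.2))
  goal := (some (L W.lhs), some (R W.rhs))

theorem seqHolds_le_iff {α : Type*} [Ortholattice α] {v : ℕ → α} {φ ψ : Term} :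
    SeqHolds v (some (L φ)) (some (R ψ)) ↔ φ.eval v ≤ ψ.eval v := by
  simp only [SeqHolds, slotEval, AFormula.eval, Ortholattice.compl_compl]

/-- Validity is tested on the canonical model, lifted to the universe over which `Holds` quantifies.
The converse passes through a proof and soundness. -/
theorem Decides.holds_iff {W : WordProblem} {g₁ g₂ : ℕ}
    (h : Decides W.toProblem r isVar g₁ g₂) : WordProblem.Holds.{u} W ↔ r g₁ g₂ := by
  constructor
  · intro hW
    let _ := (h.ortho.lift.{u}).ortholattice
    refine SeqAt.rel_of_seqHolds.{u} h.ortho h.var _ _ _ h.goal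
      (seqHolds_le_iff.2 (hW _ (nodeVal.{u} r isVar) fun r hr => seqHolds_le_iff.1 ?_))
    exact h.seqHolds_axs _ (List.mem_map.2 ⟨r, hr, rfl⟩)
  · intro hr α _ v hv
    refine seqHolds_le_iff.1 ((h.sound hr).seqHolds_goal ?_)
    intro a ha
    obtain ⟨r, hr, rfl⟩ := List.mem_map.1 ha
    exact seqHolds_le_iff.2 (hv r hr)

/-- The two encodings coincide, so one program serves both problems without any translation at run
time. -/
theorem WordProblem.encode_toProblem (W : WordProblem) : W.toProblem.encode = W.encode := by
  simp [WordProblem.toProblem, Problem.encode, WordProblem.encode, Seq.encode, slotEncode,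
    AFormula.encode, List.flatMap_map]

theorem WordProblem.size_toProblem (W : WordProblem) : W.toProblem.size = W.size := by
  simp [WordProblem.toProblem, Problem.size, WordProblem.size, Seq.size, slotSize,
    AFormula.size, Function.comp_def]

end Completeness

end Model
end OL

namespace OL

/-! ### Reasoning about programs -/

/-- The weakest precondition of a program without loops. -/
def wp (w : ℕ) : Prog → (State → Prop) → State → Prop
  | .const d k, Q, s => Q (s.setReg d (k % 2 ^ w))
  | .op o d a b, Q, s => Q (s.setReg d (o.apply w (s.reg a) (s.reg b)))
  | .load d a, Q, s => Q (s.setReg d (s.mem (s.reg a)))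
  | .store a b, Q, s => Q (s.setMem (s.reg a) (s.reg b))
  | .seq p q, Q, s => wp w p (wp w q Q) s
  | .ite c p q, Q, s => (c.Sat s → wp w p Q s) ∧ (¬ c.Sat s → wp w q Q s)
  | .while _ _, _, _ => False

/-- A bound for the running time of a program without loops. -/
def Prog.cost : Prog → ℕ
  | .const _ _ => 1
  | .op _ _ _ _ => 1
  | .load _ _ => 1
  | .store _ _ => 1
  | .seq p q => p.cost + q.cost
  | .ite _ p q => p.cost + q.cost + 1
  | .while _ _ => 0

/-- The program halts within `T` steps in a state with the property `Q`. -/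
def Runs (w : ℕ) (p : Prog) (s : State) (T : ℕ) (Q : State → Prop) : Prop :=
  ∃ t s', Exec w p s t s' ∧ t ≤ T ∧ Q s'

theorem Runs.of_wp {w : ℕ} {p : Prog} {Q : State → Prop} {s : State} (h : wp w p Q s) :
    Runs w p s p.cost Q := by
  induction p generalizing s Q with
  | const d k => exact ⟨_, _, .const .., le_rfl, h⟩
  | op o d a b => exact ⟨_, _, .op .., le_rfl, h⟩
  | load d a => exact ⟨_, _, .load .., le_rfl, h⟩
  | store a b => exact ⟨_, _, .store .., le_rfl, h⟩
  | seq p q ihp ihq =>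
    obtain ⟨t, s', e, ht, h⟩ := ihp h
    obtain ⟨t', s'', e', ht', h'⟩ := ihq h
    exact ⟨_, _, .seq e e', Nat.add_le_add ht ht', h'⟩
  | ite c p q ihp ihq =>
    by_cases hc : c.Sat s
    · obtain ⟨t, s', e, ht, h⟩ := ihp (h.1 hc)
      exact ⟨_, _, .ite_true _ hc e, by simp only [Prog.cost]; omega, h⟩
    · obtain ⟨t, s', e, ht, h⟩ := ihq (h.2 hc)
      exact ⟨_, _, .ite_false _ hc e, by simp only [Prog.cost]; omega, h⟩
  | _ => exact h.elim

theorem wp_mono {w : ℕ} {p : Prog} {Q Q' : State → Prop} {s : State} (h : wp w p Q s)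
    (hQ : ∀ s, Q s → Q' s) : wp w p Q' s := by
  induction p generalizing s Q Q' with
  | seq p q ihp ihq => exact ihp h fun s hs => ihq hs hQ
  | ite c p q ihp ihq => exact ⟨fun hc => ihp (h.1 hc) hQ, fun hc => ihq (h.2 hc) hQ⟩
  | const | op | load | store => exact hQ _ h
  | _ => exact h.elim

theorem Runs.mono {w : ℕ} {p : Prog} {s : State} {T T' : ℕ} {Q Q' : State → Prop}
    (h : Runs w p s T Q) (hT : T ≤ T') (hQ : ∀ s, Q s → Q' s) : Runs w p s T' Q' := by
  obtain ⟨t, s', e, ht, h⟩ := h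
  exact ⟨t, s', e, ht.trans hT, hQ _ h⟩

theorem Runs.seq {w : ℕ} {p q : Prog} {s : State} {T T' : ℕ} {Q : State → Prop}
    (h : Runs w p s T fun s' => Runs w q s' T' Q) : Runs w (.seq p q) s (T + T') Q := by
  obtain ⟨t, s', e, ht, t', s'', e', ht', h⟩ := h
  exact ⟨_, _, .seq e e', Nat.add_le_add ht ht', h⟩

theorem Runs.ite {w : ℕ} {c : Test} {p q : Prog} {s : State} {T : ℕ} {Q : State → Prop}
    (hp : c.Sat s → Runs w p s T Q) (hq : ¬ c.Sat s → Runs w q s T Q) :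
    Runs w (.ite c p q) s (T + 1) Q := by
  by_cases hc : c.Sat s
  · obtain ⟨t, s', e, ht, h⟩ := hp hc
    exact ⟨_, _, .ite_true _ hc e, Nat.succ_le_succ ht, h⟩
  · obtain ⟨t, s', e, ht, h⟩ := hq hc
    exact ⟨_, _, .ite_false _ hc e, Nat.succ_le_succ ht, h⟩

/-- A loop that keeps an invariant with a parameter `a`, whose running time is paid from the
potential `Φ a`. -/
theorem Runs.while {w : ℕ} {c : Test} {p : Prog} {α : Type*} (I : α → State → Prop) (Φ : α → ℕ)
    {Q : State → Prop}
    (hp : ∀ a s, I a s → c.Sat s → ∃ T, T < Φ a ∧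
      Runs w p s T fun s' => ∃ b, Φ b + T + 1 ≤ Φ a ∧ I b s')
    (hq : ∀ a s, I a s → ¬ c.Sat s → Q s) (a : α) (s : State) (h : I a s) :
    Runs w (.while c p) s (Φ a + 1) Q := by
  induction hn : Φ a using Nat.strong_induction_on generalizing a s with
  | _ n ih =>
    subst hn
    by_cases hc : c.Sat s
    · obtain ⟨T, _, t, s', e, ht, b, hb, hI⟩ := hp a s h hc
      obtain ⟨t', s'', e', ht', hQ⟩ := ih (Φ b) (by omega) b s' hI rfl
      exact ⟨_, _, .while_true hc e e', by omega, hQ⟩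
    · exact ⟨1, s, .while_false _ hc, by omega, hq a s h hc⟩

/-! ### The layout of the memory -/

/-- The number of nodes for an input, two for each symbol and two that are not used; it is the
width of all tables. -/
def dim (l : List ℕ) : ℕ := 2 * l.length + 2

theorem four_le_dim {l : List ℕ} (hl : l ≠ []) : 4 ≤ dim l := by
  have := List.length_pos_iff.2 hl
  unfold dim
  omega

/-- The contents of the memory: tables (with numbers `1` to `4`), and a queue of pairs of nodes,
without repetitions, whose elements are also marked in a matrix. -/
structure Tab : Type where
  T : ℕ → ℕ → ℕ
  Q : List (ℕ × ℕ)

/-- Change an entry of a table. -/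
def Tab.put (M : Tab) (k y v : ℕ) : Tab :=
  { M with T := Function.update M.T k (Function.update (M.T k) y v) }

/-- Add a pair to the queue, unless it is already there. -/
def Tab.mark (M : Tab) (x y : ℕ) : Tab :=
  { M with Q := if (x, y) ∈ M.Q then M.Q else M.Q ++ [(x, y)] }

/-- The registers with constants. -/
structure Consts (l : List ℕ) (R : ℕ → ℕ) : Prop where
  zero : R 10 = 0
  one : R 11 = 1
  tab : ∀ k, 1 ≤ k → k ≤ 4 → R (11 + k) = k * dim l
  mat : R 16 = 5 * dim l
  qx : R 17 = 5 * dim l + dim l * dim l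
  qy : R 18 = 5 * dim l + 2 * (dim l * dim l)
  len : R 19 = l.length

/-- The state `s` represents the tables `M`, and the registers with numbers at least `10` have the
values `R`. -/
structure Rep (w : ℕ) (l : List ℕ) (M : Tab) (R : ℕ → ℕ) (s : State) : Prop where
  word : 5 * dim l + 3 * (dim l * dim l) + 16 ≤ 2 ^ w
  pos : 4 ≤ dim l
  reg : ∀ r, 10 ≤ r → s.reg r = R r
  consts : Consts l R
  tail : s.reg 1 = M.Q.length
  inp : ∀ i < l.length, s.mem i = l.getD i 0
  tab : ∀ k y, 1 ≤ k → k ≤ 4 → y < dim l → s.mem (k * dim l + y) = M.T k y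
  tab_lt : ∀ k y, M.T k y < dim l
  mat : ∀ x y, x < dim l → y < dim l →
    s.mem (x * dim l + y + 5 * dim l) = if (x, y) ∈ M.Q then 1 else 0
  qx : ∀ j < M.Q.length, s.mem (5 * dim l + dim l * dim l + j) = (M.Q.getD j (0, 0)).1
  qy : ∀ j < M.Q.length, s.mem (5 * dim l + 2 * (dim l * dim l) + j) = (M.Q.getD j (0, 0)).2
  nodup : M.Q.Nodup
  bdd : ∀ p ∈ M.Q, p.1 < dim l ∧ p.2 < dim l

/-- This bounds the queue by the number of pairs of nodes, so `D * D` cells for each component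
suffice. -/
theorem length_le_of_nodup {D : ℕ} {Q : List (ℕ × ℕ)} (h : Q.Nodup)
    (hb : ∀ p ∈ Q, p.1 < D ∧ p.2 < D) : Q.length ≤ D * D := by
  rw [← List.toFinset_card_of_nodup h]
  calc Q.toFinset.card ≤ (Finset.range D ×ˢ Finset.range D).card :=
        Finset.card_le_card fun p hp => by
          have := hb p (List.mem_toFinset.1 hp)
          simp [this]
    _ = D * D := by simp

theorem cell_lt {D x y : ℕ} (hx : x < D) (hy : y < D) : x * D + y < D * D := by
  calc x * D + y < (x + 1) * D := by rw [Nat.succ_mul]; omega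
    _ ≤ D * D := Nat.mul_le_mul_right _ hx

theorem cell_inj {D x y x' y' : ℕ} (hy : y < D) (hy' : y' < D)
    (h : x * D + y = x' * D + y') : x = x' ∧ y = y' := by
  have e : x = x' := by
    have h1 : (x * D + y) / D = x := by
      rw [Nat.mul_comm, Nat.mul_add_div (by omega), Nat.div_eq_of_lt hy, Nat.add_zero]
    have h2 : (x' * D + y') / D = x' := by
      rw [Nat.mul_comm, Nat.mul_add_div (by omega), Nat.div_eq_of_lt hy', Nat.add_zero]
    rw [← h1, ← h2, h]
  subst e
  exact ⟨rfl, by omega⟩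

theorem Rep.length_le {w : ℕ} {l : List ℕ} {M : Tab} {R : ℕ → ℕ} {s : State}
    (h : Rep w l M R s) : M.Q.length ≤ dim l * dim l := length_le_of_nodup h.nodup h.bdd

theorem Consts.update {l : List ℕ} {R : ℕ → ℕ} (h : Consts l R) {d : ℕ} (hd : 20 ≤ d) (v : ℕ) :
    Consts l (Function.update R d v) := by
  constructor
  case tab =>
    intro k h1 h2
    rw [Function.update_of_ne (by omega)]
    exact h.tab k h1 h2
  all_goals
    rw [Function.update_of_ne (by omega)]
    first
      | exact h.zero | exact h.one | exact h.mat | exact h.qx | exact h.qy | exact h.len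

/-- Set a scratch register. -/
theorem Rep.scratch {w : ℕ} {l : List ℕ} {M : Tab} {R : ℕ → ℕ} {s : State}
    (h : Rep w l M R s) {d : ℕ} (hd : d < 10) (hd' : d ≠ 1) (v : ℕ) :
    Rep w l M R (s.setReg d v) where
  __ := h
  reg r hr := by
    simp only [State.setReg]
    rw [Function.update_of_ne (by omega)]
    exact h.reg r hr
  tail := by
    simp only [State.setReg]
    rw [Function.update_of_ne (by omega)]
    exact h.tail

/-- Set a register for a variable. -/
theorem Rep.setReg {w : ℕ} {l : List ℕ} {M : Tab} {R : ℕ → ℕ} {s : State}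
    (h : Rep w l M R s) {d : ℕ} (hd : 20 ≤ d) (v : ℕ) :
    Rep w l M (Function.update R d v) (s.setReg d v) where
  __ := h
  reg r hr := by
    simp only [State.setReg, Function.update_apply]
    rw [h.reg r hr]
  consts := h.consts.update hd v
  tail := by
    simp only [State.setReg]
    rw [Function.update_of_ne (by omega)]
    exact h.tail

/-- Total correctness of a program without loops, in terms of tables and registers. -/
def Ok (w : ℕ) (l : List ℕ) (p : Prog) (Q : Tab → (ℕ → ℕ) → Prop) (M : Tab) (R : ℕ → ℕ) : Prop :=
  ∀ s, Rep w l M R s → wp w p (fun s' => ∃ M' R', Rep w l M' R' s' ∧ Q M' R') s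

/-! ### Proof rules for single instructions and table operations -/

section Rules

variable {w : ℕ} {l : List ℕ} {Q Q' : Tab → (ℕ → ℕ) → Prop} {M : Tab} {R : ℕ → ℕ}

theorem Ok.mono {p : Prog} (h : Ok w l p Q M R) (hQ : ∀ M R, Q M R → Q' M R) :
    Ok w l p Q' M R := fun s hs =>
  wp_mono (h s hs) fun _ ⟨M', R', hr, hq⟩ => ⟨M', R', hr, hQ _ _ hq⟩

theorem Ok.seq {p q : Prog} (h : Ok w l p (fun M R => Ok w l q Q M R) M R) :
    Ok w l (.seq p q) Q M R := fun s hs => by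
  refine wp_mono (p := p) (h s hs) ?_
  rintro _ ⟨_, _, hr, hq⟩
  exact hq _ hr

theorem Ok.const {d k : ℕ} (hd : 20 ≤ d) (hk : k < 16) (h : Q M (Function.update R d k)) :
    Ok w l (.const d k) Q M R := fun s hs => by
  have := hs.word
  refine ⟨_, _, ?_, h⟩
  rw [Nat.mod_eq_of_lt (by omega)]
  exact hs.setReg hd k

/-- The numerical hypothesis excludes wraparound: the sum lies below the end of the matrix, which
`Rep.word` keeps below `2 ^ w`. -/
theorem Ok.add {d a b : ℕ} (hd : 20 ≤ d) (ha : 10 ≤ a) (hb : 10 ≤ b)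
    (hlt : R a + R b < 5 * dim l + dim l * dim l)
    (h : Q M (Function.update R d (R a + R b))) :
    Ok w l (.op .add d a b) Q M R := fun s hs => by
  have := hs.word
  refine ⟨_, _, ?_, h⟩
  rw [hs.reg a ha, hs.reg b hb, Op.apply, Nat.mod_eq_of_lt (by omega)]
  exact hs.setReg hd _

theorem Ok.ite_eq {a b : ℕ} {p q : Prog} (ha : 10 ≤ a) (hb : 10 ≤ b)
    (hp : R a = R b → Ok w l p Q M R) (hq : R a ≠ R b → Ok w l q Q M R) :
    Ok w l (.ite (.eq a b) p q) Q M R := fun s hs => by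
  simp only [wp, Test.Sat, hs.reg a ha, hs.reg b hb]
  exact ⟨fun h => hp h s hs, fun h => hq h s hs⟩

theorem Ok.ite_lt {a b : ℕ} {p q : Prog} (ha : 10 ≤ a) (hb : 10 ≤ b)
    (hp : R a < R b → Ok w l p Q M R) (hq : ¬ R a < R b → Ok w l q Q M R) :
    Ok w l (.ite (.lt a b) p q) Q M R := fun s hs => by
  simp only [wp, Test.Sat, hs.reg a ha, hs.reg b hb]
  exact ⟨fun h => hp h s hs, fun h => hq h s hs⟩

/-- Do nothing. -/
def skip : Prog := .const 9 0

theorem Ok.skip (h : Q M R) : Ok w l skip Q M R := fun _ hs =>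
  ⟨_, _, hs.scratch (by omega) (by omega) _, h⟩

/-- Read an entry of a table. -/
def getTab (k d a : ℕ) : Prog := .seq (.op .add 4 (11 + k) a) (.load d 4)

/-- Change an entry of a table. -/
def putTab (k a b : ℕ) : Prog := .seq (.op .add 4 (11 + k) a) (.store 4 b)

/-- Read a symbol of the input. -/
def getInput (d a : ℕ) : Prog := .load d a

/-- Read the components of an element of the queue. -/
def getQueue (d e a : ℕ) : Prog :=
  .seq (.op .add 4 17 a) (.seq (.load d 4) (.seq (.op .add 4 18 a) (.load e 4)))

/-- Compute the address of a matrix cell in register `4`. -/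
def cell (a b : ℕ) : Prog :=
  .seq (.op .mul 4 a 12) (.seq (.op .add 4 4 b) (.op .add 4 4 16))

/-- Read a cell of the matrix. -/
def getCell (d a b : ℕ) : Prog := .seq (cell a b) (.load d 4)

/-- Add a pair to the queue, unless it is already marked in the matrix. -/
def markPair (a b : ℕ) : Prog :=
  .seq (cell a b) (.seq (.load 5 4) (.ite (.eq 5 10)
    (.seq (.store 4 11) (.seq (.op .add 5 17 1) (.seq (.store 5 a) (.seq (.op .add 5 18 1)
      (.seq (.store 5 b) (.op .add 1 1 11))))))
    skip))

theorem setReg_reg (s : State) (d v r : ℕ) :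
    (s.setReg d v).reg r = if r = d then v else s.reg r := Function.update_apply ..

theorem setReg_mem (s : State) (d v : ℕ) : (s.setReg d v).mem = s.mem := rfl

theorem setMem_reg (s : State) (d v : ℕ) : (s.setMem d v).reg = s.reg := rfl

theorem setMem_mem (s : State) (d v a : ℕ) :
    (s.setMem d v).mem a = if a = d then v else s.mem a := Function.update_apply ..

theorem Ok.getTab {k d a : ℕ} (hk : 1 ≤ k ∧ k ≤ 4) (hd : 20 ≤ d) (ha : 10 ≤ a)
    (hlt : R a < dim l) (h : Q M (Function.update R d (M.T k (R a)))) :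
    Ok w l (getTab k d a) Q M R := fun s hs => by
  have := hs.word
  have hD : k * dim l ≤ 4 * dim l := Nat.mul_le_mul_right _ hk.2
  refine ⟨_, _, ?_, h⟩
  simp only [Op.apply, hs.reg a ha, hs.reg (11 + k) (by omega), hs.consts.tab k hk.1 hk.2,
    setReg_mem, setReg_reg, if_true]
  rw [Nat.mod_eq_of_lt (by omega), hs.tab k _ hk.1 hk.2 hlt]
  exact (hs.scratch (by omega) (by omega) _).setReg hd _

theorem Ok.getInput {d a : ℕ} (hd : 20 ≤ d) (ha : 10 ≤ a)
    (hlt : R a < l.length) (h : Q M (Function.update R d (l.getD (R a) 0))) :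
    Ok w l (getInput d a) Q M R := fun s hs => by
  refine ⟨_, _, ?_, h⟩
  simp only [hs.reg a ha, hs.inp _ hlt]
  exact hs.setReg hd _

theorem Ok.getQueue {d e a : ℕ} (hd : 20 ≤ d) (he : 20 ≤ e) (hda : d ≠ a) (ha : 10 ≤ a)
    (hlt : R a < M.Q.length)
    (h : Q M (Function.update (Function.update R d (M.Q.getD (R a) (0, 0)).1) e
      (M.Q.getD (R a) (0, 0)).2)) :
    Ok w l (getQueue d e a) Q M R := fun s hs => by
  have := hs.word
  have := hs.length_le
  refine ⟨_, _, ?_, h⟩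
  have h1 : a ≠ 4 := by omega
  have h2 : d ≠ 18 := by omega
  have h3 : d ≠ 4 := by omega
  simp only [Op.apply, hs.reg a ha, hs.reg 17 (by omega), hs.reg 18 (by omega), hs.consts.qx,
    hs.consts.qy, setReg_mem, setReg_reg, if_true, hda.symm, h1, h2.symm, if_false,
    Nat.reduceEqDiff]
  rw [Nat.mod_eq_of_lt (by omega), Nat.mod_eq_of_lt (by omega), hs.qx _ hlt, hs.qy _ hlt]
  exact (((hs.scratch (by omega) (by omega) _).setReg hd _).scratch (by omega)
    (by omega) _).setReg he _

/-- The rule takes a continuation because the address stays in the scratch register `4`, which the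
register values `R` do not describe. -/
theorem wp_cell {a b : ℕ} {P : State → Prop} {s : State} (hs : Rep w l M R s) (ha : 10 ≤ a)
    (hb : 10 ≤ b) (hla : R a < dim l) (hlb : R b < dim l)
    (h : ∀ s', Rep w l M R s' → s'.reg 4 = R a * dim l + R b + 5 * dim l → P s') :
    wp w (cell a b) P s := by
  have := hs.word
  have := cell_lt hla hlb
  refine h _ (((hs.scratch (by omega) (by omega) _).scratch (by omega) (by omega) _).scratch
    (by omega) (by omega) _) ?_
  have e : R 12 = dim l := by simpa using hs.consts.tab 1 le_rfl (by omega)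
  have h1 : b ≠ 4 := by omega
  simp only [Op.apply, setReg_reg, if_true, hs.reg a ha, hs.reg b hb, hs.reg 12 (by omega), e,
    h1, if_false, hs.reg 16 (by omega), hs.consts.mat, Nat.reduceEqDiff]
  rw [Nat.mod_eq_of_lt (a := R a * dim l) (by omega), Nat.mod_eq_of_lt (a := _ + R b) (by omega),
    Nat.mod_eq_of_lt (by omega)]

theorem Ok.getCell {d a b : ℕ} (hd : 20 ≤ d) (ha : 10 ≤ a) (hb : 10 ≤ b)
    (hla : R a < dim l) (hlb : R b < dim l)
    (h : Q M (Function.update R d (if (R a, R b) ∈ M.Q then 1 else 0))) :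
    Ok w l (getCell d a b) Q M R := fun s hs => by
  refine wp_cell hs ha hb hla hlb fun s' hs' e => ⟨_, _, ?_, h⟩
  rw [e, hs'.mat _ _ hla hlb]
  exact hs'.setReg hd _

theorem Rep.put {k y v a : ℕ} {s : State} (hs : Rep w l M R s) (hk : 1 ≤ k ∧ k ≤ 4)
    (hy : y < dim l) (hv : v < dim l) (ha : a = k * dim l + y) :
    Rep w l (M.put k y v) R (s.setMem a v) := by
  have hD : k * dim l ≤ 4 * dim l := Nat.mul_le_mul_right _ hk.2
  have hD' : 1 * dim l ≤ k * dim l := Nat.mul_le_mul_right _ hk.1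
  have hll : l.length < dim l := by unfold dim; omega
  refine { hs with
    inp := fun i hi => ?_, tab := fun k' y' h1 h2 hy' => ?_, tab_lt := fun k' y' => ?_,
    mat := fun x y hx hy => ?_, qx := fun j hj => ?_, qy := fun j hj => ?_ }
  · rw [setMem_mem, if_neg (by omega)]
    exact hs.inp i hi
  · rw [setMem_mem, ha]
    by_cases h : k' * dim l + y' = k * dim l + y
    · obtain ⟨rfl, rfl⟩ := cell_inj hy' hy h
      simp [Tab.put]
    · rw [if_neg h, hs.tab k' y' h1 h2 hy']
      simp only [Tab.put]
      by_cases hkk : k' = k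
      · subst hkk
        rw [Function.update_self, Function.update_of_ne (by rintro rfl; exact h rfl)]
      · rw [Function.update_of_ne hkk]
  · simp only [Tab.put, Function.update_apply]
    split_ifs with h1
    · simp only [Function.update_apply]
      split_ifs
      · exact hv
      · exact hs.tab_lt _ _
    · exact hs.tab_lt _ _
  · rw [setMem_mem, if_neg (by omega)]
    exact hs.mat _ _ hx hy
  · rw [setMem_mem, if_neg (by omega)]
    exact hs.qx _ hj
  · rw [setMem_mem, if_neg (by omega)]
    exact hs.qy _ hj

theorem Ok.putTab {k a b : ℕ} (hk : 1 ≤ k ∧ k ≤ 4) (ha : 10 ≤ a) (hb : 10 ≤ b)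
    (hla : R a < dim l) (hlb : R b < dim l) (h : Q (M.put k (R a) (R b)) R) :
    Ok w l (putTab k a b) Q M R := fun s hs => by
  have := hs.word
  have hD : k * dim l ≤ 4 * dim l := Nat.mul_le_mul_right _ hk.2
  refine ⟨_, _, ?_, h⟩
  have h1 : b ≠ 4 := by omega
  simp only [Op.apply, hs.reg a ha, hs.reg (11 + k) (by omega), hs.consts.tab k hk.1 hk.2,
    setReg_reg, if_true, h1, if_false, hs.reg b hb]
  rw [Nat.mod_eq_of_lt (by omega)]
  exact (hs.scratch (by omega) (by omega) _).put hk hla hlb rfl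

theorem Rep.push {x y : ℕ} {s : State} (hs : Rep w l M R s)
    (hx : x < dim l) (hy : y < dim l) (h : (x, y) ∉ M.Q) {s' : State}
    (hreg : ∀ r, 10 ≤ r → s'.reg r = s.reg r) (htail : s'.reg 1 = s.reg 1 + 1)
    (hmem : s'.mem = Function.update (Function.update (Function.update s.mem
      (x * dim l + y + 5 * dim l) 1) (5 * dim l + dim l * dim l + M.Q.length) x)
      (5 * dim l + 2 * (dim l * dim l) + M.Q.length) y) :
    Rep w l { M with Q := M.Q ++ [(x, y)] } R s' := by
  have hc := cell_lt hx hy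
  have hll : l.length < dim l := by unfold dim; omega
  have hnd : (M.Q ++ [(x, y)]).Nodup := by
    rw [List.nodup_append]
    refine ⟨hs.nodup, List.nodup_singleton _, ?_⟩
    rintro p hp q hq rfl
    rw [List.mem_singleton] at hq
    exact h (hq ▸ hp)
  have hbd : ∀ p ∈ M.Q ++ [(x, y)], p.1 < dim l ∧ p.2 < dim l := by
    intro p hp
    rcases List.mem_append.1 hp with hp | hp
    · exact hs.bdd p hp
    · rw [List.mem_singleton] at hp
      subst hp
      exact ⟨hx, hy⟩
  -- The extended queue still has no repetitions, so its last slot lies inside the region reserved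
  -- for it and does not run into the next one.
  have hlen : M.Q.length + 1 ≤ dim l * dim l := by
    have := length_le_of_nodup hnd hbd
    simpa using this
  have getD_lt : ∀ j < M.Q.length, (M.Q ++ [(x, y)]).getD j (0, 0) = M.Q.getD j (0, 0) :=
    fun j hj => List.getD_append _ _ _ _ hj
  have getD_eq : (M.Q ++ [(x, y)]).getD M.Q.length (0, 0) = (x, y) := by
    rw [List.getD_append_right _ _ _ _ le_rfl]
    simp
  refine { hs with
    reg := fun r hr => (hreg r hr).trans (hs.reg r hr), tail := ?_,
    inp := fun i hi => ?_, tab := fun k' y' h1 h2 hy' => ?_,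
    mat := fun x' y' hx' hy' => ?_, qx := fun j hj => ?_, qy := fun j hj => ?_
    nodup := hnd, bdd := hbd }
  · rw [htail, hs.tail]
    simp
  · rw [hmem, Function.update_of_ne (by omega), Function.update_of_ne (by omega),
      Function.update_of_ne (by omega)]
    exact hs.inp i hi
  · have hD : k' * dim l ≤ 4 * dim l := Nat.mul_le_mul_right _ h2
    rw [hmem, Function.update_of_ne (by omega), Function.update_of_ne (by omega),
      Function.update_of_ne (by omega)]
    exact hs.tab _ _ h1 h2 hy'
  · have := cell_lt hx' hy'
    rw [hmem, Function.update_of_ne (by omega), Function.update_of_ne (by omega)]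
    by_cases e : (x', y') = (x, y)
    · obtain ⟨rfl, rfl⟩ := Prod.mk.inj e
      simp
    · have : x' * dim l + y' + 5 * dim l ≠ x * dim l + y + 5 * dim l := by
        intro h'
        obtain ⟨rfl, rfl⟩ := cell_inj hy' hy (Nat.add_right_cancel h')
        exact e rfl
      rw [Function.update_of_ne this, hs.mat _ _ hx' hy']
      simp [e]
  · simp only [List.length_append, List.length_singleton] at hj
    rw [hmem, Function.update_of_ne (by omega)]
    by_cases e : j = M.Q.length
    · subst e
      rw [Function.update_self, getD_eq]
    · rw [Function.update_of_ne (by omega), Function.update_of_ne (by omega),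
        hs.qx _ (by omega), getD_lt _ (by omega)]
  · simp only [List.length_append, List.length_singleton] at hj
    rw [hmem]
    by_cases e : j = M.Q.length
    · subst e
      rw [Function.update_self, getD_eq]
    · rw [Function.update_of_ne (by omega), Function.update_of_ne (by omega),
        Function.update_of_ne (by omega), hs.qy _ (by omega), getD_lt _ (by omega)]

theorem Ok.markPair {a b : ℕ} (ha : 10 ≤ a) (hb : 10 ≤ b)
    (hla : R a < dim l) (hlb : R b < dim l) (h : Q (M.mark (R a) (R b)) R) :
    Ok w l (markPair a b) Q M R := fun s hs => by
  refine wp_cell hs ha hb hla hlb fun s hs e4 => ?_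
  have hw := hs.word
  have hlen := hs.length_le
  have hval := hs.mat _ _ hla hlb
  have h10 : s.reg 10 = 0 := (hs.reg 10 le_rfl).trans hs.consts.zero
  simp only [wp, Test.Sat, setReg_reg, setReg_mem, e4, if_true, h10,
    Nat.reduceEqDiff, if_false, hval]
  by_cases hm : (R a, R b) ∈ M.Q
  · rw [Tab.mark, if_pos hm] at h
    refine ⟨fun h' => absurd h' (by rw [if_pos hm]; omega),
      fun _ => Ok.skip h _ (hs.scratch (by omega) (by omega) _)⟩
  · rw [Tab.mark, if_neg hm] at h
    refine ⟨fun _ => ⟨_, _, ?_, h⟩, fun h' => absurd (if_neg hm) h'⟩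
    have a1 : a ≠ 5 := by omega
    have b1 : b ≠ 5 := by omega
    have hc := cell_lt hla hlb
    simp only [Op.apply, setReg_reg, setReg_mem, setMem_reg, e4, if_true, if_false, a1, b1,
      Nat.reduceEqDiff, hs.tail, hs.reg a ha, hs.reg b hb,
      hs.reg 17 (by omega), hs.reg 18 (by omega), hs.reg 11 (by omega), hs.consts.qx,
      hs.consts.qy, hs.consts.one]
    rw [Nat.mod_eq_of_lt (by omega), Nat.mod_eq_of_lt (by omega), Nat.mod_eq_of_lt (by omega)]
    refine hs.push hla hlb hm (fun r hr => ?_) ?_ rfl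
    · have r1 : r ≠ 1 := by omega
      have r5 : r ≠ 5 := by omega
      simp only [setReg_reg, setMem_reg, r1, r5, if_false]
    · rw [setReg_reg, if_pos rfl, hs.tail]

end Rules

end OL

namespace OL

/-! ### Loops and running times -/

section Timed

variable {w : ℕ} {l : List ℕ} {Q Q' : Tab → (ℕ → ℕ) → Prop} {M : Tab} {R : ℕ → ℕ}

/-- Facts that hold in every represented state. -/
structure Inv (l : List ℕ) (M : Tab) (R : ℕ → ℕ) : Prop where
  pos : 4 ≤ dim l
  consts : Consts l R
  tab_lt : ∀ k y, M.T k y < dim l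
  nodup : M.Q.Nodup
  bdd : ∀ p ∈ M.Q, p.1 < dim l ∧ p.2 < dim l

theorem Rep.inv {s : State} (h : Rep w l M R s) : Inv l M R :=
  ⟨h.pos, h.consts, h.tab_lt, h.nodup, h.bdd⟩

theorem Inv.length_le (h : Inv l M R) : M.Q.length ≤ dim l * dim l :=
  length_le_of_nodup h.nodup h.bdd

theorem Ok.intro {p : Prog} (h : Inv l M R → Ok w l p Q M R) : Ok w l p Q M R :=
  fun s hs => h hs.inv s hs

/-- Total correctness within `T` steps, in terms of tables and registers. -/
def OkT (w : ℕ) (l : List ℕ) (T : ℕ) (p : Prog) (Q : Tab → (ℕ → ℕ) → Prop) (M : Tab)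
    (R : ℕ → ℕ) : Prop :=
  ∀ s, Rep w l M R s → Runs w p s T fun s' => ∃ M' R', Rep w l M' R' s' ∧ Q M' R'

theorem OkT.intro {p : Prog} {T : ℕ} (h : Inv l M R → OkT w l T p Q M R) : OkT w l T p Q M R :=
  fun s hs => h hs.inv s hs

theorem Ok.timed {p : Prog} (h : Ok w l p Q M R) : OkT w l p.cost p Q M R :=
  fun s hs => Runs.of_wp (h s hs)

theorem OkT.mono {p : Prog} {T T' : ℕ} (h : OkT w l T p Q M R) (hT : T ≤ T')
    (hQ : ∀ M R, Inv l M R → Q M R → Q' M R) : OkT w l T' p Q' M R := fun s hs =>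
  (h s hs).mono hT fun _ ⟨M', R', hr, hq⟩ => ⟨M', R', hr, hQ _ _ hr.inv hq⟩

theorem OkT.seq {p q : Prog} {T T' : ℕ} (h : OkT w l T p (fun M R => OkT w l T' q Q M R) M R) :
    OkT w l (T + T') (.seq p q) Q M R := fun s hs => by
  refine Runs.seq ((h s hs).mono le_rfl ?_)
  rintro _ ⟨_, _, hr, hq⟩
  exact hq _ hr

theorem OkT.ite_lt {a b T : ℕ} {p q : Prog} (ha : 10 ≤ a) (hb : 10 ≤ b)
    (hp : R a < R b → OkT w l T p Q M R) (hq : ¬ R a < R b → OkT w l T q Q M R) :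
    OkT w l (T + 1) (.ite (.lt a b) p q) Q M R := fun s hs => by
  refine Runs.ite (fun h => ?_) (fun h => ?_) <;>
    simp only [Test.Sat, hs.reg a ha, hs.reg b hb] at h
  · exact hp h s hs
  · exact hq h s hs

theorem OkT.while {a b : ℕ} (ha : 10 ≤ a) (hb : 10 ≤ b) {p : Prog} {α : Type*}
    (I : α → Tab → (ℕ → ℕ) → Prop) (Φ : α → ℕ)
    (hp : ∀ x M R, Inv l M R → I x M R → R a < R b → ∃ T, T < Φ x ∧
      OkT w l T p (fun M R => ∃ y, Φ y + T + 1 ≤ Φ x ∧ I y M R) M R)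
    (hq : ∀ x M R, Inv l M R → I x M R → ¬ R a < R b → Q M R) (x : α) (h : I x M R) :
    OkT w l (Φ x + 1) (.while (.lt a b) p) Q M R := fun s hs => by
  refine Runs.while (fun x s => ∃ M R, Rep w l M R s ∧ I x M R) Φ ?_ ?_ x s ⟨M, R, hs, h⟩
  · rintro x s ⟨M, R, hs, h⟩ hc
    simp only [Test.Sat, hs.reg a ha, hs.reg b hb] at hc
    obtain ⟨T, hT, hr⟩ := hp x M R hs.inv h hc
    refine ⟨T, hT, (hr s hs).mono le_rfl ?_⟩
    rintro s' ⟨M', R', hs', y, hy, hI⟩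
    exact ⟨y, hy, M', R', hs', hI⟩
  · rintro x s ⟨M, R, hs, h⟩ hc
    simp only [Test.Sat, hs.reg a ha, hs.reg b hb] at hc
    exact ⟨M, R, hs, hq x M R hs.inv h hc⟩

/-- Each pass pays one unit for its test; the last unit is for the test that fails. -/
theorem OkT.for {a b : ℕ} (ha : 10 ≤ a) (hb : 10 ≤ b) {p : Prog} (T n : ℕ)
    (I : ℕ → Tab → (ℕ → ℕ) → Prop) (hI : ∀ k M R, I k M R → R a = k ∧ R b = n)
    (hp : ∀ k M R, Inv l M R → k < n → I k M R → OkT w l T p (I (k + 1)) M R)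
    (k : ℕ) (hk : k ≤ n) (h : I k M R) :
    OkT w l ((n - k) * (T + 1) + 1) (.while (.lt a b) p) (I n) M R := by
  refine OkT.while ha hb (fun k M R => k ≤ n ∧ I k M R) (fun k => (n - k) * (T + 1)) ?_ ?_ k
    ⟨hk, h⟩
  · rintro k M R hinv ⟨hk, h⟩ hlt
    obtain ⟨e1, e2⟩ := hI k M R h
    have hkn : k < n := by omega
    have e : (n - k) * (T + 1) = (n - (k + 1)) * (T + 1) + (T + 1) := by
      rw [← Nat.succ_mul]
      congr 1
      omega
    refine ⟨T, ?_, (hp k M R hinv hkn h).mono le_rfl fun M R _ h => ⟨k + 1, ?_, hkn, h⟩⟩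
    · rw [e]
      omega
    · rw [e]
      omega
  · rintro k M R _ ⟨hk, h⟩ hlt
    obtain ⟨e1, e2⟩ := hI k M R h
    have : k = n := by omega
    exact this ▸ h

/-- Read the length of the queue. -/
def getLength (d : ℕ) : Prog := .op .add d 1 10

theorem Ok.getLength {d : ℕ} (hd : 20 ≤ d) (h : Q M (Function.update R d M.Q.length)) :
    Ok w l (getLength d) Q M R := fun s hs => by
  have := hs.word
  have := hs.length_le
  refine ⟨_, _, ?_, h⟩
  rw [hs.tail, hs.reg 10 le_rfl, hs.consts.zero, Op.apply, Nat.mod_eq_of_lt (by omega)]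
  exact hs.setReg hd _

end Timed

/-! ### Parsing -/

infixr:60 " ⨾ " => Prog.seq

/-- The state of the parser: the next node `n` and its predecessor `pn`, the nodes `s₁`, `s₂` of
the current sequent (`s₁ = 0` if there are none yet), the nodes `g₁`, `g₂` of the goal (`g₁ = 0`
if the goal has not been read yet), and a flag `e` for empty axioms. The terms `tm` at the nodes
are not represented in the memory. Table `1` has the last node before the term that ends at a node.
In tables `2` and `3` an entry `p`, respectively `s`, at the node `y` stands for the rule that
infers `x, p` from `x, y` and `x, s`. Table `4` has the dual nodes of the nodes on which cuts are
made. -/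
structure PSt : Type where
  M : Tab
  n : ℕ
  pn : ℕ
  s₁ : ℕ
  s₂ : ℕ
  g₁ : ℕ
  g₂ : ℕ
  e : ℕ
  tm : ℕ → Term

/-- Add the rule that infers `x, p` from `x, y` and `x, s`. -/
def Tab.rule (M : Tab) (y s p : ℕ) : Tab := (M.put 2 y p).put 3 y s

namespace PSt

def leaf (σ : PSt) (t : Term) : PSt :=
  { σ with M := σ.M.put 1 σ.n σ.pn, tm := Function.update σ.tm σ.n t }

def mark (σ : PSt) (x y : ℕ) : PSt := { σ with M := σ.M.mark x y }

def neg (σ : PSt) : PSt :=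
  { σ with
    M := ((σ.M.put 1 σ.n (σ.M.T 1 σ.pn)).rule σ.pn σ.pn (σ.n + 1)).rule (σ.pn + 1) (σ.pn + 1) σ.n
    tm := Function.update σ.tm σ.n (.neg (σ.tm σ.pn)) }

/-- A binary connective, where the side `u` has two rules with one premise, and the side `v` has
one rule with two premises. -/
def bin (σ : PSt) (u v : ℕ) (op : Term → Term → Term) : PSt :=
  let a := σ.M.T 1 σ.pn
  let b := σ.pn
  { σ with
    M := ((((σ.M.put 1 σ.n (σ.M.T 1 a)).rule (a + u) (a + u) (σ.n + u)).rule
      (b + u) (b + u) (σ.n + u)).rule (a + v) (b + v) (σ.n + v)).rule (b + v) (a + v) (σ.n + v)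
    tm := Function.update σ.tm σ.n (op (σ.tm a) (σ.tm b)) }

def annot (σ : PSt) (u : ℕ) : PSt :=
  { σ with
    M := (σ.M.put 4 σ.pn (σ.pn + 1)).put 4 (σ.pn + 1) σ.pn
    s₁ := if σ.s₁ = 0 then σ.pn + u else σ.s₁
    s₂ := σ.pn + u }

def endSeq (σ : PSt) : PSt :=
  if σ.s₁ = 0 then
    if σ.g₁ = 0 then { σ with g₁ := σ.n, g₂ := σ.n } else { σ with e := 1 }
  else
    if σ.g₁ = 0 then { σ with s₁ := 0, g₁ := σ.s₁, g₂ := σ.s₂ }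
    else { σ with s₁ := 0, M := σ.M.mark σ.s₁ σ.s₂ }

def next (σ : PSt) : PSt := { σ with n := σ.n + 2, pn := σ.n }

/-- The parser reads a symbol. -/
def step (σ : PSt) (c : ℕ) : PSt :=
  next <|
    if c = 0 then σ.endSeq
    else if c = 1 then σ.annot 0
    else if c = 2 then σ.annot 1
    else if c = 3 then (σ.leaf .bot).mark σ.n σ.n
    else if c = 4 then (σ.leaf .top).mark (σ.n + 1) (σ.n + 1)
    else if c = 5 then σ.neg
    else if c = 6 then σ.bin 0 1 .and
    else if c = 7 then σ.bin 1 0 .or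
    else σ.leaf (.var (c - 8))

/-- The initial state. -/
def init : PSt where
  M := ⟨fun _ _ => 0, []⟩
  n := 2
  pn := 0
  s₁ := 0
  s₂ := 0
  g₁ := 0
  g₂ := 0
  e := 0
  tm := fun _ => .top

/-- The registers `R` hold the state of the parser, which is about to read the symbol `i`. -/
structure Regs (σ : PSt) (i : ℕ) (R : ℕ → ℕ) : Prop where
  i : R 20 = i
  n : R 21 = σ.n
  pn : R 22 = σ.pn
  s₁ : R 23 = σ.s₁
  s₂ : R 24 = σ.s₂
  g₁ : R 25 = σ.g₁
  g₂ : R 26 = σ.g₂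
  e : R 27 = σ.e

/-- Bounds for the state of the parser, before it reads the symbol `i`. -/
structure Bounds (l : List ℕ) (σ : PSt) (i : ℕ) : Prop where
  n : σ.n = 2 * i + 2
  pn : σ.pn = 2 * i
  s₁ : σ.s₁ < dim l
  s₂ : σ.s₂ < dim l
  tab : ∀ y, σ.M.T 1 y + 1 < dim l

end PSt

def ruleProg (y s p : ℕ) : Prog := putTab 2 y p ⨾ putTab 3 y s

def leafProg : Prog := putTab 1 21 22

def botProg : Prog := leafProg ⨾ markPair 21 21

def topProg : Prog := leafProg ⨾ .op .add 30 21 11 ⨾ markPair 30 30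

def negProg : Prog :=
  getTab 1 30 22 ⨾ putTab 1 21 30 ⨾ .op .add 31 22 11 ⨾ .op .add 32 21 11 ⨾
    ruleProg 22 22 32 ⨾ ruleProg 31 31 21

/-- The registers `u`, `v` hold `0` and `1`. -/
def binProg (u v : ℕ) : Prog :=
  getTab 1 30 22 ⨾ getTab 1 31 30 ⨾ putTab 1 21 31 ⨾
    .op .add 32 30 u ⨾ .op .add 33 22 u ⨾ .op .add 34 21 u ⨾
    .op .add 35 30 v ⨾ .op .add 36 22 v ⨾ .op .add 37 21 v ⨾
    ruleProg 32 32 34 ⨾ ruleProg 33 33 34 ⨾ ruleProg 35 36 37 ⨾ ruleProg 36 35 37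

/-- The register `u` holds `0` or `1`. -/
def annotProg (u : ℕ) : Prog :=
  .op .add 30 22 11 ⨾ putTab 4 22 30 ⨾ putTab 4 30 22 ⨾ .op .add 24 22 u ⨾
    .ite (.eq 23 10) (.op .add 23 24 10) skip

def endSeqProg : Prog :=
  .ite (.eq 23 10)
    (.ite (.eq 25 10) (.op .add 25 21 10 ⨾ .op .add 26 21 10) (.const 27 1))
    (.ite (.eq 25 10) (.op .add 25 23 10 ⨾ .op .add 26 24 10) (markPair 23 24) ⨾ .const 23 0)

def nextProg : Prog :=
  .op .add 22 21 10 ⨾ .op .add 21 21 11 ⨾ .op .add 21 21 11 ⨾ .op .add 20 20 11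

def stepProg : Prog :=
  getInput 28 20 ⨾
    .ite (.eq 28 10) endSeqProg
      (.ite (.eq 28 11) (annotProg 10)
        (.const 29 2 ⨾ .ite (.eq 28 29) (annotProg 11)
          (.const 29 3 ⨾ .ite (.eq 28 29) botProg
            (.const 29 4 ⨾ .ite (.eq 28 29) topProg
              (.const 29 5 ⨾ .ite (.eq 28 29) negProg
                (.const 29 6 ⨾ .ite (.eq 28 29) (binProg 10 11)
                  (.const 29 7 ⨾ .ite (.eq 28 29) (binProg 11 10) leafProg))))))) ⨾
    nextProg

/-! ### The parsing program follows the abstract parser -/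

section ParseOk

variable {w : ℕ} {l : List ℕ} {σ : PSt} {i : ℕ} {R : ℕ → ℕ}

/-- The program turns the state `σ` of the parser into `σ'`. -/
def Steps (w : ℕ) (l : List ℕ) (p : Prog) (σ σ' : PSt) : Prop :=
  ∀ i R, i < l.length → PSt.Bounds l σ i → PSt.Regs σ i R →
    Ok w l p (fun M' R' => M' = σ'.M ∧ PSt.Regs σ' i R') σ.M R

theorem steps_leaf (t : Term) : Steps w l leafProg σ (σ.leaf t) := by
  intro i R hi hB hR
  have hD : dim l = 2 * l.length + 2 := rfl
  refine Ok.putTab (by omega) (by omega) (by omega) ?_ ?_ ⟨?_, ?_⟩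
  · rw [hR.n, hB.n]; omega
  · rw [hR.pn, hB.pn]; omega
  · rw [hR.n, hR.pn]; rfl
  · exact ⟨hR.i, hR.n, hR.pn, hR.s₁, hR.s₂, hR.g₁, hR.g₂, hR.e⟩

theorem steps_bot : Steps w l botProg σ ((σ.leaf .bot).mark σ.n σ.n) := by
  intro i R hi hB hR
  have hD : dim l = 2 * l.length + 2 := rfl
  refine Ok.seq ((steps_leaf .bot i R hi hB hR).mono ?_)
  rintro M R ⟨rfl, hR⟩
  have e : R 21 = σ.n := hR.n
  have := hB.n
  refine Ok.markPair (by omega) (by omega) (by omega) (by omega) ⟨?_, ?_⟩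
  · rw [e]; rfl
  · exact ⟨hR.i, hR.n, hR.pn, hR.s₁, hR.s₂, hR.g₁, hR.g₂, hR.e⟩

theorem steps_top : Steps w l topProg σ ((σ.leaf .top).mark (σ.n + 1) (σ.n + 1)) := by
  intro i R hi hB hR
  have hD : dim l = 2 * l.length + 2 := rfl
  refine Ok.seq ((steps_leaf .top i R hi hB hR).mono ?_)
  rintro M R ⟨rfl, hR⟩
  refine Ok.intro fun hv => ?_
  have h11 := hv.consts.one
  have e : R 21 = σ.n := hR.n
  have := hB.n
  have h4 := hv.pos
  refine Ok.seq (Ok.add (by omega) (by omega) (by omega) (by omega) ?_)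
  refine Ok.markPair (by omega) (by omega) ?_ ?_ ⟨?_, ?_⟩
  iterate 2 · simp only [Function.update_self]; omega
  · simp only [Function.update_self, e, h11, PSt.mark]
  · constructor <;> simp only [Function.update_apply, Nat.reduceEqDiff, reduceIte, PSt.mark, hR.i,
      hR.n, hR.pn, hR.s₁, hR.s₂, hR.g₁, hR.g₂, hR.e]

theorem steps_neg : Steps w l negProg σ σ.neg := by
  intro i R hi hB hR
  have hD : dim l = 2 * l.length + 2 := rfl
  refine Ok.intro fun hv => ?_
  have h10 := hv.consts.zero
  have h11 := hv.consts.one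
  have hn := hB.n
  have hpn := hB.pn
  have e1 := hR.n
  have e2 := hR.pn
  have h4 := hv.pos
  have ht := hB.tab σ.pn
  have ht' : σ.M.T 1 (2 * i) = σ.M.T 1 σ.pn := by rw [hpn]
  refine Ok.seq (Ok.getTab (by omega) (by omega) (by omega) ?_ ?_)
  · simp only [Function.update_apply, Nat.reduceEqDiff, reduceIte, e1, e2, h11, h10]; omega
  refine Ok.seq (Ok.putTab (by omega) (by omega) (by omega) ?_ ?_ ?_)
  iterate 2 · simp only [Function.update_apply, Nat.reduceEqDiff, reduceIte, e1, e2, h11, h10]; omega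
  refine Ok.seq (Ok.add (by omega) (by omega) (by omega) ?_ ?_)
  · simp only [Function.update_apply, Nat.reduceEqDiff, reduceIte, e1, e2, h11, h10]; omega
  refine Ok.seq (Ok.add (by omega) (by omega) (by omega) ?_ ?_)
  · simp only [Function.update_apply, Nat.reduceEqDiff, reduceIte, e1, e2, h11, h10]; omega
  refine Ok.seq (Ok.seq (Ok.putTab (by omega) (by omega) (by omega) ?_ ?_
    (Ok.putTab (by omega) (by omega) (by omega) ?_ ?_ ?_)))
  iterate 4 · simp only [Function.update_apply, Nat.reduceEqDiff, reduceIte, e1, e2, h11, h10]; omega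
  refine Ok.seq (Ok.putTab (by omega) (by omega) (by omega) ?_ ?_
    (Ok.putTab (by omega) (by omega) (by omega) ?_ ?_ ⟨?_, ?_⟩))
  iterate 4 · simp only [Function.update_apply, Nat.reduceEqDiff, reduceIte, e1, e2, h11, h10]; omega
  · simp only [Function.update_apply, Nat.reduceEqDiff, reduceIte, e1, e2, h10, h11, PSt.neg, Tab.rule]
  · constructor <;> simp only [Function.update_apply, Nat.reduceEqDiff, reduceIte, PSt.neg, hR.i, hR.n,
      hR.pn, hR.s₁, hR.s₂, hR.g₁, hR.g₂, hR.e]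

/-- The program is given names of registers, the abstract parser offsets. Registers `10` and `11`
hold `0` and `1`, so the offset is the name minus `10`. -/
theorem steps_bin {u v : ℕ} (hu : u = 10 ∨ u = 11) (hv : v = 10 ∨ v = 11)
    (op : Term → Term → Term) :
    Steps w l (binProg u v) σ (σ.bin (u - 10) (v - 10) op) := by
  intro i R hi hB hR
  have hD : dim l = 2 * l.length + 2 := rfl
  refine Ok.intro fun hI => ?_
  have h10 := hI.consts.zero
  have h11 := hI.consts.one
  have hRu : R u = u - 10 := by rcases hu with rfl | rfl <;> assumption
  have hRv : R v = v - 10 := by rcases hv with rfl | rfl <;> assumption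
  have hu1 : u - 10 ≤ 1 := by omega
  have hv1 : v - 10 ≤ 1 := by omega
  have hu10 : 10 ≤ u := by omega
  have hv10 : 10 ≤ v := by omega
  have nu : ∀ j, 30 ≤ j → u ≠ j := by omega
  have nv : ∀ j, 30 ≤ j → v ≠ j := by omega
  have hn := hB.n
  have hpn := hB.pn
  have e1 := hR.n
  have e2 := hR.pn
  have h4 := hI.pos
  have ht := hB.tab σ.pn
  have ht' := hB.tab (σ.M.T 1 σ.pn)
  generalize u - 10 = u' at *
  generalize v - 10 = v' at *
  refine Ok.seq (Ok.getTab (by omega) (by omega) (by omega) ?_ ?_)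
  · simp only [Function.update_apply, Nat.reduceEqDiff, reduceIte, e1, e2, h11, h10,
        hRu, hRv, Nat.reduceLeDiff, nu, nv]; omega
  refine Ok.seq (Ok.getTab (by omega) (by omega) (by omega) ?_ ?_)
  · simp only [Function.update_apply, Nat.reduceEqDiff, reduceIte, e1, e2, h11, h10,
        hRu, hRv, Nat.reduceLeDiff, nu, nv]; omega
  refine Ok.seq (Ok.putTab (by omega) (by omega) (by omega) ?_ ?_ ?_)
  iterate 2 · simp only [Function.update_apply, Nat.reduceEqDiff, reduceIte, e1, e2, h11, h10,
        hRu, hRv, Nat.reduceLeDiff, nu, nv]; omega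
  refine Ok.seq (Ok.add (by omega) (by omega) (by omega) ?_ ?_)
  · simp only [Function.update_apply, Nat.reduceEqDiff, reduceIte, e1, e2, h11, h10,
        hRu, hRv, Nat.reduceLeDiff, nu, nv]; omega
  refine Ok.seq (Ok.add (by omega) (by omega) (by omega) ?_ ?_)
  · simp only [Function.update_apply, Nat.reduceEqDiff, reduceIte, e1, e2, h11, h10,
        hRu, hRv, Nat.reduceLeDiff, nu, nv]; omega
  refine Ok.seq (Ok.add (by omega) (by omega) (by omega) ?_ ?_)
  · simp only [Function.update_apply, Nat.reduceEqDiff, reduceIte, e1, e2, h11, h10,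
        hRu, hRv, Nat.reduceLeDiff, nu, nv]; omega
  refine Ok.seq (Ok.add (by omega) (by omega) (by omega) ?_ ?_)
  · simp only [Function.update_apply, Nat.reduceEqDiff, reduceIte, e1, e2, h11, h10,
        hRu, hRv, Nat.reduceLeDiff, nu, nv]; omega
  refine Ok.seq (Ok.add (by omega) (by omega) (by omega) ?_ ?_)
  · simp only [Function.update_apply, Nat.reduceEqDiff, reduceIte, e1, e2, h11, h10,
        hRu, hRv, Nat.reduceLeDiff, nu, nv]; omega
  refine Ok.seq (Ok.add (by omega) (by omega) (by omega) ?_ ?_)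
  · simp only [Function.update_apply, Nat.reduceEqDiff, reduceIte, e1, e2, h11, h10,
        hRu, hRv, Nat.reduceLeDiff, nu, nv]; omega
  refine Ok.seq (Ok.seq (Ok.putTab (by omega) (by omega) (by omega) ?_ ?_
    (Ok.putTab (by omega) (by omega) (by omega) ?_ ?_ ?_)))
  iterate 4 · simp only [Function.update_apply, Nat.reduceEqDiff, reduceIte, e1, e2, h11, h10,
        hRu, hRv, Nat.reduceLeDiff, nu, nv]; omega
  refine Ok.seq (Ok.seq (Ok.putTab (by omega) (by omega) (by omega) ?_ ?_
    (Ok.putTab (by omega) (by omega) (by omega) ?_ ?_ ?_)))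
  iterate 4 · simp only [Function.update_apply, Nat.reduceEqDiff, reduceIte, e1, e2, h11, h10,
        hRu, hRv, Nat.reduceLeDiff, nu, nv]; omega
  refine Ok.seq (Ok.seq (Ok.putTab (by omega) (by omega) (by omega) ?_ ?_
    (Ok.putTab (by omega) (by omega) (by omega) ?_ ?_ ?_)))
  iterate 4 · simp only [Function.update_apply, Nat.reduceEqDiff, reduceIte, e1, e2, h11, h10,
        hRu, hRv, Nat.reduceLeDiff, nu, nv]; omega
  refine Ok.seq (Ok.putTab (by omega) (by omega) (by omega) ?_ ?_
    (Ok.putTab (by omega) (by omega) (by omega) ?_ ?_ ⟨?_, ?_⟩))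
  iterate 4 · simp only [Function.update_apply, Nat.reduceEqDiff, reduceIte, e1, e2, h11, h10,
        hRu, hRv, Nat.reduceLeDiff, nu, nv]; omega
  · simp only [Function.update_apply, Nat.reduceEqDiff, reduceIte, e1, e2, h10, h11, hRu, hRv, Nat.reduceLeDiff, nu, nv, PSt.bin, Tab.rule]
  · constructor <;> simp only [Function.update_apply, Nat.reduceEqDiff, reduceIte, PSt.bin, hR.i, hR.n,
      hR.pn, hR.s₁, hR.s₂, hR.g₁, hR.g₂, hR.e]

theorem steps_annot {u : ℕ} (hu : u = 10 ∨ u = 11) :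
    Steps w l (annotProg u) σ (σ.annot (u - 10)) := by
  intro i R hi hB hR
  have hD : dim l = 2 * l.length + 2 := rfl
  refine Ok.intro fun hI => ?_
  have h10 := hI.consts.zero
  have h11 := hI.consts.one
  have hRu : R u = u - 10 := by rcases hu with rfl | rfl <;> assumption
  have hu1 : u - 10 ≤ 1 := by omega
  have hu10 : 10 ≤ u := by omega
  have nu : ∀ j, 20 ≤ j → u ≠ j := by omega
  have hn := hB.n
  have hpn := hB.pn
  have e1 := hR.n
  have e2 := hR.pn
  have h4 := hI.pos
  have e3 := hR.s₁
  generalize u - 10 = u' at *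
  refine Ok.seq (Ok.add (by omega) (by omega) (by omega) ?_ ?_)
  · simp only [Function.update_apply, Nat.reduceEqDiff, reduceIte, e1, e2, h11, h10, hRu, Nat.reduceLeDiff, nu]; omega
  refine Ok.seq (Ok.putTab (by omega) (by omega) (by omega) ?_ ?_ ?_)
  iterate 2 · simp only [Function.update_apply, Nat.reduceEqDiff, reduceIte, e1, e2, h11, h10, hRu, Nat.reduceLeDiff, nu]; omega
  refine Ok.seq (Ok.putTab (by omega) (by omega) (by omega) ?_ ?_ ?_)
  iterate 2 · simp only [Function.update_apply, Nat.reduceEqDiff, reduceIte, e1, e2, h11, h10, hRu, Nat.reduceLeDiff, nu]; omega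
  refine Ok.seq (Ok.add (by omega) (by omega) (by omega) ?_ ?_)
  · simp only [Function.update_apply, Nat.reduceEqDiff, reduceIte, e1, e2, h11, h10, hRu, Nat.reduceLeDiff, nu]; omega
  refine Ok.ite_eq (by omega) (by omega) (fun h => ?_) (fun h => ?_) <;>
    simp only [Function.update_apply, Nat.reduceEqDiff, reduceIte, e3, h10] at h
  · refine Ok.add (by omega) (by omega) (by omega) ?_ ⟨?_, ?_⟩
    · simp only [Function.update_apply, Nat.reduceEqDiff, reduceIte, e1, e2, h11, h10, hRu,
        Nat.reduceLeDiff, nu]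
      omega
    · simp only [Function.update_apply, Nat.reduceEqDiff, reduceIte, e1, e2, h11, PSt.annot]
    · constructor <;> simp only [Function.update_apply, Nat.reduceEqDiff, reduceIte, PSt.annot, hR.i,
        hR.n, hR.pn, hR.s₁, hR.s₂, hR.g₁, hR.g₂, hR.e, h, h10, hRu, Nat.reduceLeDiff, nu,
        Nat.add_zero]
  · refine Ok.skip ⟨?_, ?_⟩
    · simp only [Function.update_apply, Nat.reduceEqDiff, reduceIte, e1, e2, h11, PSt.annot]
    · constructor <;> simp only [Function.update_apply, Nat.reduceEqDiff, reduceIte, PSt.annot, hR.i,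
        hR.n, hR.pn, hR.s₁, hR.s₂, hR.g₁, hR.g₂, hR.e, h, h10, hRu, Nat.reduceLeDiff, nu]

theorem steps_endSeq : Steps w l endSeqProg σ σ.endSeq := by
  intro i R hi hB hR
  have hD : dim l = 2 * l.length + 2 := rfl
  refine Ok.intro fun hv => ?_
  have h10 := hv.consts.zero
  have h11 := hv.consts.one
  have hs₁ := hB.s₁
  have hs₂ := hB.s₂
  have e3 := hR.s₁
  have e4 := hR.s₂
  have e5 := hR.g₁
  have hn := hB.n
  have hpn := hB.pn
  have e1 := hR.n
  have e2 := hR.pn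
  have h4 := hv.pos
  refine Ok.ite_eq (by omega) (by omega) (fun h1 => ?_) (fun h1 => ?_) <;>
    rw [e3, h10] at h1
  · refine Ok.ite_eq (by omega) (by omega) (fun h2 => ?_) (fun h2 => ?_) <;> rw [e5, h10] at h2
    · refine Ok.seq (Ok.add (by omega) (by omega) (by omega) (by omega) ?_)
      refine Ok.add (by omega) (by omega) (by omega) ?_ ⟨?_, ?_⟩
      · simp only [Function.update_apply, Nat.reduceEqDiff, reduceIte, e1, h10]; omega
      · simp only [PSt.endSeq, h1, h2, reduceIte]
      · constructor <;> simp only [PSt.endSeq, h1, h2, reduceIte, Function.update_apply,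
          Nat.reduceEqDiff, hR.i, hR.n, hR.pn, hR.s₁, hR.s₂, hR.g₁, hR.g₂, hR.e, h10, Nat.add_zero]
    · refine Ok.const (by omega) (by omega) ⟨?_, ?_⟩
      · simp only [PSt.endSeq, h1, h2, reduceIte]
      · constructor <;> simp only [PSt.endSeq, h1, h2, reduceIte, Function.update_apply,
          Nat.reduceEqDiff, hR.i, hR.n, hR.pn, hR.s₁, hR.s₂, hR.g₁, hR.g₂, hR.e, h10]
  · refine Ok.seq (Ok.ite_eq (by omega) (by omega) (fun h2 => ?_) (fun h2 => ?_)) <;>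
      rw [e5, h10] at h2
    · refine Ok.seq (Ok.add (by omega) (by omega) (by omega) (by omega) ?_)
      refine Ok.add (by omega) (by omega) (by omega) ?_ ?_
      · simp only [Function.update_apply, Nat.reduceEqDiff, reduceIte, e4, h10]; omega
      refine Ok.const (by omega) (by omega) ⟨?_, ?_⟩
      · simp only [PSt.endSeq, h1, h2, reduceIte]
      · constructor <;> simp only [PSt.endSeq, h1, h2, reduceIte, Function.update_apply,
          Nat.reduceEqDiff, hR.i, hR.n, hR.pn, hR.s₁, hR.s₂, hR.g₁, hR.g₂, hR.e, h10, Nat.add_zero]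
    · refine Ok.markPair (by omega) (by omega) (by omega) (by omega) ?_
      refine Ok.const (by omega) (by omega) ⟨?_, ?_⟩
      · simp only [PSt.endSeq, h1, h2, reduceIte, e3, e4]
      · constructor <;> simp only [PSt.endSeq, h1, h2, reduceIte, Function.update_apply,
          Nat.reduceEqDiff, hR.i, hR.n, hR.pn, hR.s₁, hR.s₂, hR.g₁, hR.g₂, hR.e, h10]

end ParseOk

end OL

namespace OL

section ParseLoop

variable {w : ℕ} {l : List ℕ} {σ : PSt} {i : ℕ} {R : ℕ → ℕ}

theorem PSt.Regs.update (h : PSt.Regs σ i R) {d : ℕ} (hd : 28 ≤ d) (v : ℕ) :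
    PSt.Regs σ i (Function.update R d v) := by
  constructor <;> rw [Function.update_of_ne (by omega)]
  exacts [h.i, h.n, h.pn, h.s₁, h.s₂, h.g₁, h.g₂, h.e]

theorem steps_next {σ' : PSt} (hσ : σ'.n = σ.n) (hB : PSt.Bounds l σ i) (hi : i < l.length)
    (hR : PSt.Regs σ' i R) :
    Ok w l nextProg (fun M' R' => M' = σ'.next.M ∧ PSt.Regs σ'.next (i + 1) R') σ'.M R := by
  have hD : dim l = 2 * l.length + 2 := rfl
  refine Ok.intro fun hv => ?_
  have h10 := hv.consts.zero
  have h11 := hv.consts.one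
  have hn := hB.n
  have e1 := hR.n
  have e2 := hR.i
  have h4 := hv.pos
  refine Ok.seq (Ok.add (by omega) (by omega) (by omega) (by omega) ?_)
  refine Ok.seq (Ok.add (by omega) (by omega) (by omega) ?_ ?_)
  · simp only [Function.update_apply, Nat.reduceEqDiff, reduceIte]; omega
  refine Ok.seq (Ok.add (by omega) (by omega) (by omega) ?_ ?_)
  · simp only [Function.update_apply, Nat.reduceEqDiff, reduceIte]; omega
  refine Ok.add (by omega) (by omega) (by omega) ?_ ⟨rfl, ?_⟩
  · simp only [Function.update_apply, Nat.reduceEqDiff, reduceIte]; omega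
  · constructor <;> simp only [Function.update_apply, Nat.reduceEqDiff, reduceIte, PSt.next, hR.i,
      hR.n, hR.pn, hR.s₁, hR.s₂, hR.g₁, hR.g₂, hR.e, h10, h11, Nat.add_zero]

theorem stepProg_ok (hi : i < l.length) (hB : PSt.Bounds l σ i) (hR : PSt.Regs σ i R) :
    Ok w l stepProg (fun M' R' => M' = (σ.step (l.getD i 0)).M ∧
      PSt.Regs (σ.step (l.getD i 0)) (i + 1) R') σ.M R := by
  refine Ok.intro fun hv => ?_
  have h10 := hv.consts.zero
  have h11 := hv.consts.one
  refine Ok.seq (Ok.getInput (by omega) (by omega) (by rw [hR.i]; exact hi) ?_)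
  rw [hR.i, PSt.step]
  have hR' := hR.update (d := 28) le_rfl (l.getD i 0)
  generalize hc : l.getD i 0 = c at *
  have h28 : Function.update R 28 c 28 = c := Function.update_self ..
  have k10 : Function.update R 28 c 10 = 0 := h10
  have k11 : Function.update R 28 c 11 = 1 := h11
  generalize Function.update R 28 c = R' at *
  clear hR hc h10 h11 hv
  -- No branch moves the next node, so the advance to the next symbol is the same after all of them.
  have fin : ∀ {p : Prog} {σ' : PSt} {R}, Steps w l p σ σ' → σ'.n = σ.n → PSt.Regs σ i R →
      Ok w l p (fun M R => Ok w l nextProg (fun M' R' => M' = σ'.next.M ∧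
        PSt.Regs σ'.next (i + 1) R') M R) σ.M R := by
    intro p σ' R h hn hR
    refine (h i R hi hB hR).mono ?_
    rintro M R ⟨rfl, hR⟩
    exact steps_next hn hB hi hR
  refine Ok.seq (Ok.ite_eq (by omega) (by omega) (fun h => ?_) (fun h => ?_)) <;>
    rw [h28, k10] at h
  · rw [if_pos h]
    refine fin steps_endSeq ?_ hR'
    unfold PSt.endSeq
    split_ifs <;> rfl
  rw [if_neg h]
  refine Ok.ite_eq (by omega) (by omega) (fun h => ?_) (fun h => ?_) <;>
    rw [h28, k11] at h
  · rw [if_pos h]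
    exact fin (steps_annot (.inl rfl)) rfl hR'
  rw [if_neg h]
  -- One link of the chain of tests; the remaining alternatives enter through a hypothesis, so the
  -- chain is peeled off one symbol at a time.
  have key : ∀ {k : ℕ} {p q : Prog} {σ₁ σ₂ : PSt} {R}, k < 16 →
      PSt.Regs σ i R → R 28 = c →
      Steps w l p σ σ₁ → σ₁.n = σ.n →
      (∀ R, PSt.Regs σ i R → R 28 = c → 
        Ok w l q (fun M R => Ok w l nextProg (fun M' R' => M' = σ₂.next.M ∧
        PSt.Regs σ₂.next (i + 1) R') M R) σ.M R) → 
      Ok w l (.const 29 k ⨾ .ite (.eq 28 29) p q) (fun M R => Ok w l nextProg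
        (fun M' R' => M' = (if c = k then σ₁ else σ₂).next.M ∧
        PSt.Regs (if c = k then σ₁ else σ₂).next (i + 1) R') M R) σ.M R := by
    intro k p q σ₁ σ₂ R hk hR h28 h1 h2 h3
    refine Ok.seq (Ok.const (by omega) hk (Ok.ite_eq (by omega) (by omega)
      (fun h => ?_) (fun h => ?_))) <;>
      simp only [Function.update_apply, Nat.reduceEqDiff, reduceIte, h28] at h
    · rw [if_pos h]
      exact fin h1 h2 (hR.update (by omega) _)
    · rw [if_neg h]
      exact h3 _ (hR.update (by omega) _) (by simp [h28])
  refine key (by omega) hR' h28 (steps_annot (.inr rfl)) rfl fun R hR h28 => ?_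
  refine key (by omega) hR h28 steps_bot rfl fun R hR h28 => ?_
  refine key (by omega) hR h28 steps_top rfl fun R hR h28 => ?_
  refine key (by omega) hR h28 steps_neg rfl fun R hR h28 => ?_
  refine key (by omega) hR h28 (steps_bin (.inl rfl) (.inr rfl) _) rfl fun R hR h28 => ?_
  refine key (by omega) hR h28 (steps_bin (.inr rfl) (.inl rfl) _) rfl fun R hR h28 => ?_
  exact fin (steps_leaf _) rfl hR

theorem Tab.put_T (M : Tab) (k y v k' y' : ℕ) :
    (M.put k y v).T k' y' = if k' = k ∧ y' = y then v else M.T k' y' := by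
  simp only [Tab.put, Function.update_apply]
  by_cases h : k' = k
  · subst h
    by_cases h' : y' = y <;> simp [h', Function.update_apply]
  · simp [h]

/-- The bound on table `1` leaves room for the offset `1` of a right annotation, so a node computed
from an entry is again an index into the tables. -/
theorem PSt.Bounds.step (hB : PSt.Bounds l σ i) (hi : i < l.length) (c : ℕ) :
    PSt.Bounds l (σ.step c) (i + 1) := by
  have hD : dim l = 2 * l.length + 2 := rfl
  have h1 := hB.n
  have h2 := hB.pn
  have h3 := hB.s₁
  have h4 := hB.s₂
  have h5 := hB.tab
  have h6 := h5 σ.pn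
  have h7 := h5 (σ.M.T 1 σ.pn)
  have put1 : ∀ v, v + 1 < dim l → ∀ y, (σ.M.put 1 σ.n v).T 1 y + 1 < dim l := by
    intro v hv y
    rw [Tab.put_T]
    split_ifs
    exacts [hv, h5 y]
  unfold PSt.step
  split_ifs
  · unfold PSt.endSeq
    split_ifs <;> constructor <;> simp only [PSt.next, Tab.mark] <;>
      omega
  iterate 2
    · constructor <;> simp only [PSt.next, PSt.annot, Tab.put_T, Nat.reduceEqDiff, false_and,
        if_false]
      · omega
      · omega
      · split_ifs <;> omega
      · omega
      · exact h5
  iterate 2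
    · constructor <;> simp only [PSt.next, PSt.mark, PSt.leaf, Tab.mark] <;>
        first | omega | exact put1 _ (by omega)
  · constructor <;> simp only [PSt.next, PSt.neg, Tab.rule, Tab.put_T _ 2, Tab.put_T _ 3,
      Nat.reduceEqDiff, false_and, if_false] <;>
      first | omega | exact put1 _ (by omega)
  iterate 2
    · constructor <;> simp only [PSt.next, PSt.bin, Tab.rule, Tab.put_T _ 2, Tab.put_T _ 3,
        Nat.reduceEqDiff, false_and, if_false] <;>
        first | omega | exact put1 _ (by omega)
  · constructor <;> simp only [PSt.next, PSt.leaf] <;>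
      first | omega | exact put1 _ (by omega)

/-- The state of the parser after it has read the string. -/
def PSt.run (l : List ℕ) : PSt := l.foldl PSt.step PSt.init

theorem PSt.run_take_succ (hi : i < l.length) :
    PSt.run (l.take (i + 1)) = (PSt.run (l.take i)).step (l.getD i 0) := by
  rw [PSt.run, PSt.run, List.take_succ_eq_append_getElem hi, List.foldl_append]
  simp [List.getElem?_eq_getElem hi]

theorem PSt.bounds_run (hi : i ≤ l.length) : PSt.Bounds l (PSt.run (l.take i)) i := by
  induction i with
  | zero =>
    constructor <;> simp only [PSt.run, List.take_zero, List.foldl_nil, PSt.init, dim] <;> omega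
  | succ i ih =>
    rw [PSt.run_take_succ hi]
    exact (ih (by omega)).step hi _

def parseProg : Prog := .while (.lt 20 19) stepProg

theorem parseProg_ok (hR : PSt.Regs PSt.init 0 R) :
    OkT w l (l.length * (stepProg.cost + 1) + 1) parseProg
      (fun M R => M = (PSt.run l).M ∧ PSt.Regs (PSt.run l) l.length R) PSt.init.M R := by
  refine OkT.intro fun hv => ?_
  refine (OkT.for (by omega) (by omega) stepProg.cost l.length
    (fun k M R => M = (PSt.run (l.take k)).M ∧ PSt.Regs (PSt.run (l.take k)) k R ∧
      R 19 = l.length) ?_ ?_ 0 (by omega) ?_).mono le_rfl ?_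
  · rintro k M R ⟨_, h, h'⟩
    exact ⟨h.i, h'⟩
  · rintro k M R hv hk ⟨rfl, h, _⟩
    refine (stepProg_ok hk (PSt.bounds_run hk.le) h).timed.mono le_rfl ?_
    rintro M R hv ⟨rfl, h⟩
    rw [PSt.run_take_succ hk]
    exact ⟨rfl, h, hv.consts.len⟩
  · exact ⟨rfl, hR, hv.consts.len⟩
  · rintro M R hv ⟨h1, h2, _⟩
    rw [List.take_length] at h1 h2
    exact ⟨h1, h2⟩

end ParseLoop
end OL

namespace OL

/-! ### Initial pairs for variables -/

/-- A left and a right occurrence of the same variable in a string. -/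
def VarPair (l : List ℕ) (i j : ℕ) (p : ℕ × ℕ) : Prop :=
  l.getD i 0 = l.getD j 0 ∧ 7 < l.getD i 0 ∧ p = (2 * i + 2, 2 * j + 3)

/-- Registers `34` and `35` hold the symbols at the two positions, `31` the left node of the first
and `33` the right node of the second. Register `36` holds `7`, the largest symbol that is not a
variable. -/
def varBody : Prog :=
  getInput 35 32 ⨾ .ite (.eq 34 35) (.ite (.lt 36 34) (markPair 31 33) skip) skip ⨾
    .op .add 32 32 11 ⨾ .op .add 33 33 11 ⨾ .op .add 33 33 11

def varPre : Prog := getInput 34 30 ⨾ .const 32 0 ⨾ .const 33 3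

def varPost : Prog := .op .add 30 30 11 ⨾ .op .add 31 31 11 ⨾ .op .add 31 31 11

def varProg : Prog :=
  (.const 36 7 ⨾ .const 30 0 ⨾ .const 31 2) ⨾
    .while (.lt 30 19) (varPre ⨾ .while (.lt 32 19) varBody ⨾ varPost)

section VarLoop

variable {w : ℕ} {l : List ℕ} {M : Tab} {R : ℕ → ℕ}

/-- The registers below `30` are the same. -/
def Keep (R₀ R : ℕ → ℕ) : Prop := ∀ r < 30, R r = R₀ r

theorem Keep.update {R₀ R : ℕ → ℕ} (h : Keep R₀ R) {d : ℕ} (hd : 30 ≤ d) (v : ℕ) :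
    Keep R₀ (Function.update R d v) := fun r hr => by
  rw [Function.update_of_ne (by omega)]
  exact h r hr

theorem Tab.mem_mark {x y : ℕ} {p : ℕ × ℕ} : p ∈ (M.mark x y).Q ↔ p ∈ M.Q ∨ p = (x, y) := by
  simp only [Tab.mark]
  split_ifs with h
  · constructor
    · exact .inl
    · rintro (h' | rfl) <;> assumption
  · simp

theorem Tab.prefix_mark {x y : ℕ} : M.Q <+: (M.mark x y).Q := by
  simp only [Tab.mark]
  split_ifs with h
  · exact List.prefix_rfl
  · exact List.prefix_append _ _

/-- The invariant of the inner loop. -/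
structure VarInv (l : List ℕ) (M₀ : Tab) (R₀ : ℕ → ℕ) (i j : ℕ) (M : Tab) (R : ℕ → ℕ) : Prop where
  T : M.T = M₀.T
  mem : ∀ p, p ∈ M.Q ↔ p ∈ M₀.Q ∨ (∃ i' < i, ∃ j' < l.length, VarPair l i' j' p) ∨
    ∃ j' < j, VarPair l i j' p
  keep : Keep R₀ R
  r30 : R 30 = i
  r31 : R 31 = 2 * i + 2
  r32 : R 32 = j
  r33 : R 33 = 2 * j + 3
  r34 : R 34 = l.getD i 0
  r36 : R 36 = 7
  r19 : R 19 = l.length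

theorem varBody_ok {M₀ : Tab} {R₀ : ℕ → ℕ} {i j : ℕ} (hi : i < l.length) (hj : j < l.length)
    (hI : VarInv l M₀ R₀ i j M R) : Ok w l varBody (VarInv l M₀ R₀ i (j + 1)) M R := by
  refine Ok.intro fun hv => ?_
  have h11 := hv.consts.one
  have hD : dim l = 2 * l.length + 2 := rfl
  have h4 := hv.pos
  obtain ⟨hT, hQ, hK, h30, h31, h32, h33, h34, h36, h19⟩ := hI
  have fin : ∀ M', M'.T = M₀.T →
      (∀ p, p ∈ M'.Q ↔ p ∈ M.Q ∨ VarPair l i j p) →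
      Ok w l (.op .add 32 32 11 ⨾ .op .add 33 33 11 ⨾ .op .add 33 33 11)
        (VarInv l M₀ R₀ i (j + 1)) M' (Function.update R 35 (l.getD j 0)) := by
    intro M' hT' hQ'
    refine Ok.seq (Ok.add (by omega) (by omega) (by omega) ?_ (Ok.seq
      (Ok.add (by omega) (by omega) (by omega) ?_ (Ok.add (by omega) (by omega) (by omega) ?_
      ⟨hT', ?_, ?_, ?_, ?_, ?_, ?_, ?_, ?_, ?_⟩))))
    iterate 3
      · simp only [Function.update_apply, Nat.reduceEqDiff, reduceIte, h11, h32, h33]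
        omega
    · intro p
      rw [hQ', hQ]
      simp only [Nat.lt_succ_iff_lt_or_eq, or_and_right, exists_or, exists_eq_left, or_assoc]
    · exact (((hK.update (by omega) _).update (by omega) _).update (by omega) _).update
        (by omega) _
    all_goals
      simp only [Function.update_apply, Nat.reduceEqDiff, reduceIte, h11, h32, h33, h30, h31, h34,
        h36, h19]
    omega
  refine Ok.seq (Ok.getInput (by omega) (by omega) (by omega) ?_)
  rw [h32]
  refine Ok.seq (Ok.ite_eq (by omega) (by omega) (fun h => ?_) (fun h => ?_)) <;>
    simp only [Function.update_apply, Nat.reduceEqDiff, reduceIte, h34] at h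
  · refine Ok.ite_lt (by omega) (by omega) (fun h' => ?_) (fun h' => ?_) <;>
      simp only [Function.update_apply, Nat.reduceEqDiff, reduceIte, h34, h36] at h'
    · refine Ok.markPair (by omega) (by omega) ?_ ?_ (fin _ hT fun p => ?_)
      iterate 2
        · simp only [Function.update_apply, Nat.reduceEqDiff, reduceIte, h31, h33]
          omega
      rw [Tab.mem_mark]
      simp only [Function.update_apply, Nat.reduceEqDiff, reduceIte, h31, h33, VarPair, h, true_and,
        and_iff_right (h ▸ h')]
    · exact Ok.skip (fin _ hT fun p => ⟨.inl, fun hp => hp.elim id fun hp => absurd hp.2.1 h'⟩)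
  · exact Ok.skip (fin _ hT fun p => ⟨.inl, fun hp => hp.elim id fun hp => absurd hp.1 h⟩)

/-- The time of one pass of the inner loop, with the instructions around it. -/
def varCost : ℕ := varBody.cost + varPre.cost + varPost.cost + 4

theorem varProg_ok (M₀ : Tab) (R₀ : ℕ → ℕ) :
    OkT w l (varCost * ((l.length + 1) * (l.length + 1))) varProg (fun M R =>
      M.T = M₀.T ∧ (∀ p, p ∈ M.Q ↔ p ∈ M₀.Q ∨
        ∃ i < l.length, ∃ j < l.length, VarPair l i j p) ∧ Keep R₀ R) M₀ R₀ := by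
  let n := l.length
  let I : ℕ → Tab → (ℕ → ℕ) → Prop := fun i M R =>
    M.T = M₀.T ∧ (∀ p, p ∈ M.Q ↔ p ∈ M₀.Q ∨ ∃ i' < i, ∃ j' < l.length, VarPair l i' j' p) ∧
      Keep R₀ R ∧ R 30 = i ∧ R 31 = 2 * i + 2 ∧ R 36 = 7 ∧ R 19 = l.length
  have hD : dim l = 2 * l.length + 2 := rfl
  have body : ∀ i M R, Inv l M R → i < l.length → I i M R →
      OkT w l (varPre.cost + ((n - 0) * (varBody.cost + 1) + 1 + varPost.cost))
        (varPre ⨾ .while (.lt 32 19) varBody ⨾ varPost) (I (i + 1)) M R := by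
    rintro i M R hv hi ⟨hT, hQ, hK, h30, h31, h36, h19⟩
    have h4 := hv.pos
    refine OkT.seq (Ok.timed (Ok.seq (Ok.getInput (by omega) (by omega) (by omega)
      (Ok.seq (Ok.const (by omega) (by omega) (Ok.const (by omega) (by omega) ?_))))))
    refine OkT.seq ((OkT.for (by omega) (by omega) varBody.cost l.length (VarInv l M₀ R₀ i)
      (fun _ _ _ h => ⟨h.r32, h.r19⟩) (fun j M R _ hj h => (varBody_ok hi hj h).timed) 0
      (by omega) ⟨hT, ?_, ?_, ?_, ?_, ?_, ?_, ?_, ?_, ?_⟩).mono le_rfl ?_)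
    · intro p
      simp [hQ]
    · exact ((hK.update (by omega) _).update (by omega) _).update (by omega) _
    iterate 7
      · simp only [Function.update_apply, Nat.reduceEqDiff, reduceIte, h30, h31, h36, h19]
    intro M R hv hI
    have h11 := hv.consts.one
    have h30 := hI.r30
    have h31 := hI.r31
    refine Ok.timed (Ok.seq (Ok.add (by omega) (by omega) (by omega) (by omega) (Ok.seq
      (Ok.add (by omega) (by omega) (by omega) ?_ (Ok.add (by omega) (by omega) (by omega) ?_
      ⟨hI.T, ?_, ?_, ?_, ?_, ?_, ?_⟩)))))
    iterate 2
      · simp only [Function.update_apply, Nat.reduceEqDiff, reduceIte, h11, h31]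
        omega
    · intro p
      rw [hI.mem]
      simp only [Nat.lt_succ_iff_lt_or_eq, or_and_right, exists_or, exists_eq_left]
    · exact ((hI.keep.update (by omega) _).update (by omega) _).update (by omega) _
    all_goals
      simp only [Function.update_apply, Nat.reduceEqDiff, reduceIte, h11, h30, h31, hI.r36, hI.r19]
    omega
  refine OkT.intro fun hv => ?_
  have h19 := hv.consts.len
  refine (OkT.seq (Ok.timed (Ok.seq (Ok.const (by omega) (by omega) (Ok.seq
    (Ok.const (by omega) (by omega) (Ok.const (by omega) (by omega)
    (OkT.for (by omega) (by omega) _ l.length I (fun _ _ _ h => ⟨h.2.2.2.1, h.2.2.2.2.2.2⟩)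
      body 0 (by omega) ⟨rfl, ?_, ?_, ?_, ?_, ?_, ?_⟩)))))))).mono ?_ ?_
  · intro p
    simp
  · exact Keep.update (Keep.update (Keep.update (fun _ _ => rfl) (by omega) _) (by omega) _)
      (by omega) _
  iterate 4
    · simp only [Function.update_apply, Nat.reduceEqDiff, reduceIte, h19]
  · have e1 : varBody.cost = 20 := by rfl
    have e2 : varPre.cost = 3 := by rfl
    have e3 : varPost.cost = 3 := by rfl
    simp only [varCost, e1, e2, e3, Prog.cost, n, Nat.sub_zero]
    nlinarith
  · rintro M R _ ⟨h1, h2, h3, _⟩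
    exact ⟨h1, h2, h3⟩

end VarLoop
end OL

namespace OL

/-! ### The closure loop -/

/-- The first `h` elements of the queue have been processed. -/
structure Done (l : List ℕ) (T : ℕ → ℕ → ℕ) (Q : List (ℕ × ℕ)) (h : ℕ) : Prop where
  symm : ∀ x y, (x, y) ∈ Q.take h → (y, x) ∈ Q
  self : ∀ x z, (x, x) ∈ Q.take h → 2 ≤ z → z < dim l → (x, z) ∈ Q
  rule : ∀ x y s, T 3 y = s → T 3 s = y → T 2 s = T 2 y →
    (x, y) ∈ Q.take h → (x, s) ∈ Q.take h → (x, T 2 y) ∈ Q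
  cut : ∀ x y q z, T 4 y = q → T 4 q = y → y ≠ 0 → q ≠ 0 → y ≠ q →
    (x, y) ∈ Q.take h → (z, q) ∈ Q.take h → (x, z) ∈ Q ∨ (z, x) ∈ Q

/-- The queue `Q'` extends `Q` by the immediate consequences of the pair `x, y`. -/
structure Extends (l : List ℕ) (T : ℕ → ℕ → ℕ) (Q Q' : List (ℕ × ℕ)) (x y : ℕ) : Prop where
  pre : Q <+: Q'
  symm : (y, x) ∈ Q'
  self : ∀ z, x = y → 2 ≤ z → z < dim l → (x, z) ∈ Q'
  rule : (x, T 3 y) ∈ Q → (x, T 2 y) ∈ Q'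
  cut : ∀ z, T 4 y ≠ 0 → (T 4 y, z) ∈ Q → (x, z) ∈ Q'

/-- An inference with two premises is triggered by the premise that is processed last. For logical
rules this works because table `3` links the two premises to each other. For cuts, symmetry has put
the mirror image of the earlier premise into the queue, where the scan finds it. If the second
premise comes last, the conclusion appears with its components exchanged; this is why `Done.cut`
ends in a disjunction. -/
theorem Done.step {l : List ℕ} {T : ℕ → ℕ → ℕ} {Q Q' : List (ℕ × ℕ)} {h x y : ℕ}
    (hd : Done l T Q h) (hlt : h < Q.length) (hxy : Q.getD h (0, 0) = (x, y))
    (he : Extends l T Q Q' x y) : Done l T Q' (h + 1) := by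
  have hget : Q[h] = (x, y) := by rw [← hxy, List.getD_eq_getElem _ _ hlt]
  have htake : Q'.take (h + 1) = Q.take h ++ [(x, y)] := by
    obtain ⟨Q'', rfl⟩ := he.pre
    rw [List.take_append_of_le_length hlt, List.take_succ_eq_append_getElem hlt, hget]
  have hmem : (x, y) ∈ Q := hget ▸ List.getElem_mem hlt
  have hsub : ∀ {p}, p ∈ Q → p ∈ Q' := fun hp => he.pre.subset hp
  have htk : ∀ {p}, p ∈ Q.take h → p ∈ Q := fun hp => List.take_subset _ _ hp
  have hcase : ∀ {a b}, (a, b) ∈ Q'.take (h + 1) → (a, b) ∈ Q.take h ∨ (a = x ∧ b = y) := by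
    intro a b hab
    rw [htake, List.mem_append, List.mem_singleton, Prod.mk.injEq] at hab
    exact hab
  constructor
  · intro a b hab
    rcases hcase hab with hab | ⟨rfl, rfl⟩
    · exact hsub (hd.symm _ _ hab)
    · exact he.symm
  · intro a z hab h1 h2
    rcases hcase hab with hab | ⟨rfl, hab⟩
    · exact hsub (hd.self _ _ hab h1 h2)
    · exact he.self z hab h1 h2
  · intro a b s h1 h2 h3 hab has
    rcases hcase hab with hab | ⟨rfl, rfl⟩
    · rcases hcase has with has | ⟨rfl, rfl⟩
      · exact hsub (hd.rule _ _ _ h1 h2 h3 hab has)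
      · rw [← h3]
        exact he.rule (h2 ▸ htk hab)
    · refine he.rule ?_
      -- In the second case both premises are the current pair, as for a rule with one premise,
      -- which is stored with `s = y`.
      rcases hcase has with has | ⟨-, rfl⟩
      · exact h1 ▸ htk has
      · rw [h1]
        exact hmem
  · intro a b q z h1 h2 h3 h4 h5 hab hzq
    rcases hcase hab with hab | ⟨rfl, rfl⟩
    · rcases hcase hzq with hzq | ⟨rfl, rfl⟩
      · exact (hd.cut _ _ _ _ h1 h2 h3 h4 h5 hab hzq).imp hsub hsub
      · exact .inr (he.cut _ (h2 ▸ h3) (h2 ▸ hd.symm _ _ hab))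
    · rcases hcase hzq with hzq | ⟨rfl, rfl⟩
      · exact .inl (he.cut _ (h1 ▸ h4) (h1 ▸ hd.symm _ _ hzq))
      · exact absurd rfl h5

/-- A relation on nodes that is closed under all inferences. -/
structure ClosedRel (l : List ℕ) (T : ℕ → ℕ → ℕ) (G : ℕ → ℕ → Prop) : Prop where
  bdd : ∀ x y, G x y → 2 ≤ y ∧ y < dim l
  symm : ∀ x y, G x y → G y x
  self : ∀ x z, G x x → 2 ≤ z → z < dim l → G x z
  rule : ∀ x y, G x y → G x (T 3 y) → G x (T 2 y)
  cut : ∀ x y z, T 4 y ≠ 0 → G x y → G (T 4 y) z → G x z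

/-- Weakening and cuts share one scan over `z`. Register `34` holds `1` if `x = y` and `0`
otherwise; it is added to the matrix cell of the dual node of `y` and `z`, so the sum is positive
when the pair `x, z` has to be marked. -/
def cutBody : Prog :=
  getCell 36 33 35 ⨾ .op .add 36 36 34 ⨾ .ite (.lt 10 36) (markPair 31 35) skip ⨾
    .op .add 35 35 11

def cutLoop : Prog := .const 35 2 ⨾ .while (.lt 35 12) cutBody

def closePre : Prog :=
  getQueue 31 32 30 ⨾ markPair 32 31 ⨾ .const 34 0 ⨾
    .ite (.eq 31 32) (.const 34 1) skip ⨾ getTab 4 33 32 ⨾ .op .add 36 33 34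

/-- A missing rule has the entry `0` in table `3`. Nodes start at `2`, so the matrix cell read in
that case is never marked and no test for a missing entry is needed. -/
def closePost : Prog :=
  getTab 3 38 32 ⨾ getTab 2 39 32 ⨾ getCell 36 31 38 ⨾
    .ite (.lt 10 36) (markPair 31 39) skip ⨾ .op .add 30 30 11 ⨾ getLength 37

def closeBody : Prog := closePre ⨾ .ite (.lt 10 36) cutLoop skip ⨾ closePost

def closeProg : Prog := (.const 30 0 ⨾ getLength 37) ⨾ .while (.lt 30 37) closeBody

section CloseLoop

variable {w : ℕ} {l : List ℕ} {M : Tab} {R : ℕ → ℕ} {T : ℕ → ℕ → ℕ} {G : ℕ → ℕ → Prop}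

/-- The invariant while the pair `x, y`, the element `h` of the queue, is processed. -/
structure CutInv (T : ℕ → ℕ → ℕ) (G : ℕ → ℕ → Prop) (R₀ : ℕ → ℕ) (h x y u : ℕ)
    (M : Tab) (R : ℕ → ℕ) : Prop where
  tab : M.T = T
  rel : ∀ p ∈ M.Q, G p.1 p.2
  keep : Keep R₀ R
  r30 : R 30 = h
  r31 : R 31 = x
  r32 : R 32 = y
  r33 : R 33 = T 4 y
  r34 : R 34 = u

/-- The scan may enlarge the row that it is reading. Only the pairs in the older queue `Q` have to
be taken into account, and acting on newer ones is harmless because every marked pair remains in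
`G`. -/
theorem cutBody_ok (hG : ClosedRel l T G) {R₀ : ℕ → ℕ} {h x y u z : ℕ} {Q : List (ℕ × ℕ)}
    (hxy : G x y) (hu : u = if x = y then 1 else 0) (hqu : 0 < T 4 y + u)
    (hz : 2 ≤ z) (hz' : z < dim l)
    (hI : CutInv T G R₀ h x y u M R) (hQ : Q <+: M.Q) (h35 : R 35 = z)
    (hc : ∀ z' < z, 2 ≤ z' → (T 4 y, z') ∈ Q ∨ x = y → (x, z') ∈ M.Q) :
    Ok w l cutBody (fun M R => CutInv T G R₀ h x y u M R ∧ Q <+: M.Q ∧ R 35 = z + 1 ∧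
      ∀ z' < z + 1, 2 ≤ z' → (T 4 y, z') ∈ Q ∨ x = y → (x, z') ∈ M.Q) M R := by
  refine Ok.intro fun hv => ?_
  have h10 := hv.consts.zero
  have h11 := hv.consts.one
  have h4 := hv.pos
  obtain ⟨hT, hMG, hK, h30, h31, h32, h33, h34⟩ := hI
  have hq : T 4 y < dim l := hT ▸ hv.tab_lt 4 y
  have hx := (hG.bdd _ _ (hG.symm _ _ hxy)).2
  have hu1 : u ≤ 1 := by rw [hu]; split_ifs <;> omega
  have fin : ∀ M' R', CutInv T G R₀ h x y u M' R' → M.Q <+: M'.Q → R' 35 = z → R' 11 = 1 →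
      ((T 4 y, z) ∈ Q ∨ x = y → (x, z) ∈ M'.Q) →
      Ok w l (.op .add 35 35 11) (fun M R => CutInv T G R₀ h x y u M R ∧ Q <+: M.Q ∧ R 35 = z + 1 ∧
      ∀ z' < z + 1, 2 ≤ z' → (T 4 y, z') ∈ Q ∨ x = y → (x, z') ∈ M.Q) M' R' := by
    intro M' R' hI' hsub h35 h11 hm
    refine Ok.add (by omega) (by omega) (by omega) (by omega)
      ⟨⟨hI'.tab, hI'.rel, hI'.keep.update (by omega) _, ?_, ?_, ?_, ?_, ?_⟩, hQ.trans hsub, ?_, ?_⟩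
    iterate 6
      · simp only [Function.update_apply, Nat.reduceEqDiff, reduceIte, h35, h11, hI'.r30, hI'.r31,
          hI'.r32, hI'.r33, hI'.r34]
    · intro z' h1 h2 h3
      rcases Nat.lt_succ_iff_lt_or_eq.1 h1 with h1 | rfl
      · exact hsub.subset (hc z' h1 h2 h3)
      · exact hm h3
  refine Ok.seq (Ok.getCell (by omega) (by omega) (by omega) (by omega) (by omega) ?_)
  refine Ok.seq (Ok.add (by omega) (by omega) (by omega) ?_ ?_)
  · simp only [Function.update_apply, Nat.reduceEqDiff, reduceIte, h34]
    split_ifs <;> omega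
  rw [h33, h35]
  have hK' := (hK.update (d := 36) (by omega) (if (T 4 y, z) ∈ M.Q then 1 else 0)).update
    (d := 36) (by omega) (Function.update R 36 (if (T 4 y, z) ∈ M.Q then 1 else 0) 36 +
      Function.update R 36 (if (T 4 y, z) ∈ M.Q then 1 else 0) 34)
  refine Ok.seq (Ok.ite_lt (by omega) (by omega) (fun h' => ?_) (fun h' => ?_)) <;>
    simp only [Function.update_apply, Nat.reduceEqDiff, reduceIte, h10, h34] at h'
  · have hxz : G x z := by
      by_cases e : x = y
      · subst e
        exact hG.self _ _ hxy hz hz'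
      · rw [if_neg e] at hu
        have hm : (T 4 y, z) ∈ M.Q := by
          by_contra hm
          rw [if_neg hm] at h'
          omega
        exact hG.cut _ _ _ (by omega) hxy (hMG _ hm)
    refine Ok.markPair (by omega) (by omega) ?_ ?_ (fin _ _ ⟨hT, ?_, hK', ?_, ?_, ?_, ?_, ?_⟩
      Tab.prefix_mark ?_ ?_ ?_)
    · simp only [Function.update_apply, Nat.reduceEqDiff, reduceIte, h31, hx]
    · simp only [Function.update_apply, Nat.reduceEqDiff, reduceIte, h35, hz']
    · intro p hp
      simp only [Function.update_apply, Nat.reduceEqDiff, reduceIte, h35, h31] at hp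
      rcases Tab.mem_mark.1 hp with hp | rfl
      · exact hMG p hp
      · exact hxz
    iterate 7
      · simp only [Function.update_apply, Nat.reduceEqDiff, reduceIte, h30, h31, h32, h33, h34, h35,
          h11]
    · intro _
      simp only [Function.update_apply, Nat.reduceEqDiff, reduceIte, h35, h31]
      exact Tab.mem_mark.2 (.inr rfl)
  · refine Ok.skip (fin _ _ ⟨hT, hMG, hK', ?_, ?_, ?_, ?_, ?_⟩ List.prefix_rfl ?_ ?_ ?_)
    iterate 7
      · simp only [Function.update_apply, Nat.reduceEqDiff, reduceIte, h30, h31, h32, h33, h34, h35,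
          h11]
    · intro h3
      exfalso
      apply h'
      rcases h3 with h3 | h3
      · rw [if_pos (hQ.subset h3)]
        omega
      · rw [hu, if_pos h3]
        omega

theorem cutLoop_ok (hG : ClosedRel l T G) {R₀ : ℕ → ℕ} {h x y u : ℕ}
    (hxy : G x y) (hu : u = if x = y then 1 else 0) (hqu : 0 < T 4 y + u)
    (hI : CutInv T G R₀ h x y u M R) :
    OkT w l (dim l * (cutBody.cost + 1)) cutLoop
      (fun M' R => CutInv T G R₀ h x y u M' R ∧ M.Q <+: M'.Q ∧
        ∀ z' < dim l, 2 ≤ z' → (T 4 y, z') ∈ M.Q ∨ x = y → (x, z') ∈ M'.Q) M R := by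
  refine OkT.intro fun hv => ?_
  have h12 : R 12 = dim l := by simpa using hv.consts.tab 1 le_rfl (by omega)
  have h4 := hv.pos
  refine (OkT.seq (Ok.timed (Ok.const (by omega) (by omega)
    (OkT.for (by omega) (by omega) cutBody.cost (dim l) (fun z M' R => 2 ≤ z ∧
      CutInv T G R₀ h x y u M' R ∧ M.Q <+: M'.Q ∧ R 35 = z ∧ R 12 = dim l ∧
      ∀ z' < z, 2 ≤ z' → (T 4 y, z') ∈ M.Q ∨ x = y → (x, z') ∈ M'.Q)
      (fun z M R h => ⟨h.2.2.2.1, h.2.2.2.2.1⟩) ?_ 2 (by omega)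
      ⟨le_rfl, ⟨hI.tab, hI.rel, hI.keep.update (by omega) _, ?_, ?_, ?_, ?_, ?_⟩,
        List.prefix_rfl, ?_, ?_, ?_⟩)))).mono ?_ ?_
  · rintro z M' R' hv' hz ⟨h1, h2, h3, h4, h5, h6⟩
    refine (cutBody_ok hG hxy hu hqu h1 hz h2 h3 h4 h6).timed.mono le_rfl ?_
    rintro M'' R'' hv'' ⟨k1, k2, k3, k4⟩
    exact ⟨by omega, k1, k2, k3, by simpa using hv''.consts.tab 1 le_rfl (by omega), k4⟩
  iterate 7
    · simp only [Function.update_apply, Nat.reduceEqDiff, reduceIte, hI.r30, hI.r31, hI.r32, hI.r33,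
        hI.r34, h12]
  · intro z' h1 h2
    omega
  · obtain ⟨d, hd⟩ := Nat.exists_eq_add_of_le (show 2 ≤ dim l by omega)
    rw [hd, Nat.add_sub_cancel_left, Nat.add_mul]
    simp only [Prog.cost]
    omega
  · rintro M' R' _ ⟨h1, h2, h3, h4, h5, h6⟩
    exact ⟨h2, h3, h6⟩

theorem closePre_ok (hG : ClosedRel l T G) {R₀ : ℕ → ℕ} {h x y : ℕ} (hT : M.T = T)
    (hMG : ∀ p ∈ M.Q, G p.1 p.2) (hK : Keep R₀ R) (h30 : R 30 = h) (hlt : h < M.Q.length)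
    (hxy : M.Q.getD h (0, 0) = (x, y)) :
    Ok w l closePre (fun M' R' => CutInv T G R₀ h x y (if x = y then 1 else 0) M' R' ∧
      R' 36 = T 4 y + (if x = y then 1 else 0) ∧ M.Q <+: M'.Q ∧ (y, x) ∈ M'.Q) M R := by
  have hG' : G x y := by
    have hm : (x, y) ∈ M.Q := by
      rw [← hxy, List.getD_eq_getElem _ _ hlt]
      exact List.getElem_mem hlt
    exact hMG _ hm
  have hx := (hG.bdd _ _ (hG.symm _ _ hG')).2
  have hy := (hG.bdd _ _ hG').2
  refine Ok.seq (Ok.getQueue (by omega) (by omega) (by omega) (by omega) (by omega) ?_)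
  rw [h30, hxy]
  have fin : ∀ R', Keep R₀ R' → R' 30 = h → R' 31 = x → R' 32 = y →
      R' 34 = (if x = y then 1 else 0) →
      Ok w l (getTab 4 33 32 ⨾ .op .add 36 33 34)
        (fun M' R' => CutInv T G R₀ h x y (if x = y then 1 else 0) M' R' ∧
          R' 36 = T 4 y + (if x = y then 1 else 0) ∧ M.Q <+: M'.Q ∧ (y, x) ∈ M'.Q)
        (M.mark y x) R' := by
    intro R' hK h30 h31 h32 h34
    refine Ok.intro fun hv => ?_
    have hq : T 4 y < dim l := hT ▸ hv.tab_lt 4 y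
    have hTm : (M.mark y x).T = T := hT
    have h4 := hv.pos
    refine Ok.seq (Ok.getTab (by omega) (by omega) (by omega) (by omega)
      (Ok.add (by omega) (by omega) (by omega) ?_ ⟨⟨hTm, ?_, (hK.update (by omega) _).update
        (by omega) _, ?_, ?_, ?_, ?_, ?_⟩, ?_, Tab.prefix_mark, Tab.mem_mark.2 (.inr rfl)⟩))
    · simp only [Function.update_apply, Nat.reduceEqDiff, reduceIte, h32, h34, hTm]
      split_ifs <;> omega
    · intro p hp
      rcases Tab.mem_mark.1 hp with hp | rfl
      · exact hMG p hp
      · exact hG.symm _ _ hG'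
    all_goals
      simp only [Function.update_apply, Nat.reduceEqDiff, reduceIte, h30, h31, h32, h34, hTm]
  refine Ok.seq (Ok.markPair (by omega) (by omega) ?_ ?_ ?_)
  iterate 2
    · simp only [Function.update_apply, Nat.reduceEqDiff, reduceIte, hx, hy]
  simp only [Function.update_apply, Nat.reduceEqDiff, reduceIte]
  have hK2 := (((hK.update (d := 31) (by omega) x).update (d := 32) (by omega) y).update
    (d := 34) (by omega) 0)
  refine Ok.seq (Ok.const (by omega) (by omega) (Ok.seq (Ok.ite_eq (by omega) (by omega)
    (fun h' => ?_) (fun h' => ?_)))) <;>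
    simp only [Function.update_apply, Nat.reduceEqDiff, reduceIte] at h'
  · refine Ok.const (by omega) (by omega) (fin _ (hK2.update (by omega) _) ?_ ?_ ?_ ?_) <;>
      simp only [Function.update_apply, Nat.reduceEqDiff, reduceIte, h30, h']
  · refine Ok.skip (fin _ hK2 ?_ ?_ ?_ ?_) <;>
      simp only [Function.update_apply, Nat.reduceEqDiff, reduceIte, h30, h']

theorem closePost_ok (hG : ClosedRel l T G) {R₀ : ℕ → ℕ} {h x y u : ℕ} (hlt : h < M.Q.length)
    (hxy : G x y) (hI : CutInv T G R₀ h x y u M R) :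
    Ok w l closePost (fun M' R' => M'.T = T ∧ (∀ p ∈ M'.Q, G p.1 p.2) ∧ Keep R₀ R' ∧
      R' 30 = h + 1 ∧ R' 37 = M'.Q.length ∧ M.Q <+: M'.Q ∧
      ((x, T 3 y) ∈ M.Q → (x, T 2 y) ∈ M'.Q)) M R := by
  refine Ok.intro fun hv => ?_
  have h10 := hv.consts.zero
  have h11 := hv.consts.one
  have h4 := hv.pos
  have hlen := hv.length_le
  obtain ⟨hT, hMG, hK, h30, h31, h32, h33, h34⟩ := hI
  have hx := (hG.bdd _ _ (hG.symm _ _ hxy)).2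
  have hy := (hG.bdd _ _ hxy).2
  have hs : T 3 y < dim l := hT ▸ hv.tab_lt 3 y
  have hp : T 2 y < dim l := hT ▸ hv.tab_lt 2 y
  have fin : ∀ M' R', M'.T = T → (∀ p ∈ M'.Q, G p.1 p.2) → Keep R₀ R' → R' 30 = h → R' 11 = 1 →
      M.Q <+: M'.Q → ((x, T 3 y) ∈ M.Q → (x, T 2 y) ∈ M'.Q) →
      Ok w l (.op .add 30 30 11 ⨾ getLength 37) (fun M' R' => M'.T = T ∧
        (∀ p ∈ M'.Q, G p.1 p.2) ∧ Keep R₀ R' ∧ R' 30 = h + 1 ∧ R' 37 = M'.Q.length ∧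
        M.Q <+: M'.Q ∧ ((x, T 3 y) ∈ M.Q → (x, T 2 y) ∈ M'.Q)) M' R' := by
    intro M' R' h1 h2 h3 h4 h5 h6 h7
    refine Ok.seq (Ok.add (by omega) (by omega) (by omega) (by omega)
      (Ok.getLength (by omega) ⟨h1, h2, (h3.update (by omega) _).update (by omega) _, ?_, ?_, h6,
        h7⟩)) <;>
      simp only [Function.update_apply, Nat.reduceEqDiff, reduceIte, h4, h5]
  refine Ok.seq (Ok.getTab (by omega) (by omega) (by omega) (by omega) ?_)
  refine Ok.seq (Ok.getTab (by omega) (by omega) (by omega) ?_ ?_)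
  · simp only [Function.update_apply, Nat.reduceEqDiff, reduceIte, h32, hy]
  refine Ok.seq (Ok.getCell (by omega) (by omega) (by omega) ?_ ?_ ?_)
  iterate 2
    · simp only [Function.update_apply, Nat.reduceEqDiff, reduceIte, h31, hx, h32, hT, hs]
  simp only [h32, h31, hT, Function.update_apply, Nat.reduceEqDiff, reduceIte]
  have hK' := ((hK.update (d := 38) (by omega) (T 3 y)).update (d := 39) (by omega) (T 2 y)).update
    (d := 36) (by omega) (if (x, T 3 y) ∈ M.Q then 1 else 0)
  refine Ok.seq (Ok.ite_lt (by omega) (by omega) (fun h' => ?_) (fun h' => ?_)) <;>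
    simp only [Function.update_apply, Nat.reduceEqDiff, reduceIte, h10] at h'
  · have hm : (x, T 3 y) ∈ M.Q := by
      by_contra hm
      rw [if_neg hm] at h'
      omega
    have hxp : G x (T 2 y) := hG.rule _ _ hxy (hMG _ hm)
    refine Ok.markPair (by omega) (by omega) ?_ ?_ (fin _ _ hT ?_ ?_ ?_ ?_ Tab.prefix_mark ?_)
    iterate 2
      · simp only [Function.update_apply, Nat.reduceEqDiff, reduceIte, h31, hx, hp]
    · intro p hp
      simp only [Function.update_apply, Nat.reduceEqDiff, reduceIte, h31] at hp
      rcases Tab.mem_mark.1 hp with hp | rfl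
      · exact hMG p hp
      · exact hxp
    · exact hK'
    iterate 2
      · simp only [Function.update_apply, Nat.reduceEqDiff, reduceIte, h30, h11]
    · intro _
      simp only [Function.update_apply, Nat.reduceEqDiff, reduceIte, h31]
      exact Tab.mem_mark.2 (.inr rfl)
  · refine Ok.skip (fin _ _ hT hMG hK' ?_ ?_ List.prefix_rfl ?_)
    iterate 2
      · simp only [Function.update_apply, Nat.reduceEqDiff, reduceIte, h30, h11]
    · intro hm
      rw [if_pos hm] at h'
      omega

/-- The time for the pair `p`. -/
def pairCost (l : List ℕ) (T : ℕ → ℕ → ℕ) (p : ℕ × ℕ) : ℕ :=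
  closePre.cost + closePost.cost + 3 +
    if T 4 p.2 ≠ 0 ∨ p.1 = p.2 then dim l * (cutBody.cost + 1) else 0

/-- One unit of `pairCost` is kept back for the test of the surrounding loop. -/
theorem closeBody_ok (hG : ClosedRel l T G) {R₀ : ℕ → ℕ} {h x y : ℕ} (hT : M.T = T)
    (hMG : ∀ p ∈ M.Q, G p.1 p.2) (hK : Keep R₀ R) (h30 : R 30 = h) (hlt : h < M.Q.length)
    (hxy : M.Q.getD h (0, 0) = (x, y)) :
    OkT w l (pairCost l T (x, y) - 1) closeBody (fun M' R' => M'.T = T ∧ (∀ p ∈ M'.Q, G p.1 p.2) ∧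
      Keep R₀ R' ∧ R' 30 = h + 1 ∧ R' 37 = M'.Q.length ∧ Extends l T M.Q M'.Q x y) M R := by
  have hm : (x, y) ∈ M.Q := by
    rw [← hxy, List.getD_eq_getElem _ _ hlt]
    exact List.getElem_mem hlt
  have hG' : G x y := hMG _ hm
  refine (OkT.seq (T' := ((if T 4 y ≠ 0 ∨ x = y then dim l * (cutBody.cost + 1) else 0) + 1) + 1 +
    closePost.cost) (Ok.timed ((closePre_ok hG hT hMG hK h30 hlt hxy).mono ?_))).mono ?_
      fun _ _ _ h => h
  · rintro M₁ R₁ ⟨hI, h36, hpre, hsym⟩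
    have post : ∀ M₂ R₂, CutInv T G R₀ h x y (if x = y then 1 else 0) M₂ R₂ → M₁.Q <+: M₂.Q →
        (∀ z' < dim l, 2 ≤ z' → (T 4 y ≠ 0 ∧ (T 4 y, z') ∈ M₁.Q) ∨ x = y → (x, z') ∈ M₂.Q) →
        OkT w l closePost.cost closePost (fun M' R' => M'.T = T ∧ (∀ p ∈ M'.Q, G p.1 p.2) ∧
          Keep R₀ R' ∧ R' 30 = h + 1 ∧ R' 37 = M'.Q.length ∧ Extends l T M.Q M'.Q x y) M₂ R₂ := by
      intro M₂ R₂ hI₂ hpre₂ hc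
      refine (closePost_ok hG (hlt.trans_le (hpre.trans hpre₂).length_le) hG' hI₂).timed.mono le_rfl ?_
      rintro M' R' _ ⟨k1, k2, k3, k4, k5, k6, k7⟩
      refine ⟨k1, k2, k3, k4, k5, (hpre.trans hpre₂).trans k6, ?_, ?_, ?_, ?_⟩
      · exact k6.subset (hpre₂.subset hsym)
      · exact fun z h1 h2 h3 => k6.subset (hc z h3 h2 (.inr h1))
      · exact fun h1 => k7 (hpre₂.subset (hpre.subset h1))
      · intro z h1 h2
        obtain ⟨b1, b2⟩ := hG.bdd _ _ (hMG _ h2)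
        exact k6.subset (hc z b2 b1 (.inl ⟨h1, hpre.subset h2⟩))
    refine OkT.intro fun hv => ?_
    have h10 := hv.consts.zero
    refine OkT.seq (OkT.ite_lt (by omega) (by omega) (fun h' => ?_) (fun h' => ?_)) <;>
      rw [h10, h36] at h'
    · refine (cutLoop_ok hG hG' rfl h' hI).mono ?_ ?_
      · rw [if_pos]
        · omega
        · by_contra hn
          rw [not_or, not_not] at hn
          rw [if_neg hn.2] at h'
          omega
      · rintro M₂ R₂ _ ⟨k1, k2, k3⟩
        exact post M₂ R₂ k1 k2 fun z' h1 h2 h3 => k3 z' h1 h2 (h3.imp And.right id)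
    · refine (Ok.skip (w := w) ?_).timed.mono (by simp only [skip, Prog.cost]; omega)
        fun _ _ _ h => h
      refine post _ _ hI List.prefix_rfl ?_
      intro z' h1 h2 h3
      exfalso
      rcases h3 with h3 | h3
      · omega
      · rw [if_pos h3] at h'
        omega
  · simp only [pairCost]
    omega

end CloseLoop
end OL

namespace OL

/-! ### Termination and total cost of the closure -/

section CloseProg

variable {w : ℕ} {l : List ℕ} {M : Tab} {R : ℕ → ℕ} {T : ℕ → ℕ → ℕ} {G : ℕ → ℕ → Prop}

/-- All pairs of nodes. -/
def grid (l : List ℕ) : Finset (ℕ × ℕ) := Finset.range (dim l) ×ˢ Finset.range (dim l)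

/-- The time for the pairs that have not been processed. -/
def remaining (l : List ℕ) (T : ℕ → ℕ → ℕ) (a : List (ℕ × ℕ) × ℕ) : ℕ :=
  ∑ p ∈ grid l \ (a.1.take a.2).toFinset, pairCost l T p

/-- The queue grows only at its end and has no repetitions, so the pair at position `h` has not been
charged before, and exactly its cost leaves the sum. -/
theorem remaining_step {Q Q' : List (ℕ × ℕ)} {h : ℕ} (hlt : h < Q.length) (hn : Q.Nodup)
    (hb : ∀ p ∈ Q, p.1 < dim l ∧ p.2 < dim l) (hpre : Q <+: Q') :
    remaining l T (Q', h + 1) + pairCost l T (Q.getD h (0, 0)) = remaining l T (Q, h) := by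
  rw [List.getD_eq_getElem _ _ hlt]
  have htake : Q'.take (h + 1) = Q.take h ++ [Q[h]] := by
    obtain ⟨Q'', rfl⟩ := hpre
    rw [List.take_append_of_le_length hlt, List.take_succ_eq_append_getElem hlt]
  have hmem : Q[h] ∈ grid l \ (Q.take h).toFinset := by
    have h1 := hb _ (List.getElem_mem hlt)
    have h2 : Q[h] ∉ Q.take h := by
      intro hm
      have hn' := hn.sublist (List.take_sublist (h + 1) Q)
      rw [List.take_succ_eq_append_getElem hlt, List.nodup_append] at hn'
      exact hn'.2.2 _ hm _ (List.mem_singleton_self _) rfl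
    simp [grid, h1, h2]
  have hset : grid l \ (Q'.take (h + 1)).toFinset =
      (grid l \ (Q.take h).toFinset).erase Q[h] := by
    rw [htake]
    ext p
    simp only [List.toFinset_append, Finset.mem_sdiff, Finset.mem_union, List.mem_toFinset,
      List.mem_singleton, Finset.mem_erase]
    tauto
  rw [remaining, remaining, hset, Finset.sum_erase_add _ _ hmem]

/-- The queue grows while it is being processed, so the number of passes is not known beforehand.
The potential is the cost of all pairs of nodes not yet processed, whether or not they ever enter
the queue. -/
theorem closeProg_ok (hG : ClosedRel l T G) (hT : M.T = T) (hMG : ∀ p ∈ M.Q, G p.1 p.2) :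
    OkT w l ((∑ p ∈ grid l, pairCost l T p) + 3) closeProg (fun M' R' => M'.T = T ∧
      (∀ p ∈ M.Q, p ∈ M'.Q) ∧ (∀ p ∈ M'.Q, G p.1 p.2) ∧ Keep R R' ∧
      Done l T M'.Q M'.Q.length) M R := by
  have hΦ : remaining l T (M.Q, 0) = ∑ p ∈ grid l, pairCost l T p := by simp [remaining]
  refine (OkT.seq (Ok.timed (Ok.seq (Ok.const (by omega) (by omega) (Ok.getLength (by omega)
    (OkT.while (by omega) (by omega) (α := List (ℕ × ℕ) × ℕ) (fun a M' R' => M'.Q = a.1 ∧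
      R' 30 = a.2 ∧ R' 37 = a.1.length ∧ a.2 ≤ a.1.length ∧ M'.T = T ∧ M.Q <+: M'.Q ∧
      (∀ p ∈ M'.Q, G p.1 p.2) ∧ Keep R R' ∧ Done l T a.1 a.2) (remaining l T) ?_ ?_ (M.Q, 0)
      ⟨rfl, ?_, ?_, by omega, hT, List.prefix_rfl, hMG, ?_, ?_⟩)))))).mono ?_ fun _ _ _ h => h
  · rintro ⟨Q, h⟩ M' R' hv ⟨rfl, h30, h37, hle, hT', hpre, hMG', hK, hD⟩ hlt
    simp only at h30 h37 hle hD
    rw [h30, h37] at hlt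
    have hrem : ∀ Q', M'.Q <+: Q' → _ := fun Q' =>
      remaining_step (T := T) (Q' := Q') hlt hv.nodup hv.bdd
    obtain ⟨⟨x, y⟩, hxy⟩ : ∃ p, M'.Q.getD h (0, 0) = p := ⟨_, rfl⟩
    rw [hxy] at hrem
    have hc : 0 < pairCost l T (x, y) := by
      simp only [pairCost]
      omega
    refine ⟨pairCost l T (x, y) - 1, ?_, (closeBody_ok hG hT' hMG' hK h30 hlt hxy).mono le_rfl ?_⟩
    · have := hrem _ List.prefix_rfl
      omega
    · rintro M'' R'' _ ⟨k1, k2, k3, k4, k5, k6⟩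
      have := hrem _ k6.pre
      have hle' := k6.pre.length_le
      refine ⟨(M''.Q, h + 1), by omega, rfl, k4, k5, by simp only; omega, k1, hpre.trans k6.pre,
        k2, k3, hD.step hlt hxy k6⟩
  · rintro ⟨Q, h⟩ M' R' hv ⟨rfl, h30, h37, hle, hT', hpre, hMG', hK, hD⟩ hlt
    simp only at h30 h37 hle hD
    rw [h30, h37] at hlt
    obtain rfl : h = M'.Q.length := by omega
    exact ⟨hT', fun p hp => hpre.subset hp, hMG', hK, hD⟩
  iterate 2
    · simp only [Function.update_apply, Nat.reduceEqDiff, reduceIte]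
  · exact Keep.update (Keep.update (fun _ _ => rfl) (by omega) _) (by omega) _
  · constructor <;> simp
  · rw [hΦ]
    simp only [Prog.cost, getLength]
    omega

/-- Only pairs whose second component is in `F`, and pairs on the diagonal, can incur a scan of
length `dim l`. There are at most `dim l * (F.card + 1)` of them; all pairs share a constant cost.
This is the source of the factor `1 + |A|`. -/
theorem sum_pairCost_le {F : Finset ℕ} (hF : ∀ y, T 4 y ≠ 0 → y ∈ F) :
    ∑ p ∈ grid l, pairCost l T p ≤ dim l * dim l *
      (closePre.cost + closePost.cost + 3 + (cutBody.cost + 1) * (F.card + 1)) := by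
  set K := dim l * (cutBody.cost + 1)
  obtain ⟨c, hc⟩ : ∃ c, closePre.cost + closePost.cost + 3 = c := ⟨_, rfl⟩
  rw [hc]
  have h1 : ∀ p ∈ grid l, pairCost l T p ≤ c + ((if p.2 ∈ F then K else 0) + if p.1 = p.2 then K else 0) := by
    intro p _
    simp only [pairCost, hc]
    by_cases h2 : T 4 p.2 ≠ 0
    · rw [if_pos (.inl h2), if_pos (hF _ h2)]
      omega
    · by_cases h3 : p.1 = p.2
      · rw [if_pos (.inr h3), if_pos h3]
        omega
      · rw [if_neg (by tauto)]
        omega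
  refine (Finset.sum_le_sum h1).trans ?_
  rw [Finset.sum_add_distrib, Finset.sum_add_distrib]
  have e1 : ∑ p ∈ grid l, (if p.2 ∈ F then K else 0) ≤ dim l * (F.card * K) := by
    rw [grid, Finset.sum_product]
    refine (Finset.sum_le_card_nsmul _ _ (F.card * K) ?_).trans_eq (by simp)
    intro x _
    rw [← Finset.sum_filter, Finset.sum_const, smul_eq_mul]
    refine Nat.mul_le_mul_right _ (Finset.card_le_card fun y hy => ?_)
    exact (Finset.mem_filter.1 hy).2
  have e2 : ∑ p ∈ grid l, (if p.1 = p.2 then K else 0) ≤ dim l * K := by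
    rw [grid, Finset.sum_product]
    refine (Finset.sum_le_card_nsmul _ _ K ?_).trans_eq (by simp)
    intro x _
    rw [Finset.sum_ite_eq]
    split_ifs
    all_goals omega
  have e3 : ∑ _p ∈ grid l, c = dim l * dim l * c := by
    simp [grid]
  calc _ ≤ dim l * dim l * c + (dim l * (F.card * K) + dim l * K) := by rw [e3]; omega
    _ = _ := by ring

end CloseProg
end OL

namespace OL

open AFormula

/-! ### Correctness of the parser -/

/-- The annotated formula at a node: even nodes are left, odd nodes are right. -/
def annAt (tm : ℕ → Term) (y : ℕ) : AFormula := if y % 2 = 0 then L (tm y) else R (tm (y - 1))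

/-- The nodes of the symbols that have been read. -/
def IsNode (n y : ℕ) : Prop := 2 ≤ y ∧ y < n

/-- The rule that infers `x, p` from `x, y` and `x, s` is sound. -/
structure RuleSound (A : Set (Set AFormula)) (tm : ℕ → Term) (n y s p : ℕ) : Prop where
  left : IsNode n y
  right : IsNode n s
  concl : IsNode n p
  sound : ∀ Γ, Provable A (sequent Γ (some (annAt tm y))) →
    Provable A (sequent Γ (some (annAt tm s))) → Provable A (sequent Γ (some (annAt tm p)))

/-- The tables and the queue are sound. -/
structure Tab.Sound (A : Set (Set AFormula)) (tm : ℕ → Term) (n : ℕ) (M : Tab) : Prop where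
  rules : ∀ y, M.T 3 y ≠ 0 → RuleSound A tm n y (M.T 3 y) (M.T 2 y)
  cuts : ∀ y, M.T 4 y ≠ 0 → IsNode n y ∧ IsNode n (M.T 4 y) ∧
    annAt tm (M.T 4 y) = (annAt tm y).dual
  pairs : ∀ p ∈ M.Q, IsNode n p.1 ∧ IsNode n p.2 ∧
    Provable A (sequent (some (annAt tm p.1)) (some (annAt tm p.2)))

section Sound

variable {A : Set (Set AFormula)} {tm tm' : ℕ → Term} {n n' : ℕ} {M : Tab}

theorem annAt_congr (h : ∀ y < n, tm' y = tm y) {y : ℕ} (hy : y < n) :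
    annAt tm' y = annAt tm y := by
  unfold annAt
  rw [h y hy, h (y - 1) (by omega)]

theorem annAt_even {y : ℕ} (hy : y % 2 = 0) : annAt tm y = L (tm y) := if_pos hy

theorem annAt_odd {y : ℕ} (hy : y % 2 = 0) : annAt tm (y + 1) = R (tm y) :=
  if_neg (by omega)

theorem IsNode.mono {y : ℕ} (h : IsNode n y) (hn : n ≤ n') : IsNode n' y :=
  ⟨h.1, h.2.trans_le hn⟩

theorem RuleSound.mono {y s p : ℕ} (h : RuleSound A tm n y s p) (hn : n ≤ n')
    (htm : ∀ y < n, tm' y = tm y) : RuleSound A tm' n' y s p := by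
  refine ⟨h.left.mono hn, h.right.mono hn, h.concl.mono hn, ?_⟩
  rw [annAt_congr htm h.left.2, annAt_congr htm h.right.2, annAt_congr htm h.concl.2]
  exact h.sound

theorem Tab.Sound.mono (h : M.Sound A tm n) (hn : n ≤ n') (htm : ∀ y < n, tm' y = tm y) :
    M.Sound A tm' n' := by
  refine ⟨fun y hy => (h.rules y hy).mono hn htm, fun y hy => ?_, fun p hp => ?_⟩
  · obtain ⟨h1, h2, h3⟩ := h.cuts y hy
    refine ⟨h1.mono hn, h2.mono hn, ?_⟩
    rw [annAt_congr htm h1.2, annAt_congr htm h2.2, h3]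
  · obtain ⟨h1, h2, h3⟩ := h.pairs p hp
    refine ⟨h1.mono hn, h2.mono hn, ?_⟩
    rwa [annAt_congr htm h1.2, annAt_congr htm h2.2]

theorem Tab.Sound.put_one (h : M.Sound A tm n) (y v : ℕ) : (M.put 1 y v).Sound A tm n := by
  refine ⟨fun z hz => ?_, fun z hz => ?_, h.pairs⟩
  · simp only [Tab.put_T, Nat.reduceEqDiff, false_and, if_false] at hz ⊢
    exact h.rules z hz
  · simp only [Tab.put_T, Nat.reduceEqDiff, false_and, if_false] at hz ⊢
    exact h.cuts z hz

theorem Tab.rule_T (M : Tab) (y s p k z : ℕ) : (M.rule y s p).T k z =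
    if k = 3 ∧ z = y then s else if k = 2 ∧ z = y then p else M.T k z := by
  rw [Tab.rule, Tab.put_T, Tab.put_T]

theorem Tab.Sound.rule (h : M.Sound A tm n) {y s p : ℕ} (hr : RuleSound A tm n y s p) :
    (M.rule y s p).Sound A tm n := by
  refine ⟨fun z hz => ?_, fun z hz => ?_, h.pairs⟩
  · simp only [Tab.rule_T, Nat.reduceEqDiff, false_and, if_false, true_and] at hz ⊢
    by_cases e : z = y
    · subst e
      simpa using hr
    · simp only [e, if_false] at hz ⊢
      exact h.rules z hz
  · simp only [Tab.rule_T, Nat.reduceEqDiff, false_and, if_false] at hz ⊢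
    exact h.cuts z hz

theorem Tab.Sound.mark (h : M.Sound A tm n) {x y : ℕ} (hx : IsNode n x) (hy : IsNode n y)
    (hp : Provable A (sequent (some (annAt tm x)) (some (annAt tm y)))) :
    (M.mark x y).Sound A tm n := by
  refine ⟨h.rules, h.cuts, fun p hp' => ?_⟩
  rcases Tab.mem_mark.1 hp' with hp' | rfl
  · exact h.pairs p hp'
  · exact ⟨hx, hy, hp⟩

theorem Tab.Sound.put_cut (h : M.Sound A tm n) {y q : ℕ} (hy : IsNode n y) (hq : IsNode n q)
    (hd : annAt tm q = (annAt tm y).dual) : (M.put 4 y q).Sound A tm n := by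
  refine ⟨fun z hz => ?_, fun z hz => ?_, h.pairs⟩
  · simp only [Tab.put_T, Nat.reduceEqDiff, false_and, if_false] at hz ⊢
    exact h.rules z hz
  · simp only [Tab.put_T, true_and] at hz ⊢
    by_cases e : z = y
    · subst e
      simpa using ⟨hy, hq, hd⟩
    · simp only [e, if_false] at hz ⊢
      exact h.cuts z hz

end Sound

/-- The rules for a binary connective at the node `r` with children `a` and `b`. -/
structure BinRules (M : Tab) (a b r u v : ℕ) : Prop where
  au : M.T 3 (a + u) = a + u ∧ M.T 2 (a + u) = r + u
  bu : M.T 3 (b + u) = b + u ∧ M.T 2 (b + u) = r + u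
  av : M.T 3 (a + v) = b + v ∧ M.T 2 (a + v) = r + v
  bv : M.T 3 (b + v) = a + v ∧ M.T 2 (b + v) = r + v

/-- The tables have the rules for a term with root `r` and nodes from `lo` on. -/
def Tree (M : Tab) (tm : ℕ → Term) : ℕ → Term → ℕ → Prop
  | lo, .var k, r => lo ≤ r ∧ tm r = .var k
  | lo, .bot, r => lo ≤ r ∧ (r, r) ∈ M.Q
  | lo, .top, r => lo ≤ r ∧ (r + 1, r + 1) ∈ M.Q
  | lo, .neg φ, r => ∃ a, Tree M tm lo φ a ∧ a + 2 ≤ r ∧ (M.T 3 a = a ∧ M.T 2 a = r + 1) ∧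
      M.T 3 (a + 1) = a + 1 ∧ M.T 2 (a + 1) = r
  | lo, .and φ ψ, r => ∃ a b, Tree M tm lo φ a ∧ Tree M tm (a + 2) ψ b ∧ b + 2 ≤ r ∧
      BinRules M a b r 0 1
  | lo, .or φ ψ, r => ∃ a b, Tree M tm lo φ a ∧ Tree M tm (a + 2) ψ b ∧ b + 2 ≤ r ∧
      BinRules M a b r 1 0

theorem Tree.le {M : Tab} {tm : ℕ → Term} {lo : ℕ} {φ : Term} {r : ℕ} (h : Tree M tm lo φ r) :
    lo ≤ r := by
  induction φ generalizing lo r with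
  | neg φ ih =>
    obtain ⟨a, ha, h1, -⟩ := h
    have := ih ha
    omega
  | and φ ψ ihφ ihψ =>
    obtain ⟨a, b, ha, hb, h1, -⟩ := h
    have := ihφ ha
    have := ihψ hb
    omega
  | or φ ψ ihφ ihψ =>
    obtain ⟨a, b, ha, hb, h1, -⟩ := h
    have := ihφ ha
    have := ihψ hb
    omega
  | _ => exact h.1

theorem BinRules.congr {M M' : Tab} {a b r u v lo : ℕ} (h : BinRules M a b r u v) (hu : u ≤ 1)
    (hv : v ≤ 1) (ha : lo ≤ a) (hb : lo ≤ b) (har : a + 2 ≤ r) (hbr : b + 2 ≤ r)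
    (hT : ∀ k y, k = 2 ∨ k = 3 → lo ≤ y → y < r → M'.T k y = M.T k y) :
    BinRules M' a b r u v := by
  have h2 := fun y => hT 2 y (.inl rfl)
  have h3 := fun y => hT 3 y (.inr rfl)
  obtain ⟨h4, h5, h6, h7⟩ := h
  constructor
  all_goals
    rw [h2 _ (by omega) (by omega), h3 _ (by omega) (by omega)]
    assumption

/-- The entries of tables `2` and `3` at the root are written only when the parent is read and are
not part of the tree, so agreement is required strictly below `r`. This lets a subtree survive its
attachment to a parent. -/
theorem Tree.congr {M M' : Tab} {tm tm' : ℕ → Term} {lo : ℕ} {φ : Term} {r : ℕ}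
    (h : Tree M tm lo φ r) (hT : ∀ k y, k = 2 ∨ k = 3 → lo ≤ y → y < r → M'.T k y = M.T k y)
    (hQ : ∀ p ∈ M.Q, p ∈ M'.Q) (htm : ∀ y, lo ≤ y → y ≤ r → tm' y = tm y) :
    Tree M' tm' lo φ r := by
  induction φ generalizing lo r with
  | var k => exact ⟨h.1, (htm r h.1 le_rfl).trans h.2⟩
  | bot => exact ⟨h.1, hQ _ h.2⟩
  | top => exact ⟨h.1, hQ _ h.2⟩
  | neg φ ih =>
    obtain ⟨a, ha, h1, h2, h3⟩ := h
    have := ha.le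
    refine ⟨a, ih ha (fun k y hk h1 h2 => hT k y hk h1 (by omega))
      (fun y h1 h2 => htm y h1 (by omega)), h1, ?_, ?_⟩
    all_goals
      rw [hT 2 _ (.inl rfl) (by omega) (by omega), hT 3 _ (.inr rfl) (by omega) (by omega)]
      assumption
  | and φ ψ ihφ ihψ =>
    obtain ⟨a, b, ha, hb, h1, h2⟩ := h
    have := ha.le
    have := hb.le
    exact ⟨a, b, ihφ ha (fun k y hk h1 h2 => hT k y hk h1 (by omega))
      (fun y h1 h2 => htm y h1 (by omega)),
      ihψ hb (fun k y hk h1 h2 => hT k y hk (by omega) (by omega))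
      (fun y h1 h2 => htm y (by omega) (by omega)), h1,
      h2.congr (by omega) (by omega) (by omega) (by omega) (by omega) h1 hT⟩
  | or φ ψ ihφ ihψ =>
    obtain ⟨a, b, ha, hb, h1, h2⟩ := h
    have := ha.le
    have := hb.le
    exact ⟨a, b, ihφ ha (fun k y hk h1 h2 => hT k y hk h1 (by omega))
      (fun y h1 h2 => htm y h1 (by omega)),
      ihψ hb (fun k y hk h1 h2 => hT k y hk (by omega) (by omega))
      (fun y h1 h2 => htm y (by omega) (by omega)), h1,
      h2.congr (by omega) (by omega) (by omega) (by omega) (by omega) h1 hT⟩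

/-- The invariant of the parser. -/
structure PSt.Good (A : Set (Set AFormula)) (σ : PSt) : Prop where
  even : σ.n % 2 = 0
  two_le : 2 ≤ σ.n
  pn : σ.pn + 2 = σ.n
  fresh : ∀ y, σ.n ≤ y → σ.tm y = .top
  sound : σ.M.Sound A σ.tm σ.n

/-- The parser has changed nothing before the node `σ.n`. -/
structure PSt.Ext (σ σ' : PSt) : Prop where
  n : σ.n ≤ σ'.n
  T : ∀ k, ∀ y < σ.n, σ'.M.T k y = σ.M.T k y
  tm : ∀ y < σ.n, σ'.tm y = σ.tm y
  Q : ∀ p ∈ σ.M.Q, p ∈ σ'.M.Q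

theorem PSt.Ext.trans {σ σ' σ'' : PSt} (h : σ.Ext σ') (h' : σ'.Ext σ'') : σ.Ext σ'' where
  n := h.n.trans h'.n
  T k y hy := (h'.T k y (hy.trans_le h.n)).trans (h.T k y hy)
  tm y hy := (h'.tm y (hy.trans_le h.n)).trans (h.tm y hy)
  Q p hp := h'.Q p (h.Q p hp)

/-- The parser has read the term `φ`. -/
structure PSt.ReadTerm (A : Set (Set AFormula)) (φ : Term) (σ σ' : PSt) : Prop where
  ext : σ.Ext σ'
  good : σ'.Good A
  n : σ'.n = σ.n + 2 * φ.size
  start : σ'.M.T 1 σ'.pn = σ.pn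
  tm : σ'.tm σ'.pn = φ
  tree : Tree σ'.M σ'.tm σ.n φ σ'.pn
  cuts : ∀ y, σ'.M.T 4 y = σ.M.T 4 y
  s₁ : σ'.s₁ = σ.s₁
  g₁ : σ'.g₁ = σ.g₁
  g₂ : σ'.g₂ = σ.g₂
  e : σ'.e = σ.e

section ReadTerm

variable {A : Set (Set AFormula)} {σ σ₁ σ₂ : PSt}

theorem PSt.leaf_tm (t : Term) : (σ.leaf t).tm σ.n = t := Function.update_self ..

theorem PSt.Good.leaf (hσ : σ.Good A) (t : Term) : (σ.leaf t).next.Good A := by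
  have h1 := hσ.even
  have h2 := hσ.pn
  have htm : ∀ y < σ.n, Function.update σ.tm σ.n t y = σ.tm y := fun y hy =>
    Function.update_of_ne hy.ne _ _
  refine ⟨?_, ?_, rfl, ?_, (hσ.sound.put_one _ _).mono (by simp [PSt.next, PSt.leaf]) htm⟩
  · simp only [PSt.next, PSt.leaf]
    omega
  · simp only [PSt.next, PSt.leaf]
    omega
  · intro y hy
    simp only [PSt.next, PSt.leaf] at hy ⊢
    rw [Function.update_of_ne (by omega)]
    exact hσ.fresh y (by omega)

theorem PSt.ext_leaf (t : Term) : σ.Ext (σ.leaf t).next where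
  n := by simp [PSt.next, PSt.leaf]
  T k y hy := by
    simp only [PSt.next, PSt.leaf, Tab.put_T]
    rw [if_neg (by omega)]
  tm y hy := Function.update_of_ne hy.ne _ _
  Q p hp := hp

theorem PSt.Good.mark_next (hσ : σ₁.next.Good A) {x y : ℕ} (hx : IsNode σ₁.next.n x)
    (hy : IsNode σ₁.next.n y)
    (hp : Provable A (sequent (some (annAt σ₁.tm x)) (some (annAt σ₁.tm y)))) :
    (σ₁.mark x y).next.Good A :=
  ⟨hσ.even, hσ.two_le, hσ.pn, hσ.fresh, hσ.sound.mark hx hy hp⟩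

theorem PSt.readTerm_leaf (hσ : σ.Good A) (t : Term) (ht : Tree ((σ.leaf t).M)
    (σ.leaf t).tm σ.n t σ.n) (hs : t.size = 1) : PSt.ReadTerm A t σ (σ.leaf t).next where
  ext := PSt.ext_leaf t
  good := hσ.leaf t
  n := by simp [PSt.next, PSt.leaf, hs]
  start := by simp [PSt.next, PSt.leaf, Tab.put_T]
  tm := Function.update_self ..
  tree := ht
  cuts y := by simp [PSt.next, PSt.leaf, Tab.put_T]
  s₁ := rfl
  g₁ := rfl
  g₂ := rfl
  e := rfl

theorem PSt.readTerm_mark (hσ : σ.Good A) (t : Term) {x : ℕ} (ht : Tree ((σ.leaf t).mark x x).M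
    (σ.leaf t).tm σ.n t σ.n) (hs : t.size = 1) (hx : IsNode (σ.n + 2) x)
    (hp : Provable A (sequent (some (annAt (σ.leaf t).tm x)) (some (annAt (σ.leaf t).tm x)))) :
    PSt.ReadTerm A t σ ((σ.leaf t).mark x x).next where
  ext := ⟨(PSt.ext_leaf t).n, (PSt.ext_leaf t).T, (PSt.ext_leaf t).tm,
    fun p hp => Tab.mem_mark.2 (.inl hp)⟩
  good := (hσ.leaf t).mark_next hx hx hp
  n := by simp [PSt.next, PSt.leaf, PSt.mark, hs]
  start := by simp [PSt.next, PSt.leaf, PSt.mark, Tab.mark, Tab.put_T]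
  tm := Function.update_self ..
  tree := ht
  cuts y := by simp [PSt.next, PSt.leaf, PSt.mark, Tab.mark, Tab.put_T]
  s₁ := rfl
  g₁ := rfl
  g₂ := rfl
  e := rfl

theorem PSt.ReadTerm.neg {φ : Term} (hσ : σ.Good A) (h : PSt.ReadTerm A φ σ σ₁) :
    PSt.ReadTerm A (.neg φ) σ σ₁.neg.next := by
  have hG := h.good
  have h1 := hG.even
  have h2 := hG.pn
  have h3 := hσ.pn
  have h4 := hσ.two_le
  have h5 := h.tree.le
  have h6 := h.n
  have hpe : σ₁.pn % 2 = 0 := by omega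
  set t := Term.neg (σ₁.tm σ₁.pn) with ht
  have htt : t = .neg φ := by rw [ht, h.tm]
  have htm : ∀ y < σ₁.n, Function.update σ₁.tm σ₁.n t y = σ₁.tm y := fun y hy =>
    Function.update_of_ne hy.ne _ _
  have hn : σ₁.neg.next.n = σ₁.n + 2 := rfl
  -- Negation exchanges the annotations: the left node of the child leads to the right node of the
  -- parent, and the right node to the left one.
  have a1 : annAt (Function.update σ₁.tm σ₁.n t) σ₁.pn = L φ := by
    rw [annAt_even hpe, htm _ (by omega), h.tm]
  have a2 : annAt (Function.update σ₁.tm σ₁.n t) (σ₁.pn + 1) = R φ := by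
    rw [annAt_odd hpe, htm _ (by omega), h.tm]
  have a3 : annAt (Function.update σ₁.tm σ₁.n t) σ₁.n = L (.neg φ) := by
    rw [annAt_even h1, Function.update_self, htt]
  have a4 : annAt (Function.update σ₁.tm σ₁.n t) (σ₁.n + 1) = R (.neg φ) := by
    rw [annAt_odd h1, Function.update_self, htt]
  have hM : σ₁.neg.next.M = ((σ₁.M.put 1 σ₁.n (σ₁.M.T 1 σ₁.pn)).rule σ₁.pn σ₁.pn (σ₁.n + 1)).rule
    (σ₁.pn + 1) (σ₁.pn + 1) σ₁.n := rfl
  have hT : ∀ k y, y < σ₁.n → y ≠ σ₁.pn → y ≠ σ₁.pn + 1 → σ₁.neg.next.M.T k y = σ₁.M.T k y := by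
    intro k y k1 k2 k3
    rw [hM]
    simp only [Tab.rule_T, Tab.put_T, k2, k3, and_false, if_false]
    rw [if_neg (by omega)]
  refine ⟨?_, ⟨?_, ?_, rfl, ?_, ?_⟩, ?_, ?_, ?_, ?_, ?_, h.s₁, h.g₁, h.g₂, h.e⟩
  · refine ⟨by omega, fun k y hy => ?_, fun y hy => ?_, h.ext.Q⟩
    · rw [hT k y (by omega) (by omega) (by omega), h.ext.T k y hy]
    · exact (htm y (by omega)).trans (h.ext.tm y hy)
  · omega
  · omega
  · intro y hy
    rw [← hG.fresh y (by omega)]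
    exact Function.update_of_ne (by omega) _ _
  · refine (((hG.sound.put_one _ _).mono (n' := σ₁.n + 2) (by omega) htm).rule ?_).rule ?_
    · refine ⟨⟨by omega, by omega⟩, ⟨by omega, by omega⟩, ⟨by omega, by omega⟩, ?_⟩
      rw [a1, a4]
      exact fun Γ k _ => .rightNot _ _ k
    · refine ⟨⟨by omega, by omega⟩, ⟨by omega, by omega⟩, ⟨by omega, by omega⟩, ?_⟩
      rw [a2, a3]
      exact fun Γ k _ => .leftNot _ _ k
  · rw [hn, h6, Term.size]
    omega
  · rw [hM, ← h.start]
    simp [Tab.rule_T, Tab.put_T, PSt.next, PSt.neg]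
  · exact (Function.update_self ..).trans htt
  · refine ⟨σ₁.pn, h.tree.congr (fun k y _ k1 k2 => hT k y (by omega) (by omega) (by omega))
      (fun p hp => hp) (fun y k1 k2 => htm y (by omega)), h2.le, ?_, ?_⟩
    · rw [hM]
      simp [Tab.rule_T, PSt.next, PSt.neg]
    · rw [hM]
      simp [Tab.rule_T, PSt.next, PSt.neg]
  · intro y
    rw [hM, ← h.cuts]
    simp [Tab.rule_T, Tab.put_T]

/-- The rules of a binary connective, where the side `u` has two rules with one premise, and the
side `v` has one rule with two premises. -/
structure BinSound (op : Term → Term → Term) (u v : ℕ) : Prop where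
  u_le : u ≤ 1
  v_le : v ≤ 1
  ne : u ≠ v
  size : ∀ φ ψ, (op φ ψ).size = φ.size + ψ.size + 1
  left : ∀ A tm a b r, a % 2 = 0 → b % 2 = 0 → r % 2 = 0 → tm r = op (tm a) (tm b) →
    ∀ Γ, Provable A (sequent Γ (some (annAt tm (a + u)))) →
      Provable A (sequent Γ (some (annAt tm (r + u))))
  right : ∀ A tm a b r, a % 2 = 0 → b % 2 = 0 → r % 2 = 0 → tm r = op (tm a) (tm b) →
    ∀ Γ, Provable A (sequent Γ (some (annAt tm (b + u)))) →
      Provable A (sequent Γ (some (annAt tm (r + u))))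
  both : ∀ A tm a b r, a % 2 = 0 → b % 2 = 0 → r % 2 = 0 → tm r = op (tm a) (tm b) →
    ∀ Γ, Provable A (sequent Γ (some (annAt tm (a + v)))) →
      Provable A (sequent Γ (some (annAt tm (b + v)))) →
      Provable A (sequent Γ (some (annAt tm (r + v))))
  tree : ∀ M tm lo φ ψ a b r, Tree M tm lo φ a → Tree M tm (a + 2) ψ b → b + 2 ≤ r →
    BinRules M a b r u v → Tree M tm lo (op φ ψ) r

theorem binSound_and : BinSound .and 0 1 where
  u_le := by omega
  v_le := by omega
  ne := by omega
  size _ _ := rfl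
  left A tm a b r ha hb hr h Γ := by
    simp only [Nat.add_zero, annAt_even ha, annAt_even hr, h]
    exact .leftAnd₁ _ _ _
  right A tm a b r ha hb hr h Γ := by
    simp only [Nat.add_zero, annAt_even hb, annAt_even hr, h]
    exact .leftAnd₂ _ _ _
  both A tm a b r ha hb hr h Γ := by
    simp only [annAt_odd ha, annAt_odd hb, annAt_odd hr, h]
    exact .rightAnd _ _ _
  tree M tm lo φ ψ a b r h1 h2 h3 h4 := ⟨a, b, h1, h2, h3, h4⟩

theorem binSound_or : BinSound .or 1 0 where
  u_le := by omega
  v_le := by omega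
  ne := by omega
  size _ _ := rfl
  left A tm a b r ha hb hr h Γ := by
    simp only [annAt_odd ha, annAt_odd hr, h]
    exact .rightOr₁ _ _ _
  right A tm a b r ha hb hr h Γ := by
    simp only [annAt_odd hb, annAt_odd hr, h]
    exact .rightOr₂ _ _ _
  both A tm a b r ha hb hr h Γ := by
    simp only [Nat.add_zero, annAt_even ha, annAt_even hb, annAt_even hr, h]
    exact .leftOr _ _ _
  tree M tm lo φ ψ a b r h1 h2 h3 h4 := ⟨a, b, h1, h2, h3, h4⟩

/-- In postfix order the second operand ends just before the connective. Table `1` at its root leads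
back to the root of the first operand, and at that root to the last node before the whole term.
Conjunction and disjunction differ only by exchanging the annotations, so `BinSound` treats them
together. -/
theorem PSt.ReadTerm.bin {φ ψ : Term} {op : Term → Term → Term} {u v : ℕ} (hop : BinSound op u v)
    (hσ : σ.Good A) (hφ : PSt.ReadTerm A φ σ σ₁) (hψ : PSt.ReadTerm A ψ σ₁ σ₂) :
    PSt.ReadTerm A (op φ ψ) σ (σ₂.bin u v op).next := by
  have hG := hψ.good
  have h1 := hG.even
  have h1' := hφ.good.even
  have h2 := hG.pn
  have h2' := hφ.good.pn
  have h3 := hσ.pn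
  have h4 := hσ.two_le
  have h5 := hφ.tree.le
  have h5' := hψ.tree.le
  have h6 := hφ.n
  have h6' := hψ.n
  have hu := hop.u_le
  have hv := hop.v_le
  have hne := hop.ne
  have ha : σ₂.M.T 1 σ₂.pn = σ₁.pn := hψ.start
  have haa : σ₂.M.T 1 σ₁.pn = σ.pn := by rw [hψ.ext.T _ _ (by omega), hφ.start]
  have hta : σ₂.tm σ₁.pn = φ := by rw [hψ.ext.tm _ (by omega), hφ.tm]
  obtain ⟨a, hae⟩ : ∃ a, σ₁.pn = a := ⟨_, rfl⟩
  obtain ⟨b, hbe⟩ : ∃ b, σ₂.pn = b := ⟨_, rfl⟩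
  obtain ⟨r, hre⟩ : ∃ r, σ₂.n = r := ⟨_, rfl⟩
  have htb : σ₂.tm b = ψ := hbe ▸ hψ.tm
  rw [hae] at ha haa hta
  rw [hbe] at ha
  have hM : (σ₂.bin u v op).next.M = ((((σ₂.M.put 1 r σ.pn).rule (a + u) (a + u) (r + u)).rule
      (b + u) (b + u) (r + u)).rule (a + v) (b + v) (r + v)).rule (b + v) (a + v) (r + v) := by
    simp only [PSt.next, PSt.bin, hbe, ha, haa, hre]
  have htm' : (σ₂.bin u v op).next.tm = Function.update σ₂.tm r (op φ ψ) := by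
    simp only [PSt.next, PSt.bin, hbe, ha, hta, htb, hre]
  have hn : (σ₂.bin u v op).next.n = r + 2 := by rw [← hre]; rfl
  have hpn : (σ₂.bin u v op).next.pn = r := hre
  have htm : ∀ y < r, Function.update σ₂.tm r (op φ ψ) y = σ₂.tm y := fun y hy =>
    Function.update_of_ne hy.ne _ _
  have har : a < r := by omega
  have hbr : b < r := by omega
  have hr : Function.update σ₂.tm r (op φ ψ) r =
      op (Function.update σ₂.tm r (op φ ψ) a) (Function.update σ₂.tm r (op φ ψ) b) := by
    rw [Function.update_self, htm _ har, htm _ hbr, hta, htb]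
  have e1 : a % 2 = 0 := by omega
  have e2 : b % 2 = 0 := by omega
  have e3 : r % 2 = 0 := by omega
  have hT : ∀ k y, y < r → y ≠ a → y ≠ a + 1 → y ≠ b → y ≠ b + 1 →
      (σ₂.bin u v op).next.M.T k y = σ₂.M.T k y := by
    intro k y k1 k2 k3 k4 k5
    rw [hM]
    simp only [Tab.rule_T, Tab.put_T]
    iterate 9 rw [if_neg (by omega)]
  refine ⟨?_, ⟨?_, ?_, ?_, ?_, ?_⟩, ?_, ?_, ?_, ?_, ?_, hψ.s₁.trans hφ.s₁, hψ.g₁.trans hφ.g₁,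
    hψ.g₂.trans hφ.g₂, hψ.e.trans hφ.e⟩
  · refine ⟨by omega, fun k y hy => ?_, fun y hy => ?_, fun p hp => ?_⟩
    · rw [hT k y (by omega) (by omega) (by omega) (by omega) (by omega),
        (hφ.ext.trans hψ.ext).T k y hy]
    · rw [htm', htm y (by omega), (hφ.ext.trans hψ.ext).tm y hy]
    · rw [hM]
      exact (hφ.ext.trans hψ.ext).Q p hp
  · omega
  · omega
  · omega
  · intro y hy
    rw [htm', Function.update_of_ne (by omega)]
    exact hG.fresh y (by omega)
  · rw [hM, htm', hn]
    have hs := ((hG.sound.put_one r σ.pn).mono (n' := r + 2) (by omega)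
      (tm' := Function.update σ₂.tm r (op φ ψ)) (fun y hy => htm y (by omega)))
    refine (((hs.rule ?_).rule ?_).rule ?_).rule ?_
    · exact ⟨⟨by omega, by omega⟩, ⟨by omega, by omega⟩, ⟨by omega, by omega⟩,
        fun Γ k _ => hop.left A _ a b r e1 e2 e3 hr Γ k⟩
    · exact ⟨⟨by omega, by omega⟩, ⟨by omega, by omega⟩, ⟨by omega, by omega⟩,
        fun Γ k _ => hop.right A _ a b r e1 e2 e3 hr Γ k⟩
    · exact ⟨⟨by omega, by omega⟩, ⟨by omega, by omega⟩, ⟨by omega, by omega⟩,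
        fun Γ k k' => hop.both A _ a b r e1 e2 e3 hr Γ k k'⟩
    · exact ⟨⟨by omega, by omega⟩, ⟨by omega, by omega⟩, ⟨by omega, by omega⟩,
        fun Γ k k' => hop.both A _ a b r e1 e2 e3 hr Γ k' k⟩
  · rw [hn, hop.size]
    omega
  · rw [hM, hpn]
    simp only [Tab.rule_T, Tab.put_T, Nat.reduceEqDiff, false_and, if_false, true_and, if_true]
  · rw [htm', hpn, Function.update_self]
  · rw [hpn]
    refine hop.tree _ _ _ _ _ a b r ?_ ?_ (by omega) ?_
    · have ht := hφ.tree
      rw [hae] at ht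
      refine ht.congr (fun k y _ k1 k2 => ?_) (fun p hp => ?_) (fun y k1 k2 => ?_)
      · rw [hT k y (by omega) (by omega) (by omega) (by omega) (by omega), hψ.ext.T _ _ (by omega)]
      · rw [hM]
        exact hψ.ext.Q p hp
      · rw [htm', htm y (by omega), hψ.ext.tm _ (by omega)]
    · have ht := hψ.tree
      rw [hbe, ← h2', hae] at ht
      refine ht.congr (fun k y _ k1 k2 => ?_) (fun p hp => ?_) (fun y k1 k2 => ?_)
      · rw [hT k y (by omega) (by omega) (by omega) (by omega) (by omega)]
      · rw [hM]
        exact hp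
      · rw [htm', htm y (by omega)]
    · rw [hM]
      have n1 : b ≠ a := by omega
      -- With even `a`, `b` distinct and `u`, `v` the two offsets, the four rules are stored at four
      -- different nodes and none overwrites another.
      have hcase : (u = 0 ∧ v = 1) ∨ (u = 1 ∧ v = 0) := by omega
      constructor <;> simp only [Tab.rule_T, Nat.reduceEqDiff, false_and, if_false, true_and]
      all_goals
        constructor
        all_goals
          repeat' split_ifs
          all_goals omega
  · intro y
    rw [hM, ← hφ.cuts, ← hψ.cuts]
    simp [Tab.rule_T, Tab.put_T]

theorem PSt.readTerm (φ : Term) (hσ : σ.Good A) :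
    PSt.ReadTerm A φ σ (φ.encode.foldl PSt.step σ) := by
  induction φ generalizing σ with
  | var k =>
    have e : Term.var k = .var (k + 8 - 8) := by simp
    simp only [Term.encode, List.foldl_cons, List.foldl_nil]
    have hs : σ.step (k + 8) = (σ.leaf (.var k)).next := by
      unfold PSt.step
      rw [if_neg (by omega), if_neg (by omega), if_neg (by omega), if_neg (by omega),
        if_neg (by omega), if_neg (by omega), if_neg (by omega), if_neg (by omega), ← e]
    rw [hs]
    exact PSt.readTerm_leaf hσ _ ⟨le_rfl, Function.update_self ..⟩ rfl
  | bot =>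
    have hs : σ.step 3 = ((σ.leaf .bot).mark σ.n σ.n).next := rfl
    simp only [Term.encode, List.foldl_cons, List.foldl_nil, hs]
    refine PSt.readTerm_mark hσ _ ⟨le_rfl, Tab.mem_mark.2 (.inr rfl)⟩ rfl
      ⟨hσ.two_le, by omega⟩ ?_
    -- The one-formula sequent for the constant `0` is recorded as the pair of its left node with
    -- itself.
    rw [annAt_even hσ.even, PSt.leaf_tm, sequent_self]
    exact sequent_comm none _ ▸ .leftBot
  | top =>
    have hs : σ.step 4 = ((σ.leaf .top).mark (σ.n + 1) (σ.n + 1)).next := rfl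
    simp only [Term.encode, List.foldl_cons, List.foldl_nil, hs]
    refine PSt.readTerm_mark hσ _ ⟨le_rfl, Tab.mem_mark.2 (.inr rfl)⟩ rfl
      ⟨by have := hσ.two_le; omega, by omega⟩ ?_
    rw [annAt_odd hσ.even, PSt.leaf_tm, sequent_self]
    exact sequent_comm none _ ▸ .rightTop
  | neg φ ih =>
    simp only [Term.encode, List.foldl_append, List.foldl_cons, List.foldl_nil]
    exact (ih hσ).neg hσ
  | and φ ψ ihφ ihψ =>
    simp only [Term.encode, List.foldl_append, List.foldl_cons, List.foldl_nil]
    exact (ihφ hσ).bin binSound_and hσ (ihψ (ihφ hσ).good)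
  | or φ ψ ihφ ihψ =>
    simp only [Term.encode, List.foldl_append, List.foldl_cons, List.foldl_nil]
    exact (ihφ hσ).bin binSound_or hσ (ihψ (ihφ hσ).good)

end ReadTerm
end OL

namespace OL

/-! ### Reading annotated formulas, the goal and the axioms -/

open AFormula

/-- The parser has an annotated formula at the node `k`, and cuts are made on this node. -/
def NodeAt (σ : PSt) (x : AFormula) (k : ℕ) : Prop :=
  ∃ lo φ r, 2 ≤ lo ∧ Tree σ.M σ.tm lo φ r ∧ r % 2 = 0 ∧ r + 1 < σ.n ∧ σ.M.T 4 r = r + 1 ∧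
    σ.M.T 4 (r + 1) = r ∧ σ.tm r = φ ∧ ((x = L φ ∧ k = r) ∨ (x = R φ ∧ k = r + 1))

/-- The nodes `k₁` and `k₂` represent the sequent `S`. -/
def SeqNodes (σ : PSt) : Seq → ℕ → ℕ → Prop
  | (some x, some y), k₁, k₂ => NodeAt σ x k₁ ∧ NodeAt σ y k₂
  | (some x, none), k₁, k₂ => NodeAt σ x k₁ ∧ k₂ = k₁
  | (none, some x), k₁, k₂ => NodeAt σ x k₁ ∧ k₂ = k₁
  | (none, none), k₁, k₂ => IsNode σ.n k₁ ∧ k₂ = k₁ ∧ annAt σ.tm k₁ = L .top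

section ReadSeq

variable {A : Set (Set AFormula)} {σ σ' σ₁ σ₂ : PSt}

theorem NodeAt.mono {x : AFormula} {k : ℕ} (h : NodeAt σ x k) (he : σ.Ext σ') : NodeAt σ' x k := by
  obtain ⟨lo, φ, r, h1, h2, h3, h4, h5, h6, h7, h8⟩ := h
  refine ⟨lo, φ, r, h1, h2.congr (fun k y _ _ hy => he.T k y (by omega)) he.Q
    (fun y _ hy => he.tm y (by omega)), h3, h4.trans_le he.n, ?_, ?_, ?_, h8⟩
  · rw [he.T _ _ (by omega), h5]
  · rw [he.T _ _ (by omega), h6]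
  · rw [he.tm _ (by omega), h7]

theorem SeqNodes.mono {S : Seq} {k₁ k₂ : ℕ} (h : SeqNodes σ S k₁ k₂) (he : σ.Ext σ') :
    SeqNodes σ' S k₁ k₂ := by
  obtain ⟨_ | x, _ | y⟩ := S
  · exact ⟨h.1.mono he.n, h.2.1, (annAt_congr he.tm h.1.2).trans h.2.2⟩
  · exact ⟨h.1.mono he, h.2⟩
  · exact ⟨h.1.mono he, h.2⟩
  · exact ⟨h.1.mono he, h.2.mono he⟩

theorem NodeAt.isNode {x : AFormula} {k : ℕ} (h : NodeAt σ x k) : IsNode σ.n k := by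
  obtain ⟨lo, φ, r, h1, h2, h3, h4, h5, h6, h7, h8⟩ := h
  have := h2.le
  rcases h8 with ⟨-, rfl⟩ | ⟨-, rfl⟩
  · exact ⟨by omega, by omega⟩
  · exact ⟨by omega, by omega⟩

theorem NodeAt.annAt {x : AFormula} {k : ℕ} (h : NodeAt σ x k) : annAt σ.tm k = x := by
  obtain ⟨lo, φ, r, h1, h2, h3, h4, h5, h6, h7, h8⟩ := h
  rcases h8 with ⟨rfl, rfl⟩ | ⟨rfl, rfl⟩
  · rw [annAt_even h3, h7]
  · rw [annAt_odd h3, h7]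

theorem SeqNodes.isNode {S : Seq} {k₁ k₂ : ℕ} (h : SeqNodes σ S k₁ k₂) :
    IsNode σ.n k₁ ∧ IsNode σ.n k₂ := by
  obtain ⟨_ | x, _ | y⟩ := S
  · exact ⟨h.1, h.2.1 ▸ h.1⟩
  · exact ⟨h.1.isNode, h.2 ▸ h.1.isNode⟩
  · exact ⟨h.1.isNode, h.2 ▸ h.1.isNode⟩
  · exact ⟨h.1.isNode, h.2.isNode⟩

/-- The empty sequent is represented by a left node of the constant `1`, taken twice. Cutting with
the right rule for `1` shows that this sequent is provable only if the empty one is. -/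
theorem SeqNodes.provable_iff {S : Seq} {k₁ k₂ : ℕ} (h : SeqNodes σ S k₁ k₂) :
    Provable A (sequent (some (annAt σ.tm k₁)) (some (annAt σ.tm k₂))) ↔ Provable A S.toSet := by
  obtain ⟨_ | x, _ | y⟩ := S
  · obtain ⟨-, rfl, h⟩ := h
    rw [h, sequent_self]
    exact ⟨fun h => .cut none none .top .rightTop h, fun h => (Provable.weaken none _ h).symm⟩
  · obtain ⟨h, rfl⟩ := h
    rw [h.annAt, sequent_self, sequent_comm]
    rfl
  · obtain ⟨h, rfl⟩ := h
    rw [h.annAt, sequent_self]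
    rfl
  · rw [h.1.annAt, h.2.annAt]
    rfl

/-- The set `F` contains all nodes on which cuts are made. -/
def Flagged (σ : PSt) (F : Finset ℕ) : Prop := ∀ y, σ.M.T 4 y ≠ 0 → y ∈ F

/-- The parser has read some annotated formulas. -/
structure PSt.Reads (A : Set (Set AFormula)) (c : ℕ) (σ σ' : PSt) : Prop where
  ext : σ.Ext σ'
  good : σ'.Good A
  flag : ∀ F, Flagged σ F → ∃ F', Flagged σ' F' ∧ F'.card ≤ F.card + c

theorem PSt.Reads.trans {c c' : ℕ} (h : PSt.Reads A c σ σ₁) (h' : PSt.Reads A c' σ₁ σ₂) :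
    PSt.Reads A (c + c') σ σ₂ := by
  refine ⟨h.ext.trans h'.ext, h'.good, fun F hF => ?_⟩
  obtain ⟨F₁, h1, h2⟩ := h.flag F hF
  obtain ⟨F₂, h3, h4⟩ := h'.flag F₁ h1
  exact ⟨F₂, h3, by omega⟩

/-- The parts of the state of the parser that only the ends of sequents change. -/
structure PSt.Same (σ σ' : PSt) : Prop where
  g₁ : σ'.g₁ = σ.g₁
  g₂ : σ'.g₂ = σ.g₂
  e : σ'.e = σ.e

theorem PSt.Reads.refl (hσ : σ.Good A) : PSt.Reads A 0 σ σ :=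
  ⟨⟨le_rfl, fun _ _ _ => rfl, fun _ _ => rfl, fun _ h => h⟩, hσ, fun F hF => ⟨F, hF, le_rfl⟩⟩

/-- The offset `u` codes the side. Whatever the side, both nodes of the root are flagged for cuts,
which accounts for the `2`. -/
theorem PSt.reads_annot (hσ : σ.Good A) (φ : Term) {u : ℕ} (hu : u ≤ 1) {σ' : PSt}
    (hσ' : ((φ.encode.foldl PSt.step σ).annot u).next = σ') :
    PSt.Reads A 2 σ σ' ∧ σ.Same σ' ∧
      ∃ k, (∀ x, (x = L φ ∧ u = 0) ∨ (x = R φ ∧ u = 1) → NodeAt σ' x k) ∧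
        σ'.s₁ = (if σ.s₁ = 0 then k else σ.s₁) ∧ σ'.s₂ = k := by
  have h := PSt.readTerm φ hσ
  revert h hσ'
  generalize φ.encode.foldl PSt.step σ = σ₁
  rintro rfl h
  have h1 := h.good.even
  have h2 := h.good.pn
  have h3 := hσ.pn
  have h4 := hσ.two_le
  have h5 := h.tree.le
  have hre : σ₁.pn % 2 = 0 := by omega
  have hM : (σ₁.annot u).next.M = (σ₁.M.put 4 σ₁.pn (σ₁.pn + 1)).put 4 (σ₁.pn + 1) σ₁.pn := rfl
  have hn : (σ₁.annot u).next.n = σ₁.n + 2 := rfl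
  have htm : (σ₁.annot u).next.tm = σ₁.tm := rfl
  have hT : ∀ k y, k ≠ 4 ∨ y < σ₁.pn → (σ₁.annot u).next.M.T k y = σ₁.M.T k y := by
    intro k y hky
    rw [hM, Tab.put_T, Tab.put_T, if_neg (by omega), if_neg (by omega)]
  refine ⟨⟨⟨?_, ?_, h.ext.tm, h.ext.Q⟩, ⟨?_, ?_, rfl, ?_, ?_⟩, ?_⟩, ⟨h.g₁, h.g₂, h.e⟩, σ₁.pn + u,
    ?_, ?_, rfl⟩
  · exact h.ext.n.trans (by omega)
  · intro k y hy
    rw [hT k y (.inr (by omega)), h.ext.T k y hy]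
  · omega
  · omega
  · intro y hy
    exact h.good.fresh y (by omega)
  · have hs := h.good.sound.mono (n' := σ₁.n + 2) (tm' := σ₁.tm) (by omega) fun _ _ => rfl
    refine (hs.put_cut ⟨by omega, by omega⟩ ⟨by omega, by omega⟩ ?_).put_cut
      ⟨by omega, by omega⟩ ⟨by omega, by omega⟩ ?_
    · rw [annAt_even hre, annAt_odd hre]
      rfl
    · rw [annAt_even hre, annAt_odd hre]
      rfl
  · intro F hF
    refine ⟨insert σ₁.pn (insert (σ₁.pn + 1) F), fun y hy => ?_, ?_⟩
    · rw [hM, Tab.put_T, Tab.put_T] at hy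
      by_cases e1 : y = σ₁.pn
      · simp [e1]
      by_cases e2 : y = σ₁.pn + 1
      · simp [e2]
      rw [if_neg (by tauto), if_neg (by tauto), h.cuts] at hy
      simp [hF y hy]
    · exact (Finset.card_insert_le _ _).trans (Nat.succ_le_succ (Finset.card_insert_le _ _))
  · intro x hx
    refine ⟨σ.n, φ, σ₁.pn, h4, h.tree.congr (fun k y hk _ _ => hT k y (.inl (by omega)))
      (fun _ hp => hp) (fun _ _ _ => rfl), hre, by omega, ?_, ?_, h.tm, ?_⟩
    · rw [hM]
      simp [Tab.put_T]
    · rw [hM]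
      simp [Tab.put_T]
    · rcases hx with ⟨rfl, rfl⟩ | ⟨rfl, rfl⟩
      · exact .inl ⟨rfl, rfl⟩
      · exact .inr ⟨rfl, rfl⟩
  · rw [← h.s₁]
    rfl

theorem PSt.reads_formula (hσ : σ.Good A) (x : AFormula) {σ' : PSt}
    (hσ' : x.encode.foldl PSt.step σ = σ') :
    PSt.Reads A 2 σ σ' ∧ σ.Same σ' ∧ ∃ k, NodeAt σ' x k ∧
      σ'.s₁ = (if σ.s₁ = 0 then k else σ.s₁) ∧ σ'.s₂ = k := by
  cases x with
  | L φ =>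
    simp only [AFormula.encode, List.foldl_append, List.foldl_cons, List.foldl_nil] at hσ'
    obtain ⟨h1, h2, k, h3, h4, h5⟩ := PSt.reads_annot hσ φ (u := 0) (by omega) hσ'
    exact ⟨h1, h2, k, h3 _ (.inl ⟨rfl, rfl⟩), h4, h5⟩
  | R φ =>
    simp only [AFormula.encode, List.foldl_append, List.foldl_cons, List.foldl_nil] at hσ'
    obtain ⟨h1, h2, k, h3, h4, h5⟩ := PSt.reads_annot hσ φ (u := 1) (by omega) hσ'
    exact ⟨h1, h2, k, h3 _ (.inr ⟨rfl, rfl⟩), h4, h5⟩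

theorem PSt.reads_slots (hσ : σ.Good A) (hs : σ.s₁ = 0) (S : Seq) {σ' : PSt}
    (hσ' : (slotEncode S.1 ++ slotEncode S.2).foldl PSt.step σ = σ') :
    PSt.Reads A 4 σ σ' ∧ σ.Same σ' ∧ (S = (none, none) → σ'.s₁ = 0) ∧
      (S ≠ (none, none) → σ'.s₁ ≠ 0 ∧ SeqNodes σ' S σ'.s₁ σ'.s₂) := by
  have weak : ∀ {c σ'}, c ≤ 4 → PSt.Reads A c σ σ' → PSt.Reads A 4 σ σ' := by
    intro c σ' hc h
    refine ⟨h.ext, h.good, fun F hF => ?_⟩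
    obtain ⟨F', h1, h2⟩ := h.flag F hF
    exact ⟨F', h1, by omega⟩
  have single : ∀ x, x.encode.foldl PSt.step σ = σ' →
      PSt.Reads A 4 σ σ' ∧ σ.Same σ' ∧ σ'.s₁ ≠ 0 ∧ NodeAt σ' x σ'.s₁ ∧ σ'.s₂ = σ'.s₁ := by
    intro x hx
    obtain ⟨h1, h2, k, h3, h4, h5⟩ := PSt.reads_formula hσ x hx
    rw [if_pos hs] at h4
    have := h3.isNode.1
    exact ⟨weak (by omega) h1, h2, by omega, h4 ▸ h3, by omega⟩
  obtain ⟨_ | x, _ | y⟩ := S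
  · simp only [slotEncode, List.append_nil, List.foldl_nil] at hσ'
    subst hσ'
    exact ⟨weak (by omega) (PSt.Reads.refl hσ), ⟨rfl, rfl, rfl⟩, fun _ => hs,
      fun h => absurd rfl h⟩
  · simp only [slotEncode, List.nil_append] at hσ'
    obtain ⟨h1, h2, h3, h4, h5⟩ := single y hσ'
    exact ⟨h1, h2, fun h => absurd h (by simp), fun _ => ⟨h3, h4, h5⟩⟩
  · simp only [slotEncode, List.append_nil] at hσ'
    obtain ⟨h1, h2, h3, h4, h5⟩ := single x hσ'
    exact ⟨h1, h2, fun h => absurd h (by simp), fun _ => ⟨h3, h4, h5⟩⟩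
  · simp only [slotEncode, List.foldl_append] at hσ'
    obtain ⟨h1, h2, k, h3, h4, h5⟩ := PSt.reads_formula hσ x rfl
    obtain ⟨j1, j2, k', j3, j4, j5⟩ := PSt.reads_formula h1.good y hσ'
    rw [if_pos hs] at h4
    have hk := h3.isNode.1
    rw [if_neg (by omega), h4] at j4
    refine ⟨h1.trans j1, ⟨j2.g₁.trans h2.g₁, j2.g₂.trans h2.g₂, j2.e.trans h2.e⟩,
      fun h => absurd h (by simp), fun _ => ⟨by omega, ?_, ?_⟩⟩
    · rw [j4]
      exact h3.mono j1.ext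
    · rw [j5]
      exact j3

theorem PSt.Good.endSeq_next {σ' : PSt} (hσ : σ.Good A) (hn : σ'.n = σ.n + 2) (hpn : σ'.pn = σ.n)
    (htm : σ'.tm = σ.tm) (hM : σ'.M.Sound A σ.tm (σ.n + 2)) : σ'.Good A := by
  have h1 := hσ.even
  have h2 := hσ.two_le
  refine ⟨by omega, by omega, by omega, fun y hy => ?_, ?_⟩
  · rw [htm]
    exact hσ.fresh y (by omega)
  · rw [htm, hn]
    exact hM

/-- An empty goal is represented by the node of its end mark: no term is read there, so `fresh`
assigns it the constant `1`. -/
theorem PSt.reads_goal (hσ : σ.Good A) (hs : σ.s₁ = 0) (hg : σ.g₁ = 0) (S : Seq) {σ' : PSt}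
    (hσ' : S.encode.foldl PSt.step σ = σ') :
    PSt.Reads A 4 σ σ' ∧ σ'.s₁ = 0 ∧ σ'.g₁ ≠ 0 ∧ σ'.e = σ.e ∧ SeqNodes σ' S σ'.g₁ σ'.g₂ := by
  rw [Seq.encode, List.foldl_append] at hσ'
  obtain ⟨h1, h2, h3, h4⟩ := PSt.reads_slots hσ hs S rfl
  revert h1 h2 h3 h4 hσ'
  generalize (slotEncode S.1 ++ slotEncode S.2).foldl PSt.step σ = σ₁
  intro hσ' h1 h2 h3 h4
  simp only [List.foldl_cons, List.foldl_nil] at hσ'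
  have hstep : σ₁.step 0 = σ₁.endSeq.next := rfl
  rw [hstep, PSt.endSeq] at hσ'
  have hg₁ : σ₁.g₁ = 0 := h2.g₁.trans hg
  have hG := h1.good
  have hsound := hG.sound.mono (n' := σ₁.n + 2) (tm' := σ₁.tm) (by omega) fun _ _ => rfl
  have ext : ∀ σ', σ'.n = σ₁.n + 2 → σ'.pn = σ₁.n → σ'.tm = σ₁.tm → σ'.M = σ₁.M →
      σ₁.Ext σ' ∧ PSt.Reads A 4 σ σ' := by
    intro σ' k1 k2 k3 k4
    have he : σ₁.Ext σ' := ⟨by omega, fun k y _ => by rw [k4], fun y _ => by rw [k3],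
      fun p hp => by rw [k4]; exact hp⟩
    refine ⟨he, h1.ext.trans he, hG.endSeq_next k1 k2 k3 (k4 ▸ hsound), fun F hF => ?_⟩
    obtain ⟨F', j1, j2⟩ := h1.flag F hF
    exact ⟨F', fun y hy => j1 y (k4 ▸ hy), j2⟩
  by_cases hS : S = (none, none)
  · rw [if_pos (h3 hS), if_pos hg₁] at hσ'
    subst hσ'
    refine ⟨(ext ({ σ₁ with g₁ := σ₁.n, g₂ := σ₁.n } : PSt).next rfl rfl rfl rfl).2, h3 hS, ?_, h2.e, ?_⟩
    · have := hG.two_le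
      simp only [PSt.next]
      omega
    · subst hS
      refine ⟨⟨hG.two_le, ?_⟩, rfl, ?_⟩
      · simp only [PSt.next]
        omega
      · simp only [PSt.next]
        rw [annAt_even hG.even, hG.fresh _ le_rfl]
  · obtain ⟨h5, h6⟩ := h4 hS
    rw [if_neg h5, if_pos hg₁] at hσ'
    subst hσ'
    obtain ⟨k1, k2⟩ := ext ({ σ₁ with s₁ := 0, g₁ := σ₁.s₁, g₂ := σ₁.s₂ } : PSt).next
      rfl rfl rfl rfl
    exact ⟨k2, rfl, h5, h2.e, h6.mono k1⟩

theorem PSt.reads_axiom (hσ : σ.Good A) (hs : σ.s₁ = 0) (hg : σ.g₁ ≠ 0) (S : Seq)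
    (hS : S.toSet ∈ A) {σ' : PSt} (hσ' : S.encode.foldl PSt.step σ = σ') :
    PSt.Reads A 4 σ σ' ∧ σ'.s₁ = 0 ∧ σ'.g₁ = σ.g₁ ∧ σ'.g₂ = σ.g₂ ∧
      (S = (none, none) → σ'.e = 1) ∧
      (S ≠ (none, none) → σ'.e = σ.e ∧ ∃ k₁ k₂, SeqNodes σ' S k₁ k₂ ∧ (k₁, k₂) ∈ σ'.M.Q) := by
  rw [Seq.encode, List.foldl_append] at hσ'
  obtain ⟨h1, h2, h3, h4⟩ := PSt.reads_slots hσ hs S rfl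
  revert h1 h2 h3 h4 hσ'
  generalize (slotEncode S.1 ++ slotEncode S.2).foldl PSt.step σ = σ₁
  intro hσ' h1 h2 h3 h4
  simp only [List.foldl_cons, List.foldl_nil] at hσ'
  have hstep : σ₁.step 0 = σ₁.endSeq.next := rfl
  rw [hstep, PSt.endSeq] at hσ'
  have hg₁ : σ₁.g₁ ≠ 0 := by rw [h2.g₁]; exact hg
  have hG := h1.good
  have hsound := hG.sound.mono (n' := σ₁.n + 2) (tm' := σ₁.tm) (by omega) fun _ _ => rfl
  have ext : ∀ σ', σ'.n = σ₁.n + 2 → σ'.pn = σ₁.n → σ'.tm = σ₁.tm → σ'.M.T = σ₁.M.T →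
      (∀ p ∈ σ₁.M.Q, p ∈ σ'.M.Q) → σ'.M.Sound A σ₁.tm (σ₁.n + 2) →
      σ₁.Ext σ' ∧ PSt.Reads A 4 σ σ' := by
    intro σ' k1 k2 k3 k4 k5 k6
    have he : σ₁.Ext σ' := ⟨by omega, fun k y _ => by rw [k4], fun y _ => by rw [k3], k5⟩
    refine ⟨he, h1.ext.trans he, hG.endSeq_next k1 k2 k3 k6, fun F hF => ?_⟩
    obtain ⟨F', j1, j2⟩ := h1.flag F hF
    exact ⟨F', fun y hy => j1 y (k4 ▸ hy), j2⟩
  by_cases hS' : S = (none, none)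
  · rw [if_pos (h3 hS'), if_neg hg₁] at hσ'
    subst hσ'
    exact ⟨(ext ({ σ₁ with e := 1 } : PSt).next rfl rfl rfl rfl (fun _ h => h) hsound).2, h3 hS', h2.g₁, h2.g₂, fun _ => rfl,
      fun h => absurd hS' h⟩
  · obtain ⟨h5, h6⟩ := h4 hS'
    rw [if_neg h5, if_neg hg₁] at hσ'
    subst hσ'
    obtain ⟨n1, n2⟩ := h6.isNode
    obtain ⟨k1, k2⟩ := ext ({ σ₁ with s₁ := 0, M := σ₁.M.mark σ₁.s₁ σ₁.s₂ } : PSt).next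
      rfl rfl rfl rfl (fun p hp => Tab.mem_mark.2 (.inl hp))
      (hsound.mark (n1.mono (by omega)) (n2.mono (by omega)) (h6.provable_iff.2 (.ax _ _ hS)))
    exact ⟨k2, rfl, h2.g₁, h2.g₂, fun h => absurd h hS', fun _ => ⟨h2.e, σ₁.s₁, σ₁.s₂,
      h6.mono k1, Tab.mem_mark.2 (.inr rfl)⟩⟩

theorem PSt.reads_axioms (axs : List Seq) (hA : ∀ S ∈ axs, S.toSet ∈ A) (hσ : σ.Good A)
    (hs : σ.s₁ = 0) (hg : σ.g₁ ≠ 0) {σ' : PSt}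
    (hσ' : (axs.flatMap Seq.encode).foldl PSt.step σ = σ') :
    PSt.Reads A (4 * axs.length) σ σ' ∧ σ'.g₁ = σ.g₁ ∧ σ'.g₂ = σ.g₂ ∧
      ((none, none) ∉ axs → σ'.e = σ.e) ∧ (σ.e ≠ 0 ∨ (none, none) ∈ axs → σ'.e ≠ 0) ∧
      ∀ S ∈ axs, S ≠ (none, none) → ∃ k₁ k₂, SeqNodes σ' S k₁ k₂ ∧ (k₁, k₂) ∈ σ'.M.Q := by
  induction axs generalizing σ with
  | nil =>
    simp only [List.flatMap_nil, List.foldl_nil] at hσ'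
    subst hσ'
    exact ⟨PSt.Reads.refl hσ, rfl, rfl, fun _ => rfl, fun h => h.elim id (by simp), by simp⟩
  | cons S axs ih =>
    rw [List.flatMap_cons, List.foldl_append] at hσ'
    obtain ⟨h1, h2, h3, h4, h5, h6⟩ := PSt.reads_axiom hσ hs hg S (hA S (by simp)) rfl
    obtain ⟨j1, j2, j3, j4, j5, j6⟩ := ih (fun S' hS' => hA S' (by simp [hS'])) h1.good h2
      (by rw [h3]; exact hg) hσ'
    refine ⟨?_, j2.trans h3, j3.trans h4, ?_, ?_, ?_⟩
    · have := h1.trans j1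
      rw [List.length_cons, Nat.mul_succ, Nat.add_comm]
      exact this
    · intro hn
      rw [List.mem_cons, not_or] at hn
      exact (j4 hn.2).trans (h6 (Ne.symm hn.1)).1
    · intro h
      by_cases hS : S = (none, none)
      · exact j5 (.inl (by rw [h5 hS]; omega))
      · refine j5 (h.imp (fun h => by rwa [(h6 hS).1]) fun h => ?_)
        rcases List.mem_cons.1 h with h | h
        · exact absurd h.symm hS
        · exact h
    · intro S' hS' hne
      rcases List.mem_cons.1 hS' with rfl | hS'
      · obtain ⟨-, k₁, k₂, k3, k4⟩ := h6 hne
        exact ⟨k₁, k₂, k3.mono j1.ext, j1.ext.Q _ k4⟩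
      · exact j6 S' hS' hne

theorem PSt.good_init : PSt.init.Good A where
  even := rfl
  two_le := le_rfl
  pn := rfl
  fresh _ _ := rfl
  sound := ⟨fun _ h => absurd rfl h, fun _ h => absurd rfl h, fun _ h => absurd h (by simp [init])⟩

/-- What the parser has found in the end. -/
structure PSt.Parsed (P : Problem) (σ : PSt) : Prop where
  good : σ.Good P.axiomSet
  goal : SeqNodes σ P.goal σ.g₁ σ.g₂
  flag : ∃ F, Flagged σ F ∧ F.card ≤ 4 * (1 + P.axs.length)
  e : σ.e ≠ 0 ↔ (none, none) ∈ P.axs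
  axs : ∀ S ∈ P.axs, S ≠ (none, none) → ∃ k₁ k₂, SeqNodes σ S k₁ k₂ ∧ (k₁, k₂) ∈ σ.M.Q

theorem PSt.parsed_run (P : Problem) : PSt.Parsed P (PSt.run P.encode) := by
  obtain ⟨h1, h2, h3, h4, h5⟩ := PSt.reads_goal (PSt.good_init (A := P.axiomSet)) rfl rfl P.goal rfl
  obtain ⟨j1, j2, j3, j4, j5, j6⟩ := PSt.reads_axioms P.axs (A := P.axiomSet)
    (fun S hS => ⟨S, hS, rfl⟩) h1.good h2 h3 rfl
  have e : PSt.run P.encode = (P.axs.flatMap Seq.encode).foldl PSt.step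
      (P.goal.encode.foldl PSt.step PSt.init) := by
    rw [PSt.run, Problem.encode, List.foldl_append]
  rw [← e] at j1 j2 j3 j4 j5 j6
  refine ⟨j1.good, ?_, ?_, ⟨fun h => ?_, fun h => j5 (.inr h)⟩, j6⟩
  · rw [j2, j3]
    exact h5.mono j1.ext
  · obtain ⟨F, k1, k2⟩ := (h1.trans j1).flag ∅ fun y hy => absurd rfl hy
    -- Four flagged nodes at most for each sequent: two formulas, with two nodes each.
    exact ⟨F, k1, by simpa [Nat.mul_add] using k2⟩
  · by_contra hn
    exact h ((j4 hn).trans h4)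

end ReadSeq

/-! ### Occurrences of variables -/

theorem PSt.step_tm (σ : PSt) (c : ℕ) :
    (∀ y ≠ σ.n, (σ.step c).tm y = σ.tm y) ∧ (7 < c → (σ.step c).tm σ.n = .var (c - 8)) ∧
      (c ≤ 7 → ∀ k, (σ.step c).tm σ.n = .var k → σ.tm σ.n = .var k) := by
  have key : ∀ t : Term, (∀ y ≠ σ.n, Function.update σ.tm σ.n t y = σ.tm y) := fun t y hy =>
    Function.update_of_ne hy _ _
  unfold PSt.step
  split_ifs
  · have : σ.endSeq.tm = σ.tm := by
      unfold PSt.endSeq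
      split_ifs <;> rfl
    exact ⟨fun y _ => by rw [← this]; rfl, by omega, fun _ k h => by rw [← this]; exact h⟩
  iterate 2 exact ⟨fun y _ => rfl, by omega, fun _ k h => h⟩
  iterate 2
    refine ⟨key _, by omega, fun _ k h => ?_⟩
    simp [PSt.next, PSt.mark, PSt.leaf] at h
  · refine ⟨key _, by omega, fun _ k h => ?_⟩
    simp [PSt.next, PSt.neg] at h
  iterate 2
    refine ⟨key _, by omega, fun _ k h => ?_⟩
    simp [PSt.next, PSt.bin] at h
  · exact ⟨key _, fun _ => Function.update_self .., by omega⟩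

/-- The nodes of variables can be read off the input string alone. This matches the pairs marked by
`varProg`, which looks only at the string, with the occurrences that the canonical model needs. -/
theorem PSt.var_run {l : List ℕ} {i : ℕ} (hi : i ≤ l.length) :
    (∀ j < i, 7 < l.getD j 0 → (PSt.run (l.take i)).tm (2 * j + 2) = .var (l.getD j 0 - 8)) ∧
    (∀ m k, (PSt.run (l.take i)).tm m = .var k → ∃ j < i, m = 2 * j + 2 ∧ l.getD j 0 = k + 8) := by
  induction i with
  | zero => exact ⟨by omega, fun m k h => by simp [PSt.run, PSt.init] at h⟩
  | succ i ih =>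
    obtain ⟨h1, h2⟩ := ih (by omega)
    have hn := (PSt.bounds_run (l := l) (i := i) (by omega)).n
    rw [PSt.run_take_succ hi]
    obtain ⟨s1, s2, s3⟩ := PSt.step_tm (PSt.run (l.take i)) (l.getD i 0)
    rw [hn] at s1 s2 s3
    refine ⟨fun j hj hc => ?_, fun m k hm => ?_⟩
    · rcases Nat.lt_succ_iff_lt_or_eq.1 hj with hj | rfl
      · rw [s1 _ (by omega)]
        exact h1 j hj hc
      · exact s2 hc
    · by_cases e : m = 2 * i + 2
      · subst e
        by_cases hc : 7 < l.getD i 0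
        · rw [s2 hc, Term.var.injEq] at hm
          exact ⟨i, by omega, rfl, by omega⟩
        · obtain ⟨j, hj, h3, h4⟩ := h2 _ _ (s3 (by omega) k hm)
          exact ⟨j, by omega, h3, h4⟩
      · rw [s1 _ e] at hm
        obtain ⟨j, hj, h3, h4⟩ := h2 _ _ hm
        exact ⟨j, by omega, h3, h4⟩

end OL

namespace OL

open AFormula

/-! ### Correctness of the closure -/

/-- Two nodes that stand for a provable sequent. -/
def Derivable (A : Set (Set AFormula)) (tm : ℕ → Term) (n x y : ℕ) : Prop :=
  IsNode n x ∧ IsNode n y ∧ Provable A (sequent (some (annAt tm x)) (some (annAt tm y)))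

/-- Nodes are related if their pair is in `Q`; everything else is related to everything. -/
def NodeRel (n : ℕ) (Q : List (ℕ × ℕ)) (x y : ℕ) : Prop :=
  IsNode n x → IsNode n y → (x, y) ∈ Q

theorem closedRel_derivable {l : List ℕ} {A : Set (Set AFormula)} {M : Tab} {tm : ℕ → Term}
    (h : M.Sound A tm (dim l)) : ClosedRel l M.T (Derivable A tm (dim l)) where
  bdd _ _ h := h.2.1
  symm _ _ h := ⟨h.2.1, h.1, h.2.2.symm⟩
  self _ _ h h1 h2 := ⟨h.1, ⟨h1, h2⟩, h.2.2.of_self _⟩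
  rule x y h1 h2 := by
    -- A missing entry is `0`, which is not a node, so `h2` shows that a rule is stored at `y`.
    have hr := h.rules y (by have := h2.2.1.1; omega)
    exact ⟨h1.1, hr.concl, hr.sound _ h1.2.2 h2.2.2⟩
  cut x y z hy h1 h2 := by
    refine ⟨h1.1, h2.2.1, h1.2.2.cut_dual ?_⟩
    rw [← (h.cuts y hy).2.2]
    exact h2.2.2

section Closure

variable {l : List ℕ} {M : Tab} {tm : ℕ → Term} {Q : List (ℕ × ℕ)}

theorem Done.nodeRel_rule (hD : Done l M.T Q Q.length) {y s p : ℕ} (hy : IsNode (dim l) y)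
    (hs : IsNode (dim l) s) (h1 : M.T 3 y = s) (h2 : M.T 3 s = y) (h3 : M.T 2 y = p)
    (h4 : M.T 2 s = p) {x : ℕ} (hxy : NodeRel (dim l) Q x y) (hxs : NodeRel (dim l) Q x s) :
    NodeRel (dim l) Q x p := fun hx _ => by
  have := hD.rule x y s h1 h2 (h4.trans h3.symm)
  rw [List.take_length, h3] at this
  exact this (hxy hx hy) (hxs hx hs)

/-- Numbers that are not nodes are related to everything by convention, so the relation can live on
all of `ℕ` and only pairs of nodes need the queue. -/
theorem Done.isOrtho (hD : Done l M.T Q Q.length) : IsOrtho (NodeRel (dim l) Q) where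
  symm x y h hy hx := hD.symm _ _ (by rw [List.take_length]; exact h hx hy)
  all_of_self x y h hx hy := hD.self _ _ (by rw [List.take_length]; exact h hx hx) hy.1 hy.2

theorem Done.closedAt (hD : Done l M.T Q Q.length) (hQ : ∀ p ∈ M.Q, p ∈ Q) {φ : Term} {lo r : ℕ}
    (hlo : 2 ≤ lo) (hr : r + 1 < dim l) (h : Tree M tm lo φ r) :
    ClosedAt (NodeRel (dim l) Q) (fun k m => tm m = .var k) φ r := by
  have one : ∀ {y p : ℕ}, IsNode (dim l) y → M.T 3 y = y ∧ M.T 2 y = p → ∀ x,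
      NodeRel (dim l) Q x y → NodeRel (dim l) Q x p := fun hy h x hx =>
    hD.nodeRel_rule hy hy h.1 h.1 h.2 h.2 hx hx
  induction φ generalizing lo r with
  | var k => exact h.2
  | bot => exact fun _ _ => hQ _ h.2
  | top => exact fun _ _ => hQ _ h.2
  | neg φ ih =>
    obtain ⟨a, ha, h1, h2, h3⟩ := h
    have := ha.le
    exact ⟨a, ih hlo (by omega) ha, one ⟨by omega, by omega⟩ h3, one ⟨by omega, by omega⟩ h2⟩
  | and φ ψ ihφ ihψ =>
    obtain ⟨a, b, ha, hb, h1, h2⟩ := h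
    have := ha.le
    have := hb.le
    exact ⟨a, b, ihφ hlo (by omega) ha, ihψ (by omega) (by omega) hb,
      one ⟨by omega, by omega⟩ h2.au, one ⟨by omega, by omega⟩ h2.bu, fun x =>
      hD.nodeRel_rule ⟨by omega, by omega⟩ ⟨by omega, by omega⟩ h2.av.1 h2.bv.1 h2.av.2 h2.bv.2⟩
  | or φ ψ ihφ ihψ =>
    obtain ⟨a, b, ha, hb, h1, h2⟩ := h
    have := ha.le
    have := hb.le
    exact ⟨a, b, ihφ hlo (by omega) ha, ihψ (by omega) (by omega) hb,
      one ⟨by omega, by omega⟩ h2.au, one ⟨by omega, by omega⟩ h2.bu, fun x =>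
      hD.nodeRel_rule ⟨by omega, by omega⟩ ⟨by omega, by omega⟩ h2.av.1 h2.bv.1 h2.av.2 h2.bv.2⟩

/-- `Done.cut` has the cut node second in both premises and leaves the order of the conclusion open;
symmetry of the processed queue absorbs both. -/
theorem Done.nodeRel_cut (hD : Done l M.T Q Q.length) {y q : ℕ} (hy : IsNode (dim l) y)
    (hq : IsNode (dim l) q) (hne : y ≠ q) (h1 : M.T 4 y = q) (h2 : M.T 4 q = y) {x z : ℕ}
    (hxy : NodeRel (dim l) Q x y) (hqz : NodeRel (dim l) Q q z) : NodeRel (dim l) Q x z :=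
  fun hx hz => by
  have := hD.cut x y q z h1 h2 (by have := hy.1; omega) (by have := hq.1; omega) hne
  have hs := hD.symm
  rw [List.take_length] at this hs
  exact (this (hxy hx hy) (hs _ _ (hqz hq hz))).elim id (hs _ _)

end Closure

theorem NodeAt.cutAt {l : List ℕ} {σ : PSt} {Q : List (ℕ × ℕ)} (hn : σ.n = dim l)
    (hD : Done l σ.M.T Q Q.length) (hQ : ∀ p ∈ σ.M.Q, p ∈ Q) {x : AFormula} {k : ℕ}
    (h : NodeAt σ x k) : CutAt (NodeRel (dim l) Q) (fun k m => σ.tm m = .var k) x k := by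
  obtain ⟨lo, φ, r, h1, h2, h3, h4, h5, h6, h7, h8⟩ := h
  have := h2.le
  have hc := hD.closedAt hQ h1 (hn ▸ h4) h2
  have hr : IsNode (dim l) r := ⟨by omega, by omega⟩
  have hr' : IsNode (dim l) (r + 1) := ⟨by omega, by omega⟩
  have hcut : ∀ x z, NodeRel (dim l) Q x (r + 1) → NodeRel (dim l) Q r z →
      NodeRel (dim l) Q x z := fun x z => hD.nodeRel_cut hr' hr (by omega) h6 h5
  rcases h8 with ⟨rfl, rfl⟩ | ⟨rfl, rfl⟩
  · exact ⟨hc, hcut⟩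
  · exact ⟨r, rfl, hc, hcut⟩

theorem SeqNodes.seqAt {l : List ℕ} {σ : PSt} {Q : List (ℕ × ℕ)} (hn : σ.n = dim l)
    (hD : Done l σ.M.T Q Q.length) (hQ : ∀ p ∈ σ.M.Q, p ∈ Q) {S : Seq} {k₁ k₂ : ℕ}
    (h : SeqNodes σ S k₁ k₂) :
    SeqAt (NodeRel (dim l) Q) (fun k m => σ.tm m = .var k) S k₁ k₂ := by
  obtain ⟨_ | x, _ | y⟩ := S
  · trivial
  · exact ⟨h.1.cutAt hn hD hQ, h.2⟩
  · exact ⟨h.1.cutAt hn hD hQ, h.2⟩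
  · exact ⟨h.1.cutAt hn hD hQ, h.2.cutAt hn hD hQ⟩

theorem PSt.run_n (l : List ℕ) : (PSt.run l).n = dim l := by
  have := (PSt.bounds_run (l := l) le_rfl).n
  rwa [List.take_length] at this

theorem derivable_varPair {l : List ℕ} {A : Set (Set AFormula)} {i j : ℕ} {p : ℕ × ℕ}
    (hi : i < l.length) (hj : j < l.length) (h : VarPair l i j p) :
    Derivable A (PSt.run l).tm (dim l) p.1 p.2 := by
  obtain ⟨h1, h2, rfl⟩ := h
  have ht := (PSt.var_run (l := l) le_rfl).1
  rw [List.take_length] at ht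
  refine ⟨⟨by omega, by unfold dim; omega⟩, ⟨by omega, by unfold dim; omega⟩, ?_⟩
  rw [annAt_even (by omega), show 2 * j + 3 = 2 * j + 2 + 1 from rfl, annAt_odd (by omega),
    ht i hi h2, ht j hj (h1 ▸ h2), h1]
  exact .hyp _

/-- The last hypothesis bounds the queue from above and yields a proof of the goal. The other ones
bound it from below, as the canonical model requires. -/
theorem decides_of_done {P : Problem} (hP : (none, none) ∉ P.axs) {Q : List (ℕ × ℕ)}
    (hD : Done P.encode (PSt.run P.encode).M.T Q Q.length)
    (hQ : ∀ p ∈ (PSt.run P.encode).M.Q, p ∈ Q)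
    (hv : ∀ p, ∀ i < P.encode.length, ∀ j < P.encode.length, VarPair P.encode i j p → p ∈ Q)
    (hs : ∀ p ∈ Q, Derivable P.axiomSet (PSt.run P.encode).tm (dim P.encode) p.1 p.2) :
    Decides P (NodeRel (dim P.encode) Q) (fun k m => (PSt.run P.encode).tm m = .var k)
      (PSt.run P.encode).g₁ (PSt.run P.encode).g₂ := by
  have hp := PSt.parsed_run P
  have hn := PSt.run_n P.encode
  have hvar := (PSt.var_run (l := P.encode) le_rfl).2
  rw [List.take_length] at hvar
  refine ⟨hD.isOrtho, ?_, hp.goal.seqAt hn hD hQ, ?_, fun h => ?_⟩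
  · intro k m n h1 h2 _ _
    obtain ⟨i, hi, rfl, hi'⟩ := hvar _ _ h1
    obtain ⟨j, hj, rfl, hj'⟩ := hvar _ _ h2
    exact hv _ i hi j hj ⟨by omega, by omega, rfl⟩
  · intro a ha
    have hne : a ≠ (none, none) := by
      rintro rfl
      exact hP ha
    obtain ⟨k₁, k₂, h1, h2⟩ := hp.axs a ha hne
    exact ⟨hne, k₁, k₂, h1.seqAt hn hD hQ, fun _ _ => hQ _ h2⟩
  · have hg := hp.goal.isNode
    rw [hn] at hg
    exact hp.goal.provable_iff.1 (hs _ (h hg.1 hg.2)).2.2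

end OL

namespace OL

open AFormula

/-! ### The program -/

/-- Compute the constants. -/
def prelude : Prog :=
  .const 10 0 ⨾ .const 11 1 ⨾ .op .add 19 0 10 ⨾ .op .add 12 0 0 ⨾ .op .add 12 12 11 ⨾
    .op .add 12 12 11 ⨾ .op .add 13 12 12 ⨾ .op .add 14 13 12 ⨾ .op .add 15 14 12 ⨾
    .op .add 16 15 12 ⨾ .op .mul 17 12 12 ⨾ .op .add 18 17 17 ⨾ .op .add 18 18 16 ⨾
    .op .add 17 17 16 ⨾ .const 20 0 ⨾ .const 21 2

/-- Write the matrix cell for the goal to the output. -/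
def outputProg : Prog := getCell 30 25 26 ⨾ .op .add 0 30 10

def closureProg : Prog := varProg ⨾ closeProg ⨾ outputProg

def decideProg : Prog := prelude ⨾ parseProg ⨾ .ite (.lt 10 27) (.const 0 1) closureProg

theorem prelude_wp {w : ℕ} {l : List ℕ} (hl : l ≠ [])
    (hw : 5 * dim l + 3 * (dim l * dim l) + 16 ≤ 2 ^ w) :
    wp w prelude (fun s => ∃ R, Rep w l PSt.init.M R s ∧ PSt.Regs PSt.init 0 R) (initState l) := by
  have h4 := four_le_dim hl
  have hD : l.length + l.length + 1 + 1 = dim l := by unfold dim; omega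
  have hD0 : 2 * l.length + 2 = dim l := rfl
  have key : ∀ R : ℕ → ℕ, ∀ s : State, s.mem = (initState l).mem → s.reg = R → Consts l R →
      R 1 = 0 → (∀ r, 20 ≤ r → R r = if r = 21 then 2 else 0) →
      ∃ R, Rep w l PSt.init.M R s ∧ PSt.Regs PSt.init 0 R := by
    rintro _ s hm rfl hc h1 h20
    -- Cells beyond the input hold `0`, which already represents empty tables, an empty matrix and
    -- an empty queue, so the quadratic memory needs no initialization.
    have hmem : ∀ a, l.length ≤ a → s.mem a = 0 := fun a ha => by
      rw [hm]
      exact List.getD_eq_default _ _ ha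
    refine ⟨s.reg, ⟨hw, h4, fun _ _ => rfl, hc, h1, fun i _ => by rw [hm]; rfl, ?_,
      fun _ _ => by simp only [PSt.init]; omega, ?_, fun j hj => absurd hj (Nat.not_lt_zero _),
      fun j hj => absurd hj (Nat.not_lt_zero _), List.nodup_nil,
      fun p hp => absurd hp List.not_mem_nil⟩, ?_⟩
    · intro k y hk _ _
      have := Nat.mul_le_mul_right (dim l) hk
      exact hmem _ (by omega)
    · intro x y _ _
      rw [if_neg (by simp [PSt.init])]
      exact hmem _ (by omega)
    · constructor <;> rw [h20 _ (by omega)] <;> simp [PSt.init]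
  simp only [prelude, wp, Op.apply, setReg_reg, Nat.reduceEqDiff, reduceIte, initState]
  have hmod : ∀ x, x ≤ 5 * dim l + 3 * (dim l * dim l) → x % 2 ^ w = x := fun x hx =>
    Nat.mod_eq_of_lt (by omega)
  have e0 : 0 % 2 ^ w = 0 := Nat.zero_mod _
  have e1 : 1 % 2 ^ w = 1 := hmod _ (by omega)
  have e2 : 2 % 2 ^ w = 2 := hmod _ (by omega)
  have e3 : (l.length + 0) % 2 ^ w = l.length := hmod _ (by omega)
  have e4 : (((l.length + l.length) % 2 ^ w + 1) % 2 ^ w + 1) % 2 ^ w = dim l := by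
    rw [hmod (l.length + l.length) (by omega), hmod (l.length + l.length + 1) (by omega), hD,
      hmod _ (by omega)]
  have e5 : (dim l + dim l) % 2 ^ w = 2 * dim l := by rw [hmod _ (by omega)]; omega
  have e6 : (2 * dim l + dim l) % 2 ^ w = 3 * dim l := by rw [hmod _ (by omega)]; omega
  have e7 : (3 * dim l + dim l) % 2 ^ w = 4 * dim l := by rw [hmod _ (by omega)]; omega
  have e8 : (4 * dim l + dim l) % 2 ^ w = 5 * dim l := by rw [hmod _ (by omega)]; omega
  have e9 : dim l * dim l % 2 ^ w = dim l * dim l := hmod _ (by omega)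
  have e10 : (dim l * dim l + dim l * dim l) % 2 ^ w = 2 * (dim l * dim l) := by
    rw [hmod _ (by omega)]; omega
  have e11 : (2 * (dim l * dim l) + 5 * dim l) % 2 ^ w = 5 * dim l + 2 * (dim l * dim l) := by
    rw [hmod _ (by omega)]; omega
  have e12 : (dim l * dim l + 5 * dim l) % 2 ^ w = 5 * dim l + dim l * dim l := by
    rw [hmod _ (by omega)]; omega
  simp only [e0, e1, e2, e3, e4, e5, e6, e7, e8, e9, e10, e11, e12]
  refine key _ _ rfl rfl ?_ ?_ ?_
  · constructor
    case tab =>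
      intro k h1 h2
      interval_cases k <;>
        simp only [setReg_reg, Nat.reduceAdd, Nat.reduceEqDiff, reduceIte, Nat.one_mul]
    all_goals simp only [setReg_reg, Nat.reduceEqDiff, reduceIte]
  · simp only [setReg_reg, Nat.reduceEqDiff, reduceIte]
  · intro r hr
    by_cases h21 : r = 21
    · subst h21
      simp only [setReg_reg, Nat.reduceEqDiff, reduceIte]
    · have : ∀ k < 20, r ≠ k := by omega
      simp only [setReg_reg, h21, reduceIte, this, Nat.reduceLT, ite_self,
        show r ≠ 0 by omega]

/-! ### Correctness of the whole program -/

section Decide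

variable {w : ℕ} {P : Problem}

theorem Problem.encode_ne_nil (P : Problem) : P.encode ≠ [] := by
  simp [Problem.encode, Seq.encode]

theorem Runs.prelude_parse {p : Prog} {T : ℕ} {Q : State → Prop} {l : List ℕ} (hl : l ≠ [])
    (hw : 5 * dim l + 3 * (dim l * dim l) + 16 ≤ 2 ^ w)
    (h : ∀ R s, Rep w l (PSt.run l).M R s → PSt.Regs (PSt.run l) l.length R → Runs w p s T Q) :
    Runs w (prelude ⨾ parseProg ⨾ p) (initState l)
      (prelude.cost + (l.length * (stepProg.cost + 1) + 1 + T)) Q := by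
  refine Runs.seq ((Runs.of_wp (prelude_wp hl hw)).mono le_rfl ?_)
  rintro s ⟨R, hs, hR⟩
  refine Runs.seq ((parseProg_ok hR s hs).mono le_rfl ?_)
  rintro s' ⟨M', R', hs', rfl, hR'⟩
  exact h R' s' hs' hR'

theorem decideProg_of_empty (hP : (none, none) ∈ P.axs)
    (hw : 5 * dim P.encode + 3 * (dim P.encode * dim P.encode) + 16 ≤ 2 ^ w) :
    Runs w decideProg (initState P.encode)
      (prelude.cost + (P.encode.length * (stepProg.cost + 1) + 1 + (1 + 1)))
      fun s => s.reg 0 = 1 := by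
  refine Runs.prelude_parse P.encode_ne_nil hw fun R s hs hR => Runs.ite (fun _ => ?_) fun h => ?_
  · refine Runs.of_wp (p := .const 0 1) ?_
    have := hs.word
    simp only [wp, setReg_reg, reduceIte]
    exact Nat.mod_eq_of_lt (by omega)
  · exfalso
    apply h
    have := (PSt.parsed_run P).e.2 hP
    simp only [Test.Sat, hs.reg 10 le_rfl, hs.reg 27 (by omega), hs.consts.zero, hR.e]
    omega

theorem output_wp {l : List ℕ} {M : Tab} {R : ℕ → ℕ} {s : State} (hs : Rep w l M R s)
    (h1 : R 25 < dim l) (h2 : R 26 < dim l) :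
    wp w outputProg (fun s => s.reg 0 = if (R 25, R 26) ∈ M.Q then 1 else 0) s := by
  refine wp_mono (p := getCell 30 25 26) (Ok.getCell (Q := fun _ R' => R' 10 = 0 ∧
    R' 30 = if (R 25, R 26) ∈ M.Q then 1 else 0) (by omega) (by omega) (by omega) h1 h2
    ⟨?_, ?_⟩ s hs) ?_
  · simp only [Function.update_apply, Nat.reduceEqDiff, reduceIte, hs.consts.zero]
  · simp only [Function.update_apply, reduceIte]
  · rintro s' ⟨M', R', hs', h10, h30⟩
    have := hs'.word
    simp only [wp, setReg_reg, reduceIte, hs'.reg 10 le_rfl, hs'.reg 30 (by omega), h10, h30,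
      Op.apply, Nat.add_zero]
    refine Nat.mod_eq_of_lt ?_
    split_ifs <;> omega

/-- A bound for the time after parsing. -/
def closureTime (ℓ f : ℕ) : ℕ :=
  varCost * ((ℓ + 1) * (ℓ + 1)) + ((2 * ℓ + 2) * (2 * ℓ + 2) *
    (closePre.cost + closePost.cost + 3 + (cutBody.cost + 1) * (f + 1)) + 3 + outputProg.cost)

theorem decideProg_of_nonempty (hP : (none, none) ∉ P.axs)
    (hw : 5 * dim P.encode + 3 * (dim P.encode * dim P.encode) + 16 ≤ 2 ^ w) :
    Runs w decideProg (initState P.encode)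
      (prelude.cost + (P.encode.length * (stepProg.cost + 1) + 1 +
        (closureTime P.encode.length (4 * (1 + P.axs.length)) + 1)))
      fun s => ∃ r isVar g₁ g₂, Decides P r isVar g₁ g₂ ∧ (r g₁ g₂ → s.reg 0 = 1) ∧
        (¬ r g₁ g₂ → s.reg 0 = 0) := by
  have hp := PSt.parsed_run P
  have hn := PSt.run_n P.encode
  have hsound := hp.good.sound
  rw [hn] at hsound
  obtain ⟨F, hF, hFc⟩ := hp.flag
  have hg := hp.goal.isNode
  rw [hn] at hg
  refine Runs.prelude_parse P.encode_ne_nil hw fun R s hs hR => Runs.ite (fun h => ?_) fun _ => ?_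
  · exfalso
    simp only [Test.Sat, hs.reg 10 le_rfl, hs.reg 27 (by omega), hs.consts.zero, hR.e] at h
    exact hP (hp.e.1 (by omega))
  refine Runs.seq ((varProg_ok _ _ s hs).mono le_rfl ?_)
  rintro s₁ ⟨M₁, R₁, hs₁, hT, hQ, hK⟩
  refine Runs.seq ((closeProg_ok (closedRel_derivable hsound) hT ?_ s₁ hs₁).mono
    (Nat.add_le_add_right ((sum_pairCost_le hF).trans
      (Nat.mul_le_mul_left _ (Nat.add_le_add_left (Nat.mul_le_mul_left _
        (Nat.add_le_add_right hFc 1)) _))) 3) ?_)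
  · intro p h
    rcases (hQ p).1 h with h | ⟨i, hi, j, hj, h⟩
    · exact hsound.pairs p h
    · exact derivable_varPair hi hj h
  rintro s₂ ⟨M₂, R₂, hs₂, hT₂, hQ₂, hG₂, hK₂, hD⟩
  have h25 : R₂ 25 = (PSt.run P.encode).g₁ := by
    rw [hK₂ _ (by omega), hK _ (by omega), hR.g₁]
  have h26 : R₂ 26 = (PSt.run P.encode).g₂ := by
    rw [hK₂ _ (by omega), hK _ (by omega), hR.g₂]
  refine (Runs.of_wp (output_wp hs₂ (h25 ▸ hg.1.2) (h26 ▸ hg.2.2))).mono le_rfl ?_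
  intro s₃ h₃
  rw [h25, h26] at h₃
  refine ⟨_, _, _, _, decides_of_done hP hD (fun p h => hQ₂ p ((hQ p).2 (.inl h)))
    (fun p i hi j hj h => hQ₂ p ((hQ p).2 (.inr ⟨i, hi, j, hj, h⟩))) hG₂, ?_, ?_⟩
  · intro h
    rw [h₃, if_pos (h hg.1 hg.2)]
  · intro h
    rw [h₃, if_neg fun h' => h fun _ _ => h']

end Decide

/-! ### Sizes and the running time -/

/-- For a power of two `m > l.length` the memory needs at most `21 * m ^ 2` cells, since `dim l ≤ 2
* m` and `2 ≤ m`. This is below `2 ^ 6 * m ^ 2 ≤ m ^ 8`, and `m ^ 8 ≤ 2 ^ w` is what the constant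
`8` in `WordsFit` provides. -/
theorem word_bound {l : List ℕ} {w : ℕ} (h : WordsFit 8 w l) :
    5 * dim l + 3 * (dim l * dim l) + 16 ≤ 2 ^ w := by
  obtain ⟨m, hm⟩ : ∃ m, m = 2 ^ (Nat.log 2 l.length + 1) := ⟨_, rfl⟩
  have h1 : l.length < m := hm ▸ Nat.lt_pow_succ_log_self (by omega) _
  have h2 : 2 ≤ m := by
    rw [hm, pow_succ]
    have := Nat.one_le_two_pow (n := Nat.log 2 l.length)
    omega
  have h3 : m ^ 8 ≤ 2 ^ w := by
    rw [hm, ← pow_mul]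
    exact Nat.pow_le_pow_right (by omega) (by rw [Nat.mul_comm]; exact h.1)
  have h4 : dim l ≤ 2 * m := by unfold dim; omega
  have h5 : dim l * dim l ≤ 2 * m * (2 * m) := Nat.mul_le_mul h4 h4
  have h6 : 2 * 2 ≤ m * m := Nat.mul_le_mul h2 h2
  have h7 : 2 * m ≤ m * m := Nat.mul_le_mul_right _ h2
  have h8 : 2 ^ 6 * (m * m) ≤ m ^ 8 := by
    rw [show m ^ 8 = m ^ 6 * (m * m) by ring]
    exact Nat.mul_le_mul_right _ (Nat.pow_le_pow_left h2 6)
  have h9 : 2 * m * (2 * m) = 4 * (m * m) := by ring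
  omega

theorem Term.length_encode (φ : Term) : φ.encode.length = φ.size := by
  induction φ <;> simp_all [Term.encode, Term.size, Nat.add_assoc]

theorem Term.one_le_size (φ : Term) : 1 ≤ φ.size := by
  cases φ <;> simp [Term.size]

theorem length_slotEncode_le (Γ : Option AFormula) :
    (slotEncode Γ).length ≤ 2 * slotSize Γ := by
  rcases Γ with _ | φ | φ
  · exact Nat.zero_le _
  all_goals
    have := φ.one_le_size
    simp only [slotEncode, AFormula.encode, slotSize, AFormula.size, List.length_append,
      Term.length_encode, List.length_singleton]
    omega

theorem Seq.length_encode_le (S : Seq) : S.encode.length ≤ 2 * S.size + 1 := by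
  have h1 := length_slotEncode_le S.1
  have h2 := length_slotEncode_le S.2
  simp only [Seq.encode, Seq.size, List.length_append, List.length_singleton]
  omega

theorem Seq.one_le_size {S : Seq} (hS : S ≠ (none, none)) : 1 ≤ S.size := by
  have key : ∀ x : AFormula, 1 ≤ x.size := fun x => by
    cases x <;> exact Term.one_le_size _
  obtain ⟨_ | x, _ | y⟩ := S
  · exact absurd rfl hS
  all_goals
    simp only [Seq.size, slotSize]
  · exact (key y).trans (by omega)
  · exact (key x).trans (by omega)
  · exact (key x).trans (by omega)

theorem Problem.length_encode_le (P : Problem) :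
    P.encode.length ≤ 2 * P.size + 1 + P.axs.length := by
  have key : ∀ A : List Seq,
      (A.flatMap Seq.encode).length ≤ 2 * (A.map Seq.size).sum + A.length := by
    intro A
    induction A with
    | nil => exact le_rfl
    | cons a A ih =>
      have := a.length_encode_le
      simp only [List.flatMap_cons, List.length_append, List.map_cons, List.sum_cons,
        List.length_cons]
      omega
  have h1 := P.goal.length_encode_le
  have h2 := key P.axs
  simp only [Problem.encode, Problem.size, List.length_append]
  omega

/-- Empty axioms have size `0` and would break this bound, which keeps the input length linear in
the size. -/
theorem Problem.length_axs_le {P : Problem} (hP : (none, none) ∉ P.axs) :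
    P.axs.length ≤ P.size := by
  have : P.axs.length ≤ (P.axs.map Seq.size).sum := by
    rw [← List.length_map Seq.size]
    refine List.length_le_sum_of_one_le _ fun i hi => ?_
    obtain ⟨a, ha, rfl⟩ := List.mem_map.1 hi
    exact Seq.one_le_size fun h => hP (h ▸ ha)
  unfold Problem.size
  omega

/-- The constant in the running time. -/
def timeConst : ℕ :=
  prelude.cost + 5 * (stepProg.cost + 1) + 2 + 25 * varCost +
    100 * (closePre.cost + closePost.cost + 3 + 5 * (cutBody.cost + 1)) + 3 + outputProg.cost

/-- Here the size does not bound the number of axioms, but after linear parsing the program answers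
at once, and the factor `1 + |A|` pays for the long input. -/
theorem time_le_of_empty (P : Problem) :
    prelude.cost + (P.encode.length * (stepProg.cost + 1) + 1 + (1 + 1)) ≤
      timeConst * (1 + P.axs.length) * (max 1 P.size) ^ 2 := by
  have h1 := P.length_encode_le
  have hN : 1 ≤ max 1 P.size := le_max_left _ _
  have hN' : P.size ≤ max 1 P.size := le_max_right _ _
  have hsq : max 1 P.size ≤ (max 1 P.size) ^ 2 := Nat.le_self_pow (by omega) _
  generalize max 1 P.size = N at *
  have hA : (1 + P.axs.length) * 1 ≤ (1 + P.axs.length) * N ^ 2 := Nat.mul_le_mul_left _ (by omega)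
  have hB : 1 * N ^ 2 ≤ (1 + P.axs.length) * N ^ 2 := Nat.mul_le_mul_right _ (by omega)
  rw [Nat.mul_assoc]
  generalize (1 + P.axs.length) * N ^ 2 = X at *
  have h2 : P.encode.length * (stepProg.cost + 1) ≤ 5 * X * (stepProg.cost + 1) :=
    Nat.mul_le_mul_right _ (by omega)
  have hX : 1 ≤ X := by omega
  have h3 : (prelude.cost + 5 * (stepProg.cost + 1) + 3) * X ≤ timeConst * X :=
    Nat.mul_le_mul_right _ (by unfold timeConst; omega)
  have h4 : (prelude.cost + 3) * 1 ≤ (prelude.cost + 3) * X := Nat.mul_le_mul_left _ hX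
  have h5 : (prelude.cost + 5 * (stepProg.cost + 1) + 3) * X =
      (prelude.cost + 3) * X + 5 * X * (stepProg.cost + 1) := by ring
  omega

/-- The factors are `(ℓ + 1) ^ 2 ≤ 25 * N ^ 2`, `(2 * ℓ + 2) ^ 2 ≤ 100 * N ^ 2` and `4 * (1 + a) + 1
≤ 5 * (1 + a)`. -/
theorem time_bound {N a ℓ : ℕ} (c₁ c₂ c₃ c₄ c₅ c₆ : ℕ) (hN : 1 ≤ N) (hℓ : ℓ + 1 ≤ 5 * N) :
    c₁ + (ℓ * c₂ + 1 + (c₆ * ((ℓ + 1) * (ℓ + 1)) + ((2 * ℓ + 2) * (2 * ℓ + 2) *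
      (c₃ + c₄ * (4 * (1 + a) + 1)) + 3 + c₅) + 1)) ≤
    (c₁ + 5 * c₂ + 2 + 25 * c₆ + 100 * (c₃ + 5 * c₄) + 3 + c₅) * (1 + a) * N ^ 2 := by
  have e1 : ℓ * c₂ ≤ 5 * c₂ * ((1 + a) * N ^ 2) := by
    calc ℓ * c₂ ≤ 5 * N * c₂ := Nat.mul_le_mul_right _ (by omega)
      _ = 5 * c₂ * (1 * N) := by ring
      _ ≤ 5 * c₂ * ((1 + a) * N ^ 2) := by gcongr <;> first | omega | exact Nat.le_self_pow (by omega) _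
  have e2 : c₆ * ((ℓ + 1) * (ℓ + 1)) ≤ 25 * c₆ * ((1 + a) * N ^ 2) := by
    calc c₆ * ((ℓ + 1) * (ℓ + 1)) ≤ c₆ * (5 * N * (5 * N)) := by gcongr
      _ = 25 * c₆ * (1 * N ^ 2) := by ring
      _ ≤ 25 * c₆ * ((1 + a) * N ^ 2) := by gcongr; omega
  have e3 : (2 * ℓ + 2) * (2 * ℓ + 2) * (c₃ + c₄ * (4 * (1 + a) + 1)) ≤
      100 * (c₃ + 5 * c₄) * ((1 + a) * N ^ 2) := by
    calc (2 * ℓ + 2) * (2 * ℓ + 2) * (c₃ + c₄ * (4 * (1 + a) + 1))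
        ≤ 10 * N * (10 * N) * (c₃ * (1 + a) + c₄ * (5 * (1 + a))) := by
          gcongr
          · omega
          · omega
          · exact Nat.le_mul_of_pos_right _ (by omega)
          · omega
      _ = 100 * (c₃ + 5 * c₄) * ((1 + a) * N ^ 2) := by ring
  have hX : 1 ≤ (1 + a) * N ^ 2 := Nat.mul_pos (by omega) (Nat.pow_pos hN)
  rw [Nat.mul_assoc (_ + c₅)]
  generalize (1 + a) * N ^ 2 = X at *
  have e4 : (c₁ + 5 + c₅) * 1 ≤ (c₁ + 5 + c₅) * X := Nat.mul_le_mul_left _ hX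
  have e5 : (c₁ + 5 * c₂ + 2 + 25 * c₆ + 100 * (c₃ + 5 * c₄) + 3 + c₅) * X = 5 * c₂ * X +
      25 * c₆ * X + 100 * (c₃ + 5 * c₄) * X + (c₁ + 5 + c₅) * X := by ring
  omega

theorem time_le_of_nonempty {P : Problem} (hP : (none, none) ∉ P.axs) :
    prelude.cost + (P.encode.length * (stepProg.cost + 1) + 1 +
      (closureTime P.encode.length (4 * (1 + P.axs.length)) + 1)) ≤
      timeConst * (1 + P.axs.length) * (max 1 P.size) ^ 2 := by
  have h0 := Problem.length_axs_le hP
  have h1 := P.length_encode_le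
  -- Without empty axioms `ℓ + 1 ≤ 2 * n + 2 + |A| ≤ 3 * n + 2`, hence at most `5 * max 1 n`.
  exact time_bound _ _ _ _ _ _ (le_max_left _ _) (by omega)

theorem Provable.of_empty {A : Set (Set AFormula)} (h : sequent none none ∈ A)
    (Γ Δ : Option AFormula) : Provable A (sequent Γ Δ) :=
  .weaken _ _ (Provable.weaken _ _ (.ax _ _ h)).symm

theorem WordProblem.nonempty_toProblem (W : WordProblem) : (none, none) ∉ W.toProblem.axs := by
  intro h
  obtain ⟨r, -, h⟩ := List.mem_map.1 h
  cases h

/-- Each relation and the query contain at least one symbol. This turns the bound `(1 + |A|) * n ^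
2` into a cubic one. -/
theorem WordProblem.length_rels_le (W : WordProblem) : 1 + W.rels.length ≤ W.size := by
  have h2 : W.toProblem.axs.length ≤ (W.rels.map fun r => r.1.size + r.2.size).sum := by
    rw [WordProblem.toProblem, List.length_map, ← List.length_map (fun r => r.1.size + r.2.size)]
    refine List.length_le_sum_of_one_le _ fun i hi => ?_
    obtain ⟨r, -, rfl⟩ := List.mem_map.1 hi
    exact r.1.one_le_size.trans (Nat.le_add_right _ _)
  rw [WordProblem.toProblem, List.length_map] at h2
  have := W.lhs.one_le_size
  unfold WordProblem.size
  omega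

end OL

/-! ### The main theorem -/

theorem mainTheorem4 :
    ∃ (p : OL.Prog) (C K : ℕ),
      (∀ (P : OL.Problem) (w : ℕ), OL.WordsFit K w P.encode →
        OL.DecidesWithin w p P.encode (C * (1 + P.axs.length) * (max 1 P.size) ^ 2)
          (OL.Provable P.axiomSet P.goal.toSet)) ∧
      (∀ (W : OL.WordProblem) (w : ℕ), OL.WordsFit K w W.encode →
        OL.DecidesWithin w p W.encode (C * W.size ^ 3) W.Holds) := by
  refine ⟨OL.decideProg, OL.timeConst, 8, fun P w hw => ?_, fun W w hw => ?_⟩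
  · by_cases hP : (none, none) ∈ P.axs
    · obtain ⟨t, s, h1, h2, h3⟩ := OL.decideProg_of_empty hP (OL.word_bound hw)
      exact ⟨t, s, h1, h2.trans (OL.time_le_of_empty P), fun _ => h3,
        fun h => absurd (OL.Provable.of_empty (A := P.axiomSet) ⟨_, hP, rfl⟩ P.goal.1 P.goal.2) h⟩
    · obtain ⟨t, s, h1, h2, r, isVar, g₁, g₂, hd, h3, h4⟩ :=
        OL.decideProg_of_nonempty hP (OL.word_bound hw)
      refine ⟨t, s, h1, h2.trans (OL.time_le_of_nonempty hP), ?_⟩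
      rw [hd.provable_iff]
      exact ⟨h3, h4⟩
  · rw [← W.encode_toProblem] at hw ⊢
    obtain ⟨t, s, h1, h2, r, isVar, g₁, g₂, hd, h3, h4⟩ :=
      OL.decideProg_of_nonempty W.nonempty_toProblem (OL.word_bound hw)
    refine ⟨t, s, h1, h2.trans ((OL.time_le_of_nonempty W.nonempty_toProblem).trans ?_), ?_⟩
    · have h5 := W.length_rels_le
      rw [W.size_toProblem, max_eq_right (by omega), OL.WordProblem.toProblem, List.length_map,
        Nat.mul_assoc, pow_succ' W.size 2]
      exact Nat.mul_le_mul_left _ (Nat.mul_le_mul_right _ h5)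
    · rw [hd.holds_iff]
      exact ⟨h3, h4⟩
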